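/- **The model.** Let $\alpha>0$, $e=\sqrt\alpha$, $m\ge 0$, let $N$ be the number of electrons and let $Z_1,\dots,Z_K\ge 0$ be nuclear charges. With the Pauli matrices $\sigma_1,\sigma_2,\sigma_3$, let $\boldsymbol\alpha=\begin{pmatrix}0&\boldsymbol\sigma\\ \boldsymbol\sigma&0\end{pmatrix}$ and $\beta=\begin{pmatrix}1&0\\0&-1\end{pmatrix}$ be the $4\times4$ Dirac matrices in standard representation. Let $\mathfrak H_+\subset L^2(\mathbb R^3;\mathbb C^4)$ be the positive spectral subspace of the free Dirac operator $-i\boldsymbol\alpha\cdot\nabla+m\beta$. - An *allowed state* is a normalized antisymmetric $\Psi\in\bigotimes_{\nu=1}^N\mathfrak H_+\subset L^2(\mathbb R^{3N};(\mathbb C^4)^{\otimes N})$ that lies in the Sobolev space $H^{1/2}$. - An *allowed vector potential* is a field $\mathbf A\in L^6(\mathbb R^3;\mathbb R^3)$ with $\nabla\cdot\mathbf A=0$ and $\mathbf B=\nabla\times\mathbf A\in L^2(\mathbb R^3;\mathbb R^3)$, both in the sense of distributions (Coulomb gauge, finite field energy, vanishing at infinity). For pairwise distinct $\mathbf R_1,\dots,\mathbf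 R_K\in\mathbb R^3$ put $$V_c=-\sum_{\nu=1}^N\sum_{\kappa=1}^K\frac{Z_\kappa}{|\mathbf r_\nu-\mathbf R_\kappa|}+\sum_{1\le\mu<\nu\le N}\frac1{|\mathbf r_\mu-\mathbf r_\nu|}+\sum_{1\le\kappa<\lambda\le K}\frac{Z_\kappa Z_\lambda}{|\mathbf R_\kappa-\mathbf R_\lambda|},$$ $D_\nu(\mathbf A)=\boldsymbol\alpha\cdot(-i\nabla_\nu+e\mathbf A(\mathbf r_\nu))+m\beta$ (with $\boldsymbol\alpha,\beta$ acting on the spin of the $\nu$-th electron), and, in the sense of quadratic forms, $$\mathcal E[\Psi,\Psi]=\Big(\Psi,\Big(\sum_{\nu=1}^N D_\nu(\mathbf A)+\alpha V_c\Big)\Psi\Big)+\frac1{8\pi}\int_{\mathbb R^3}|\mathbf B(\mathbf r)|^2\,d\mathbf r .$$ Let $E_{N,K}\in[-\infty,\infty]$ be the infimum of $\mathcal E[\Psi,\Psi]$ over all allowed vector potentials $\mathbf A$, all pairwise distinct nuclear positions $\mathbf R_1,\dots,\mathbf R_K$, and all allowed states $\Psi$. **Theorem (Instability).** There exists a universal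 number $C>0$ such that for all $\alpha>0$, all $m\ge0$, all $N,K\in\{1,2,3,\dots\}$ and all $Z_1,\dots,Z_K\ge0$ satisfying $$\sum_{\kappa=1}^K Z_\kappa>C\max\{\alpha^{-3/2},1\},\qquad N>C\max\{\alpha^{-3/2},1\},\qquad \sum_{\kappa=1}^K Z_\kappa^2>2,$$ one has $$E_{N,K}=-\infty .$$ -/

import Mathlib

open MeasureTheory Real
open scoped ENNReal FourierTransform SchwartzMap Matrix Gradient ContDiff

noncomputable section

namespace BrownRavenhall

/-! ### Spin and the Dirac matrices -/

/-- Physical space `ℝ³`. -/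
abbrev Space : Type := EuclideanSpace ℝ (Fin 3)

/-- The four spin indices, split into upper and lower pairs. -/
abbrev Spin : Type := Fin 2 ⊕ Fin 2

/-- The Pauli matrices `σ₁, σ₂, σ₃`. -/
def pauli : Fin 3 → Matrix (Fin 2) (Fin 2) ℂ :=
  ![!![0, 1; 1, 0], !![0, -Complex.I; Complex.I, 0], !![1, 0; 0, -1]]

/-- The Dirac matrices `α₁, α₂, α₃` in standard representation. -/
def diracAlpha (j : Fin 3) : Matrix Spin Spin ℂ :=
  Matrix.fromBlocks 0 (pauli j) (pauli j) 0

/-- The Dirac matrix `β` in standard representation. -/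
def diracBeta : Matrix Spin Spin ℂ :=
  Matrix.fromBlocks 1 0 0 (-1)

/-- The matrix `𝛂 · v` for a vector `v`. -/
def alphaDot (v : Space) : Matrix Spin Spin ℂ :=
  ∑ j : Fin 3, (v j : ℂ) • diracAlpha j

/-- The symbol `𝛂 · p + m β` of the free Dirac operator at momentum `p`. -/
def diracSymbol (m : ℝ) (p : Space) : Matrix Spin Spin ℂ :=
  alphaDot p + (m : ℂ) • diracBeta

/-! ### One-particle and `N`-particle spaces -/

/-- The one-particle space `L²(ℝ³; ℂ⁴)`. -/
abbrev OneParticle : Type :=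
  Lp (EuclideanSpace ℂ Spin) 2 (volume : Measure Space)

/-- The configuration space `ℝ^{3N}` of `N` particles. -/
abbrev Config (N : ℕ) : Type := EuclideanSpace ℝ (Fin N × Fin 3)

/-- The `ν`-th component (position or momentum of particle `ν`) of `x ∈ ℝ^{3N}`. -/
def particle {N : ℕ} (x : Config N) (ν : Fin N) : Space :=
  WithLp.toLp 2 fun j => x (ν, j)

/-- `N`-particle spin space `(ℂ⁴)^{⊗ N}`, in coordinates. -/
abbrev NSpin (N : ℕ) : Type := EuclideanSpace ℂ (Fin N → Spin)

/-- The space `L²(ℝ^{3N}; (ℂ⁴)^{⊗ N})`. -/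
abbrev NParticle (N : ℕ) : Type :=
  Lp (NSpin N) 2 (volume : Measure (Config N))

/-- The action of a `4 × 4` matrix on the spin of particle `ν`. -/
def onSpin {N : ℕ} (M : Matrix Spin Spin ℂ) (ν : Fin N) (v : NSpin N) : NSpin N :=
  WithLp.toLp 2 fun s => ∑ t : Spin, M (s ν) t * v (Function.update s ν t)

/-- The positive spectral subspace of the free Dirac operator `-i 𝛂 · ∇ + m β`. The Fourier
transform `𝓕` (with kernel `exp (-2 π i x · ξ)`, so that the momentum is `p = 2 π ξ`) turns this
operator into multiplication by the Hermitian matrix `𝛂 · p + m β`, with eigenvalues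
`± √(p² + m²)`; a spinor is in the positive spectral subspace iff for almost every `p` its
transform at `p` is in the eigenspace of `+ √(p² + m²)`. -/
def positiveSubspace (m : ℝ) : Set OneParticle :=
  {ψ | ∀ᵐ ξ : Space,
    diracSymbol m ((2 * π) • ξ) *ᵥ WithLp.ofLp ((𝓕 ψ : OneParticle) ξ)
      = ((√(‖(2 * π) • ξ‖ ^ 2 + m ^ 2) : ℝ) : ℂ) • WithLp.ofLp ((𝓕 ψ : OneParticle) ξ)}

/-- `Ψ = ψ₁ ⊗ ⋯ ⊗ ψ_N`. -/
def IsTensorProduct {N : ℕ} (ψ : Fin N → OneParticle) (Ψ : NParticle N) : Prop :=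
  ∀ᵐ x : Config N, ∀ s : Fin N → Spin, Ψ x s = ∏ ν, ψ ν (particle x ν) (s ν)

/-- The `N`-fold Hilbert space tensor power of the positive spectral subspace. -/
def positiveTensorPower (m : ℝ) (N : ℕ) : Submodule ℂ (NParticle N) :=
  (Submodule.span ℂ {Ψ | ∃ ψ : Fin N → OneParticle,
    (∀ ν, ψ ν ∈ positiveSubspace m) ∧ IsTensorProduct ψ Ψ}).topologicalClosure

/-- Relabelling of the particles of a configuration. -/
def permute {N : ℕ} (σ : Equiv.Perm (Fin N)) (x : Config N) : Config N :=
  WithLp.toLp 2 fun i => x (σ i.1, i.2)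

/-- Antisymmetry under simultaneous permutation of positions and spins. -/
def IsAntisymmetric {N : ℕ} (Ψ : NParticle N) : Prop :=
  ∀ σ : Equiv.Perm (Fin N), ∀ᵐ x : Config N, ∀ s : Fin N → Spin,
    Ψ (permute σ x) (s ∘ σ) = ((Equiv.Perm.sign σ : ℤ) : ℂ) * Ψ x s

/-- The allowed electronic states: normalized antisymmetric states in the tensor power of the
positive spectral subspace of the free Dirac operator, in the Sobolev space `H^{1/2}`. -/
structure IsState (m : ℝ) {N : ℕ} (Ψ : NParticle N) : Prop where
  norm_eq_one : ‖Ψ‖ = 1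
  antisymmetric : IsAntisymmetric Ψ
  mem_positive : Ψ ∈ positiveTensorPower m N
  finite_kinetic : TemperedDistribution.MemSobolev (1 / 2) 2 (Ψ : 𝓢'(Config N, NSpin N))

/-! ### Vector potentials -/

/-- `div A = 0` in the sense of distributions. -/
def IsWeaklyDivFree (A : Space → Space) : Prop :=
  ∀ φ : Space → ℝ, ContDiff ℝ ∞ φ → HasCompactSupport φ →
    ∫ x, inner ℝ (A x) (∇ φ x) = 0

/-- `B = curl A` in the sense of distributions. -/
def IsWeakCurl (A B : Space → Space) : Prop :=
  ∀ φ : Space → ℝ, ContDiff ℝ ∞ φ → HasCompactSupport φ → ∀ i : Fin 3,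
    ∫ x, φ x * B x i = ∫ x, (WithLp.ofLp (A x) ⨯₃ WithLp.ofLp (∇ φ x)) i

/-- `A` is a vector potential in Coulomb gauge, of finite field energy, with magnetic field `B`.
The condition `A ∈ L⁶` expresses that `A` vanishes at infinity: a divergence-free `A` with square
integrable curl is in `L⁶` up to an additive harmonic vector field (e.g. a constant), and such a
field would carry no field energy. -/
structure IsCoulombPotential (A B : Space → Space) : Prop where
  memLp : MemLp A 6
  div_free : IsWeaklyDivFree A
  memLp_field : MemLp B 2
  curl_eq : IsWeakCurl A B

/-! ### The energy -/

/-- The quadratic form on `H^{1/2}` of the free Dirac operator `-i 𝛂 · ∇ + m β` acting on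
particle `ν`. -/
def freeDiracForm (m : ℝ) {N : ℕ} (ν : Fin N) (Ψ : NParticle N) : ℝ :=
  ∫ ξ : Config N, (inner ℂ ((𝓕 Ψ : NParticle N) ξ)
    (onSpin (diracSymbol m ((2 * π) • particle ξ ν)) ν ((𝓕 Ψ : NParticle N) ξ))).re

/-- The quadratic form of `e 𝛂 · A(r_ν)`. -/
def magneticForm (e : ℝ) (A : Space → Space) {N : ℕ} (ν : Fin N) (Ψ : NParticle N) : ℝ :=
  ∫ x : Config N, (inner ℂ (Ψ x) (onSpin (alphaDot (e • A (particle x ν))) ν (Ψ x))).re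

/-- The Coulomb interaction `V_c` of `N` electrons at the positions `x` with `K` nuclei of charges
`Z κ` at the positions `R κ`. -/
def coulomb {N K : ℕ} (Z : Fin K → ℝ) (R : Fin K → Space) (x : Config N) : ℝ :=
  -(∑ ν : Fin N, ∑ κ : Fin K, Z κ / ‖particle x ν - R κ‖)
    + (∑ ν : Fin N, ∑ μ ∈ Finset.Iio ν, 1 / ‖particle x μ - particle x ν‖)
    + ∑ l : Fin K, ∑ κ ∈ Finset.Iio l, Z κ * Z l / ‖R κ - R l‖

/-- The energy `(Ψ, (∑_ν D_ν(A) + α V_c) Ψ) + (8π)⁻¹ ∫ B²` with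
`D_ν(A) = 𝛂 · (-i ∇_ν + e A(r_ν)) + m β` and `e = √α`. By the Kato and Sobolev inequalities all
integrals converge absolutely for `Ψ ∈ H^{1/2}`, `A ∈ L⁶` and `B ∈ L²`. -/
def energy (α m : ℝ) {N K : ℕ} (Z : Fin K → ℝ) (R : Fin K → Space) (A B : Space → Space)
    (Ψ : NParticle N) : ℝ :=
  (∑ ν : Fin N, (freeDiracForm m ν Ψ + magneticForm (√α) A ν Ψ))
    + α * (∫ x : Config N, coulomb Z R x * ‖Ψ x‖ ^ 2)
    + 1 / (8 * π) * ∫ x : Space, ‖B x‖ ^ 2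

/-- The set of all values of the energy, over all vector potentials in Coulomb gauge, all pairwise
distinct nuclear positions and all allowed states. -/
def energyValues (α m : ℝ) (N : ℕ) {K : ℕ} (Z : Fin K → ℝ) : Set ℝ :=
  {E | ∃ (A B : Space → Space) (R : Fin K → Space) (Ψ : NParticle N),
    IsCoulombPotential A B ∧ Function.Injective R ∧ IsState m Ψ ∧
      E = energy α m Z R A B Ψ}

/-- The ground state energy `E_{N,K}`, as an extended real number. -/
def groundStateEnergy (α m : ℝ) (N : ℕ) {K : ℕ} (Z : Fin K → ℝ) : EReal :=
  sInf ((fun E : ℝ => (E : EReal)) '' energyValues α m N Z)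

end BrownRavenhall

end

open MeasureTheory Real
open scoped ENNReal FourierTransform SchwartzMap Matrix Gradient ContDiff

noncomputable section

namespace BrownRavenhall

/-! The energy of a suitable family of Slater determinants is bounded above by an affine function of
a momentum scale `l`, and its slope is negative as soon as the particle number allows it. Letting
`l` tend to infinity gives the theorem.

The trial state uses `n ^ 3` cluster orbitals of positive energy. In momentum space they are bumps
of width about `l` around `l k`, where `k` runs through a cube of `n ^ 3` lattice points shifted by
`M n` along the third axis `e₂`. Disjoint supports make them orthonormal. Their momenta are large
compared with `m` and almost parallel to `e₂`, so their spinors are close to `limitSpinor`, the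
eigenvector of `α₃` with eigenvalue 1 (`norm_spinorField_sub_sq_le`): each orbital carries a current
of nearly full strength along `e₂`. Translation in momentum space is only a phase in position space
(`norm_sq_scalarWave`), so with the limiting spinor all these orbitals have one and the same
density, of diameter about `1 / l`, and their currents add up.

A fixed potential `A` with third component 1 at the origin is rescaled to length `r / l` and
multiplied by a coupling `c < 0`. With `s = l / r` the magnetic interaction is at most `n ^ 3 √α c s
/ 4`, and the field energy is at most `c ^ 2 s b / (8 π)`. Minimizing in `c` leaves `-π α n ^ 6 l /
(8 b r)`. The Pauli principle forces momenta of order `n l`, so the kinetic energy is of order `n ^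
4 l`. Hence the slope is negative once `α n ^ 2` exceeds a universal `Γ`, which is possible with `n
^ 3` at most a constant times `max (α ^ (-3/2)) 1` (`exists_clusterSize`).

The Coulomb energy must not spoil this, although the self-repulsion of the cluster may grow with
`l`. In a Slater determinant the exchange term lowers the repulsion, so only the direct term remains
(`sum_integral_twoBody_le`). A subset of the nuclei, of total charge just above the cluster charge,
is placed no worse than independent random positions distributed as the cluster density; its average
energy, including the cluster self-repulsion, is nonpositive (`exists_positions`, `exists_nuclei`).
The other nuclei stay at distance at least one from each other and from these, at a cost independent
of `l`.

The `q = N - n ^ 3` electrons in excess occupy orbitals independent of `l`, at low momenta. All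
energies involving them are bounded uniformly in `l` (`coulombEnergy_le`,
`integral_magnetic_le_of_bounded`). The pieces are assembled in `exists_energyValues_le`. -/

/-! ### Integration over configurations -/

/-- A configuration as a family of positions. -/
def particles {N : ℕ} (x : Config N) : Fin N → Space := fun ν => particle x ν

/-- A product measure is determined by its values on boxes, and the volume of a box factors over
both indices in either arrangement. -/
lemma measurePreserving_uncurry (ι κ : Type*) [Fintype ι] [Fintype κ] :
    MeasurePreserving (MeasurableEquiv.curry ι κ ℝ).symm
      (volume : Measure (ι → κ → ℝ)) (volume : Measure (ι × κ → ℝ)) := by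
  refine ⟨(MeasurableEquiv.curry ι κ ℝ).symm.measurable, ?_⟩
  refine (Measure.pi_eq fun s hs => ?_).symm
  rw [MeasurableEquiv.map_apply]
  have : (MeasurableEquiv.curry ι κ ℝ).symm ⁻¹' (Set.univ.pi s)
      = Set.univ.pi fun i => Set.univ.pi fun j => s (i, j) := by
    ext f
    simp [Set.mem_pi, MeasurableEquiv.curry, Function.uncurry]
  rw [this, volume_pi_pi]
  simp_rw [volume_pi_pi]
  rw [Fintype.prod_prod_type]

/-- The measurable equivalence of configurations and families of positions. -/
def particlesEquiv (N : ℕ) : Config N ≃ᵐ (Fin N → Space) :=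
  (MeasurableEquiv.toLp 2 (Fin N × Fin 3 → ℝ)).symm.trans
    ((MeasurableEquiv.curry (Fin N) (Fin 3) ℝ).trans
      (MeasurableEquiv.piCongrRight fun _ => MeasurableEquiv.toLp 2 (Fin 3 → ℝ)))

lemma measurePreserving_particles (N : ℕ) :
    MeasurePreserving (particlesEquiv N) (volume : Measure (Config N))
      (volume : Measure (Fin N → Space)) := by
  have h1 := PiLp.volume_preserving_ofLp (Fin N × Fin 3)
  have h2 := (measurePreserving_uncurry (Fin N) (Fin 3)).symm
  have h3 : MeasurePreserving (fun (f : Fin N → Fin 3 → ℝ) (ν : Fin N) =>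
      (WithLp.toLp 2 (f ν) : Space)) volume volume :=
    volume_preserving_pi fun _ => PiLp.volume_preserving_toLp (Fin 3)
  exact h3.comp (h2.comp h1)

lemma quasiMeasurePreserving_particle {N : ℕ} (ν : Fin N) :
    Measure.QuasiMeasurePreserving (fun x : Config N => particle x ν) := by
  have h := Measure.quasiMeasurePreserving_eval (fun _ : Fin N => (volume : Measure Space)) ν
  exact h.comp (measurePreserving_particles N).quasiMeasurePreserving

lemma integral_config_eq {N : ℕ} {E : Type*} [NormedAddCommGroup E] [NormedSpace ℝ E]
    (F : (Fin N → Space) → E) :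
    ∫ x : Config N, F (particles x) = ∫ y : Fin N → Space, F y :=
  (measurePreserving_particles N).integral_comp' F

lemma integrable_config_iff {N : ℕ} {E : Type*} [NormedAddCommGroup E]
    (F : (Fin N → Space) → E) :
    Integrable (fun x : Config N => F (particles x)) ↔ Integrable F :=
  (measurePreserving_particles N).integrable_comp_emb (particlesEquiv N).measurableEmbedding

lemma integral_config_prod {N : ℕ} (h : Fin N → Space → ℂ) :
    ∫ x : Config N, ∏ ν, h ν (particle x ν) = ∏ ν, ∫ y, h ν y := by
  rw [← integral_fintype_prod_volume_eq_prod, ← integral_config_eq]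
  rfl

lemma integrable_config_prod {N : ℕ} {h : Fin N → Space → ℂ} (hh : ∀ ν, Integrable (h ν)) :
    Integrable fun x : Config N => ∏ ν, h ν (particle x ν) :=
  (integrable_config_iff fun y => ∏ ν, h ν (y ν)).2 (Integrable.fintype_prod hh)

/-- The measure preserving equivalence that splits off the coordinate `μ`. -/
lemma volume_preserving_insertNth {n : ℕ} (μ : Fin (n + 1)) :
    MeasurePreserving (fun p : Space × (Fin n → Space) =>
      (μ.insertNth p.1 p.2 : Fin (n + 1) → Space)) := 
  (volume_preserving_piFinSuccAbove (fun _ : Fin (n + 1) => Space) μ).symm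

lemma measurableEmbedding_insertNth {n : ℕ} (μ : Fin (n + 1)) :
    MeasurableEmbedding (fun p : Space × (Fin n → Space) =>
      (μ.insertNth p.1 p.2 : Fin (n + 1) → Space)) :=
  (MeasurableEquiv.piFinSuccAbove (fun _ : Fin (n + 1) => Space) μ).symm.measurableEmbedding

/-- Splitting off two coordinates. -/
def insertTwo {n : ℕ} (μ : Fin (n + 2)) (ν : Fin (n + 1))
    (p : (Space × Space) × (Fin n → Space)) : Fin (n + 2) → Space :=
  μ.insertNth p.1.1 (ν.insertNth p.1.2 p.2 : Fin (n + 1) → Space)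

lemma measurePreserving_insertTwo {n : ℕ} (μ : Fin (n + 2)) (ν : Fin (n + 1)) :
    MeasurePreserving (insertTwo μ ν) := by
  have h1 : MeasurePreserving (fun p : Space × (Space × (Fin n → Space)) =>
      (p.1, (ν.insertNth p.2.1 p.2.2 : Fin (n + 1) → Space))) :=
    (MeasurePreserving.id volume).prod (volume_preserving_insertNth ν)
  have h2 := volume_preserving_prodAssoc (α₁ := Space) (β₁ := Space) (γ₁ := Fin n → Space)
  exact (volume_preserving_insertNth μ).comp (h1.comp h2)

lemma measurableEmbedding_insertTwo {n : ℕ} (μ : Fin (n + 2)) (ν : Fin (n + 1)) :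
    MeasurableEmbedding (insertTwo μ ν) := by
  have h1 : MeasurableEmbedding (fun p : Space × (Space × (Fin n → Space)) =>
      (p.1, (ν.insertNth p.2.1 p.2.2 : Fin (n + 1) → Space))) :=
    MeasurableEmbedding.id.prodMap (measurableEmbedding_insertNth ν)
  exact (measurableEmbedding_insertNth μ).comp
    (h1.comp (MeasurableEquiv.prodAssoc).measurableEmbedding)

lemma prod_insertTwo {n : ℕ} (μ : Fin (n + 2)) (ν : Fin (n + 1)) (h : Fin (n + 2) → Space → ℂ)
    (p : (Space × Space) × (Fin n → Space)) :
    ∏ k, h k (insertTwo μ ν p k) = (h μ p.1.1 * h (μ.succAbove ν) p.1.2)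
      * ∏ k, h (μ.succAbove (ν.succAbove k)) (p.2 k) := by
  rw [Fin.prod_univ_succAbove _ μ, Fin.prod_univ_succAbove _ ν]
  simp [insertTwo, mul_assoc]

lemma insertTwo_pair {n : ℕ} (μ : Fin (n + 2)) (ν : Fin (n + 1)) (v : Space → Space → ℝ)
    (h : Fin (n + 2) → Space → ℂ) (p : (Space × Space) × (Fin n → Space)) :
    (v (insertTwo μ ν p μ) (insertTwo μ ν p (μ.succAbove ν)) : ℂ) * ∏ k, h k (insertTwo μ ν p k)
      = ((v p.1.1 p.1.2 : ℂ) * (h μ p.1.1 * h (μ.succAbove ν) p.1.2))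
        * ∏ k, h (μ.succAbove (ν.succAbove k)) (p.2 k) := by
  rw [prod_insertTwo]
  simp [insertTwo, mul_assoc]

/-- Fubini's theorem for a product with a pair interaction. -/
lemma integral_config_pair {N : ℕ} {μ ν : Fin N} (hμν : μ ≠ ν) (v : Space → Space → ℝ)
    (h : Fin N → Space → ℂ) :
    ∫ x : Config N, (v (particle x μ) (particle x ν) : ℂ) * ∏ k, h k (particle x k)
      = (∫ p : Space × Space, (v p.1 p.2 : ℂ) * (h μ p.1 * h ν p.2))
        * ∏ k ∈ {μ, ν}ᶜ, ∫ y, h k y := by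
  obtain _ | _ | n := N
  · exact μ.elim0
  · exact absurd (Fin.ext (by omega)) hμν
  obtain ⟨ν, rfl⟩ := Fin.exists_succAbove_eq hμν.symm
  have key := integral_config_eq (N := n + 2)
    (fun y => (v (y μ) (y (μ.succAbove ν)) : ℂ) * ∏ k, h k (y k))
  refine key.trans ?_
  rw [← (measurePreserving_insertTwo μ ν).integral_comp (measurableEmbedding_insertTwo μ ν)]
  simp_rw [insertTwo_pair μ ν v h]
  rw [Measure.volume_eq_prod, integral_prod_mul
    (fun q : Space × Space => (v q.1 q.2 : ℂ) * (h μ q.1 * h (μ.succAbove ν) q.2))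
    (fun y : Fin n → Space => ∏ k, h (μ.succAbove (ν.succAbove k)) (y k)),
    integral_fintype_prod_volume_eq_prod (fun k => h (μ.succAbove (ν.succAbove k)))]
  congr 1
  have himg : ({μ, μ.succAbove ν}ᶜ : Finset (Fin (n + 2)))
      = Finset.univ.image fun k : Fin n => μ.succAbove (ν.succAbove k) := by
    ext k
    simp only [Finset.mem_compl, Finset.mem_insert, Finset.mem_singleton, Finset.mem_image,
      Finset.mem_univ, true_and, not_or]
    constructor
    · rintro ⟨h1, h2⟩
      obtain ⟨j, rfl⟩ := Fin.exists_succAbove_eq h1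
      obtain ⟨i, rfl⟩ := Fin.exists_succAbove_eq (x := j) (y := ν) (fun hh => h2 (by rw [hh]))
      exact ⟨i, rfl⟩
    · rintro ⟨i, rfl⟩
      exact ⟨Fin.succAbove_ne _ _, fun hh => Fin.succAbove_ne _ _
        (Fin.succAbove_right_injective hh)⟩
  rw [himg, Finset.prod_image]
  intro a _ b _ hab
  exact Fin.succAbove_right_injective (Fin.succAbove_right_injective hab)

lemma integrable_config_pair {N : ℕ} {μ ν : Fin N} (hμν : μ ≠ ν) (v : Space → Space → ℝ)
    {h : Fin N → Space → ℂ} (hh : ∀ k, Integrable (h k))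
    (hv : Integrable fun p : Space × Space => (v p.1 p.2 : ℂ) * (h μ p.1 * h ν p.2)) :
    Integrable fun x : Config N =>
      (v (particle x μ) (particle x ν) : ℂ) * ∏ k, h k (particle x k) := by
  obtain _ | _ | n := N
  · exact μ.elim0
  · exact absurd (Fin.ext (by omega)) hμν
  obtain ⟨ν, rfl⟩ := Fin.exists_succAbove_eq hμν.symm
  refine (integrable_config_iff (N := n + 2)
    (fun y => (v (y μ) (y (μ.succAbove ν)) : ℂ) * ∏ k, h k (y k))).2 ?_
  rw [← (measurePreserving_insertTwo μ ν).integrable_comp_emb (measurableEmbedding_insertTwo μ ν)]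
  have := hv.mul_prod (Integrable.fintype_prod
    (μ := fun _ => volume) (fun k : Fin n => hh (μ.succAbove (ν.succAbove k))))
  refine this.congr (Filter.Eventually.of_forall fun p => ?_)
  exact (insertTwo_pair μ ν v h p).symm

/-! ### Tensor products of spinors -/

/-- The spinors `ℂ⁴`. -/
abbrev Spinor : Type := EuclideanSpace ℂ Spin

/-- The action of a matrix on a spinor. -/
def actSpinor (M : Matrix Spin Spin ℂ) (a : Spinor) : Spinor :=
  WithLp.toLp 2 (M *ᵥ WithLp.ofLp a)

/-- The tensor product of `N` spinors. -/
def spinTensor {N : ℕ} (a : Fin N → Spinor) : NSpin N :=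
  WithLp.toLp 2 fun s => ∏ ν, a ν (s ν)

lemma inner_spinTensor {N : ℕ} (a b : Fin N → Spinor) :
    inner ℂ (spinTensor a) (spinTensor b) = ∏ ν, inner ℂ (a ν) (b ν) := by
  simp only [PiLp.inner_apply, RCLike.inner_apply, spinTensor, map_prod, ← Finset.prod_mul_distrib]
  rw [Finset.prod_univ_sum]
  simp

lemma onSpin_spinTensor {N : ℕ} (M : Matrix Spin Spin ℂ) (ν : Fin N) (b : Fin N → Spinor) :
    onSpin M ν (spinTensor b) = spinTensor (Function.update b ν (actSpinor M (b ν))) := by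
  ext s
  simp only [onSpin, spinTensor, actSpinor]
  rw [← Finset.mul_prod_erase _ _ (Finset.mem_univ ν)]
  simp only [Function.update_self, Matrix.mulVec, dotProduct, Finset.sum_mul]
  refine Finset.sum_congr rfl fun t _ => ?_
  rw [← Finset.mul_prod_erase _ _ (Finset.mem_univ ν)]
  simp only [Function.update_self, mul_assoc]
  congr 2
  refine Finset.prod_congr rfl fun k hk => ?_
  rw [Function.update_of_ne (Finset.ne_of_mem_erase hk),
    Function.update_of_ne (Finset.ne_of_mem_erase hk)]

/-- The action of a matrix on the spin of particle `ν`, as a linear map. -/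
def onSpinLin {N : ℕ} (M : Matrix Spin Spin ℂ) (ν : Fin N) : NSpin N →ₗ[ℂ] NSpin N where
  toFun := onSpin M ν
  map_add' v w := by
    ext s
    simp [onSpin, mul_add, Finset.sum_add_distrib]
  map_smul' c v := by
    ext s
    simp only [onSpin, PiLp.smul_apply, smul_eq_mul, RingHom.id_apply, Finset.mul_sum]
    exact Finset.sum_congr rfl fun t _ => by ring

lemma onSpin_smul_one {N : ℕ} (c : ℂ) (ν : Fin N) (v : NSpin N) :
    onSpin (c • (1 : Matrix Spin Spin ℂ)) ν v = c • v := by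
  ext s
  simp [onSpin, Matrix.one_apply, Finset.sum_ite_eq]

lemma actSpinor_smul_one (c : ℂ) (a : Spinor) :
    actSpinor (c • (1 : Matrix Spin Spin ℂ)) a = c • a := by
  ext s
  simp [actSpinor, Matrix.smul_mulVec]

/-! ### Slater determinants -/

/-- The Slater determinant with orbitals `a i`, `a i ν` being the value of the orbital `i` at the
position of particle `ν`. -/
def slater {N : ℕ} (a : Fin N → Fin N → Spinor) : NSpin N :=
  (((√(N.factorial : ℝ))⁻¹ : ℝ) : ℂ) • ∑ σ : Equiv.Perm (Fin N),
    ((Equiv.Perm.sign σ : ℤ) : ℂ) • spinTensor fun ν => a (σ ν) ν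

/-- The sign of a product of permutations, as a complex number. -/
def signProd {N : ℕ} (σ τ : Equiv.Perm (Fin N)) : ℂ :=
  ((Equiv.Perm.sign σ : ℤ) : ℂ) * ((Equiv.Perm.sign τ : ℤ) : ℂ)

lemma signProd_self {N : ℕ} (σ : Equiv.Perm (Fin N)) : signProd σ σ = 1 := by
  rw [signProd, ← Int.cast_mul, ← Units.val_mul, Int.units_mul_self]
  simp

lemma signProd_swap {N : ℕ} (σ : Equiv.Perm (Fin N)) {μ ν : Fin N} (h : μ ≠ ν) :
    signProd σ (σ * Equiv.swap μ ν) = -1 := by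
  rw [signProd, Equiv.Perm.sign_mul, Equiv.Perm.sign_swap h]
  have := signProd_self σ
  rw [signProd] at this
  push_cast
  rw [mul_neg_one, mul_neg, this]

lemma inv_sqrt_factorial_sq (N : ℕ) :
    (starRingEnd ℂ) (((√(N.factorial : ℝ))⁻¹ : ℝ) : ℂ) * (((√(N.factorial : ℝ))⁻¹ : ℝ) : ℂ)
      = ((N.factorial : ℝ) : ℂ)⁻¹ := by
  rw [Complex.conj_ofReal, ← Complex.ofReal_mul, ← mul_inv, Real.mul_self_sqrt (by positivity),
    Complex.ofReal_inv]

/-- The operator is an arbitrary linear map, so that one expansion over pairs of permutations serves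
the norm (`L = id`) and all one-body matrix elements. -/
lemma inner_slater {N : ℕ} (a : Fin N → Fin N → Spinor) (L : NSpin N →ₗ[ℂ] NSpin N) :
    inner ℂ (slater a) (L (slater a)) = ((N.factorial : ℝ) : ℂ)⁻¹ *
      ∑ σ : Equiv.Perm (Fin N), ∑ τ : Equiv.Perm (Fin N), signProd σ τ *
        inner ℂ (spinTensor fun ν => a (σ ν) ν) (L (spinTensor fun ν => a (τ ν) ν)) := by
  rw [slater, map_smul, map_sum, inner_smul_left, inner_smul_right, ← mul_assoc,
    inv_sqrt_factorial_sq, sum_inner]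
  congr 1
  refine Finset.sum_congr rfl fun σ _ => ?_
  rw [inner_sum]
  refine Finset.sum_congr rfl fun τ _ => ?_
  rw [map_smul, inner_smul_left, inner_smul_right, signProd, mul_assoc]
  simp

/-- The Slater determinant of a family of one-particle wave functions. -/
def slaterFun {N : ℕ} (ψ : Fin N → Space → Spinor) (x : Config N) : NSpin N :=
  slater fun i ν => ψ i (particle x ν)

lemma norm_sq_slaterFun {N : ℕ} (ψ : Fin N → Space → Spinor) (x : Config N) :
    ((‖slaterFun ψ x‖ ^ 2 : ℝ) : ℂ) = ((N.factorial : ℝ) : ℂ)⁻¹ *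
      ∑ σ : Equiv.Perm (Fin N), ∑ τ : Equiv.Perm (Fin N), signProd σ τ *
        ∏ k, inner ℂ (ψ (σ k) (particle x k)) (ψ (τ k) (particle x k)) := by
  have := inner_slater (fun i ν => ψ i (particle x ν)) LinearMap.id
  simp only [LinearMap.id_apply, inner_spinTensor] at this
  rw [← this, slaterFun, inner_self_eq_norm_sq_to_K]
  norm_cast

/-- Orthonormality of one-particle wave functions, with absolute convergence of all integrals. -/
structure IsOrthonormal {N : ℕ} (ψ : Fin N → Space → Spinor) : Prop where
  integrable : ∀ i j, Integrable fun x => inner ℂ (ψ i x) (ψ j x)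
  integral_eq : ∀ i j, ∫ x, inner ℂ (ψ i x) (ψ j x) = if i = j then 1 else 0

lemma integrable_slaterFun_term {N : ℕ} {ψ : Fin N → Space → Spinor} (hψ : IsOrthonormal ψ)
    (σ τ : Equiv.Perm (Fin N)) : Integrable fun x : Config N => signProd σ τ *
      ∏ k, inner ℂ (ψ (σ k) (particle x k)) (ψ (τ k) (particle x k)) :=
  (integrable_config_prod fun k => hψ.integrable (σ k) (τ k)).const_mul _

lemma integrable_norm_sq_slaterFun {N : ℕ} {ψ : Fin N → Space → Spinor} (hψ : IsOrthonormal ψ) :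
    Integrable fun x : Config N => ‖slaterFun ψ x‖ ^ 2 := by
  have : Integrable fun x : Config N => ((‖slaterFun ψ x‖ ^ 2 : ℝ) : ℂ) := by
    simp_rw [norm_sq_slaterFun]
    exact (integrable_finsetSum _ fun σ _ => integrable_finsetSum _ fun τ _ =>
      integrable_slaterFun_term hψ σ τ).const_mul _
  have h := this.re
  simpa only [RCLike.re_eq_complex_re, Complex.ofReal_re] using h

lemma integral_norm_sq_slaterFun {N : ℕ} {ψ : Fin N → Space → Spinor} (hψ : IsOrthonormal ψ) :
    ∫ x : Config N, ‖slaterFun ψ x‖ ^ 2 = 1 := by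
  have hint := integrable_slaterFun_term hψ
  apply Complex.ofReal_injective
  rw [← integral_complex_ofReal]
  simp_rw [norm_sq_slaterFun]
  rw [integral_const_mul, integral_finsetSum _ fun σ _ => integrable_finsetSum _ fun τ _ => hint σ τ]
  have : ∀ σ : Equiv.Perm (Fin N), ∫ x : Config N, ∑ τ : Equiv.Perm (Fin N), signProd σ τ *
      ∏ k, inner ℂ (ψ (σ k) (particle x k)) (ψ (τ k) (particle x k)) = 1 := by
    intro σ
    rw [integral_finsetSum _ fun τ _ => hint σ τ, Finset.sum_eq_single σ]
    · rw [integral_const_mul, signProd_self, one_mul, integral_config_prod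
        (fun k y => inner ℂ (ψ (σ k) y) (ψ (σ k) y))]
      exact Finset.prod_eq_one fun k _ => by rw [hψ.integral_eq, if_pos rfl]
    · intro τ _ hτ
      obtain ⟨k, hk⟩ : ∃ k, σ k ≠ τ k := by
        by_contra! h
        exact hτ (Equiv.ext fun k => (h k).symm)
      rw [integral_const_mul, integral_config_prod
        (fun k y => inner ℂ (ψ (σ k) y) (ψ (τ k) y)),
        Finset.prod_eq_zero (Finset.mem_univ k) (by rw [hψ.integral_eq, if_neg hk]), mul_zero]
    · simp
  simp_rw [this]
  simp [Fintype.card_perm, Nat.factorial_ne_zero]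

lemma inner_onSpin_slaterFun {N : ℕ} (ψ : Fin N → Space → Spinor) (M : Space → Matrix Spin Spin ℂ)
    (ν : Fin N) (x : Config N) :
    inner ℂ (slaterFun ψ x) (onSpin (M (particle x ν)) ν (slaterFun ψ x))
      = ((N.factorial : ℝ) : ℂ)⁻¹ *
        ∑ σ : Equiv.Perm (Fin N), ∑ τ : Equiv.Perm (Fin N), signProd σ τ *
          ∏ k, inner ℂ (ψ (σ k) (particle x k))
            (if k = ν then actSpinor (M (particle x k)) (ψ (τ k) (particle x k))
              else ψ (τ k) (particle x k)) := by
  have := inner_slater (fun i ν => ψ i (particle x ν)) (onSpinLin (M (particle x ν)) ν)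
  refine this.trans ?_
  congr 1
  refine Finset.sum_congr rfl fun σ _ => Finset.sum_congr rfl fun τ _ => ?_
  change _ * inner ℂ _ (onSpin _ _ _) = _
  rw [onSpin_spinTensor, inner_spinTensor]
  congr 1
  refine Finset.prod_congr rfl fun k _ => ?_
  by_cases hk : k = ν
  · subst hk; simp
  · simp [hk]

/-! ### Expectations of one-body operators -/

section OneBody

variable {N : ℕ} {ψ : Fin N → Space → Spinor} (hψ : IsOrthonormal ψ)
  {M : Space → Matrix Spin Spin ℂ}
  (hM : ∀ i j, Integrable fun x => inner ℂ (ψ i x) (actSpinor (M x) (ψ j x)))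

include hψ hM in
lemma integrable_oneBody_term (ν : Fin N) (σ τ : Equiv.Perm (Fin N)) (k : Fin N) :
    Integrable fun y => inner ℂ (ψ (σ k) y)
      (if k = ν then actSpinor (M y) (ψ (τ k) y) else ψ (τ k) y) := by
  by_cases hk : k = ν
  · simp only [hk, if_true]
    exact hM _ _
  · simp only [hk, if_false]
    exact hψ.integrable _ _

include hψ hM in
lemma integrable_oneBody (ν : Fin N) : Integrable fun x : Config N =>
    inner ℂ (slaterFun ψ x) (onSpin (M (particle x ν)) ν (slaterFun ψ x)) := by
  simp_rw [inner_onSpin_slaterFun]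
  exact (integrable_finsetSum _ fun σ _ => integrable_finsetSum _ fun τ _ =>
    (integrable_config_prod (integrable_oneBody_term hψ hM ν σ τ)).const_mul _).const_mul _

include hψ hM in
lemma integral_oneBody (ν : Fin N) :
    ∫ x : Config N, inner ℂ (slaterFun ψ x) (onSpin (M (particle x ν)) ν (slaterFun ψ x))
      = ((N.factorial : ℝ) : ℂ)⁻¹ * ∑ σ : Equiv.Perm (Fin N),
        ∫ y, inner ℂ (ψ (σ ν) y) (actSpinor (M y) (ψ (σ ν) y)) := by
  have hint : ∀ σ τ : Equiv.Perm (Fin N), Integrable fun x : Config N => signProd σ τ *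
      ∏ k, inner ℂ (ψ (σ k) (particle x k))
        (if k = ν then actSpinor (M (particle x k)) (ψ (τ k) (particle x k))
          else ψ (τ k) (particle x k)) := fun σ τ =>
    (integrable_config_prod (integrable_oneBody_term hψ hM ν σ τ)).const_mul _
  simp_rw [inner_onSpin_slaterFun]
  rw [integral_const_mul, integral_finsetSum _ fun σ _ => integrable_finsetSum _ fun τ _ => hint σ τ]
  congr 1
  refine Finset.sum_congr rfl fun σ _ => ?_
  rw [integral_finsetSum _ fun τ _ => hint σ τ, Finset.sum_eq_single σ]
  · rw [integral_const_mul, signProd_self, one_mul, integral_config_prod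
      (fun k y => inner ℂ (ψ (σ k) y)
        (if k = ν then actSpinor (M y) (ψ (σ k) y) else ψ (σ k) y)),
      ← Finset.mul_prod_erase _ _ (Finset.mem_univ ν), Finset.prod_eq_one, mul_one]
    · simp
    · intro k hk
      simp only [Finset.ne_of_mem_erase hk, if_false]
      rw [hψ.integral_eq, if_pos rfl]
  · intro τ _ hτ
    -- Two permutations that agree at all indices but one agree everywhere. Thus for `τ ≠ σ` some
    -- particle other than `ν` contributes a vanishing overlap.
    obtain ⟨k, hkν, hk⟩ : ∃ k, k ≠ ν ∧ σ k ≠ τ k := by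
      by_contra! h
      refine hτ (Equiv.ext fun k => ?_)
      by_cases hkν : k = ν
      · subst hkν
        obtain ⟨j, hj⟩ := σ.surjective (τ k)
        by_cases hjk : j = k
        · rw [← hj, hjk]
        · exact absurd (τ.injective ((h j hjk).symm.trans hj)) hjk
      · exact (h k hkν).symm
    rw [integral_const_mul, integral_config_prod
      (fun k y => inner ℂ (ψ (σ k) y)
        (if k = ν then actSpinor (M y) (ψ (τ k) y) else ψ (τ k) y)),
      Finset.prod_eq_zero (Finset.mem_univ k), mul_zero]
    simp [hkν, hψ.integral_eq, hk]
  · simp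

include hψ hM in
/-- The expectation of a one-body operator in a Slater determinant. -/
lemma sum_integral_oneBody :
    ∑ ν : Fin N, ∫ x : Config N,
        (inner ℂ (slaterFun ψ x) (onSpin (M (particle x ν)) ν (slaterFun ψ x))).re
      = ∑ i, ∫ y, (inner ℂ (ψ i y) (actSpinor (M y) (ψ i y))).re := by
  have hre : ∀ ν : Fin N, ∫ x : Config N,
      (inner ℂ (slaterFun ψ x) (onSpin (M (particle x ν)) ν (slaterFun ψ x))).re
      = (((N.factorial : ℝ) : ℂ)⁻¹ * ∑ σ : Equiv.Perm (Fin N),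
        ∫ y, inner ℂ (ψ (σ ν) y) (actSpinor (M y) (ψ (σ ν) y))).re := fun ν => by
    rw [← integral_oneBody hψ hM]
    exact integral_re (integrable_oneBody hψ hM ν)
  have hre' : ∀ i, ∫ y, (inner ℂ (ψ i y) (actSpinor (M y) (ψ i y))).re
      = (∫ y, inner ℂ (ψ i y) (actSpinor (M y) (ψ i y))).re := fun i =>
    integral_re (hM i i)
  simp_rw [hre, hre']
  rw [← Complex.re_sum, ← Complex.re_sum, ← Finset.mul_sum, Finset.sum_comm]
  have : ∀ σ : Equiv.Perm (Fin N),
      ∑ ν, ∫ y, inner ℂ (ψ (σ ν) y) (actSpinor (M y) (ψ (σ ν) y))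
        = ∑ i, ∫ y, inner ℂ (ψ i y) (actSpinor (M y) (ψ i y)) := fun σ =>
    Equiv.sum_comp σ fun i => ∫ y, inner ℂ (ψ i y) (actSpinor (M y) (ψ i y))
  simp_rw [this]
  rw [Finset.sum_const, Finset.card_univ, Fintype.card_perm, Fintype.card_fin, nsmul_eq_mul,
    ← mul_assoc]
  congr 1
  have hf : ((N.factorial : ℕ) : ℂ) ≠ 0 := by exact_mod_cast Nat.factorial_ne_zero N
  rw [Complex.ofReal_natCast, inv_mul_cancel₀ hf, one_mul]

end OneBody

/-! ### Two-body interactions in Slater determinants -/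

lemma two_mul_sum_Iio {N : ℕ} {F : Fin N → Fin N → ℂ} (hsymm : ∀ i j, F i j = F j i)
    (hdiag : ∀ i, F i i = 0) :
    2 * ∑ ν, ∑ μ ∈ Finset.Iio ν, F μ ν = ∑ μ, ∑ ν, F μ ν := by
  have h1 : ∀ ν, ∑ μ, F μ ν = ∑ μ ∈ Finset.Iio ν, F μ ν + ∑ μ ∈ Finset.Ioi ν, F μ ν := by
    intro ν
    have : (Finset.univ : Finset (Fin N)) = insert ν (Finset.Iio ν ∪ Finset.Ioi ν) := by
      ext k
      simp only [Finset.mem_univ, Finset.mem_insert, Finset.mem_union, Finset.mem_Iio,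
        Finset.mem_Ioi, true_iff]
      rcases lt_trichotomy k ν with h | h | h <;> simp [h]
    rw [this, Finset.sum_insert (by simp), hdiag, zero_add, Finset.sum_union]
    rw [Finset.disjoint_left]
    intro k hk hk'
    exact lt_asymm (Finset.mem_Iio.1 hk) (Finset.mem_Ioi.1 hk')
  have h2 : ∑ ν, ∑ μ ∈ Finset.Ioi ν, F μ ν = ∑ ν, ∑ μ ∈ Finset.Iio ν, F μ ν := by
    rw [Finset.sum_comm' (t' := Finset.univ) (s' := fun μ => Finset.Iio μ) (by simp)]
    exact Finset.sum_congr rfl fun i _ => Finset.sum_congr rfl fun j _ => hsymm i j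
  rw [Finset.sum_comm, two_mul]
  simp_rw [h1]
  rw [Finset.sum_add_distrib, h2]

/-- This selects the terms of a two-body expectation that survive orthogonality: off `μ` and `ν` the
permutations must agree, which leaves only the direct and the exchange term. -/
lemma eq_or_eq_mul_swap {N : ℕ} {σ τ : Equiv.Perm (Fin N)} {μ ν : Fin N}
    (h : ∀ k, k ≠ μ → k ≠ ν → σ k = τ k) : τ = σ ∨ τ = σ * Equiv.swap μ ν := by
  have hfix : ∀ k, k ≠ μ → k ≠ ν → (σ⁻¹ * τ) k = k := fun k h1 h2 => by
    rw [Equiv.Perm.mul_apply, ← h k h1 h2, Equiv.Perm.coe_inv, Equiv.symm_apply_apply]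
  set ρ := σ⁻¹ * τ with h_def
  have hτ : τ = σ * ρ := by rw [h_def, mul_inv_cancel_left]
  have hcase : ∀ k, k = μ ∨ k = ν → ρ k = μ ∨ ρ k = ν := by
    intro k hk
    by_contra! hc
    have := ρ.injective (hfix _ hc.1 hc.2)
    rcases hk with rfl | rfl
    · exact hc.1 this
    · exact hc.2 this
  by_cases hμ : ρ μ = μ
  · left
    have : ρ = 1 := by
      ext1 k
      by_cases h1 : k = μ
      · rw [h1, hμ]; rfl
      · by_cases h2 : k = ν
        · subst h2
          rcases hcase k (Or.inr rfl) with hk | hk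
          · exact absurd (ρ.injective (hk.trans hμ.symm)) h1
          · exact hk
        · exact hfix k h1 h2
    rw [hτ, this, mul_one]
  · right
    have hμ' : ρ μ = ν := (hcase μ (Or.inl rfl)).resolve_left hμ
    have : ρ = Equiv.swap μ ν := by
      ext1 k
      by_cases h1 : k = μ
      · rw [h1, hμ', Equiv.swap_apply_left]
      · by_cases h2 : k = ν
        · subst h2
          rw [Equiv.swap_apply_right]
          rcases hcase k (Or.inr rfl) with hk | hk
          · exact hk
          · exact absurd (ρ.injective (hk.trans hμ'.symm)) h1
        · rw [hfix k h1 h2, Equiv.swap_apply_of_ne_of_ne h1 h2]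
    rw [hτ, this]

/-- In components the sum is the squared Hilbert-Schmidt norm of the `4 × 4` matrix with entries `∑
j, a j s * conj (b j t)`, the density matrix between two points. Hence the exchange integrand is
nonnegative pointwise, for every nonnegative interaction. -/
lemma exchange_nonneg {N : ℕ} (a b : Fin N → Spinor) :
    0 ≤ (∑ i, ∑ j, inner ℂ (a i) (a j) * inner ℂ (b j) (b i)).re := by
  have : ∑ i, ∑ j, inner ℂ (a i) (a j) * inner ℂ (b j) (b i)
      = ∑ s : Spin, ∑ t : Spin, ((Complex.normSq (∑ j, a j s * (starRingEnd ℂ) (b j t)) : ℝ) : ℂ) := by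
    simp only [PiLp.inner_apply, RCLike.inner_apply, ← Complex.mul_conj, map_sum, map_mul,
      Complex.conj_conj, Finset.sum_mul_sum]
    have h1 : ∀ F : Fin N → Fin N → Spin → Spin → ℂ,
        ∑ i, ∑ j, ∑ s, ∑ t, F i j s t = ∑ s, ∑ t, ∑ i, ∑ j, F i j s t := by
      intro F
      calc _ = ∑ i, ∑ s, ∑ j, ∑ t, F i j s t :=
            Finset.sum_congr rfl fun i _ => Finset.sum_comm
        _ = ∑ s, ∑ i, ∑ j, ∑ t, F i j s t := Finset.sum_comm
        _ = ∑ s, ∑ i, ∑ t, ∑ j, F i j s t :=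
            Finset.sum_congr rfl fun s _ => Finset.sum_congr rfl fun i _ => Finset.sum_comm
        _ = _ := Finset.sum_congr rfl fun s _ => Finset.sum_comm
    rw [h1]
    refine Finset.sum_congr rfl fun s _ => Finset.sum_congr rfl fun t _ => ?_
    rw [Finset.sum_comm]
    exact Finset.sum_congr rfl fun i _ => Finset.sum_congr rfl fun j _ => by ring
  rw [this, Complex.re_sum]
  refine Finset.sum_nonneg fun s _ => ?_
  rw [Complex.re_sum]
  exact Finset.sum_nonneg fun t _ => by rw [Complex.ofReal_re]; exact Complex.normSq_nonneg _

/-- The Coulomb type integral of the product of two overlap densities. -/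
def pairIntegral {N : ℕ} (ψ : Fin N → Space → Spinor) (v : Space → Space → ℝ)
    (i j k l : Fin N) : ℂ :=
  ∫ p : Space × Space, (v p.1 p.2 : ℂ) *
    (inner ℂ (ψ i p.1) (ψ j p.1) * inner ℂ (ψ k p.2) (ψ l p.2))

section TwoBody

variable {N : ℕ} {ψ : Fin N → Space → Spinor} (hψ : IsOrthonormal ψ) {v : Space → Space → ℝ}
  (hv : ∀ i j k l, Integrable fun p : Space × Space => (v p.1 p.2 : ℂ) *
    (inner ℂ (ψ i p.1) (ψ j p.1) * inner ℂ (ψ k p.2) (ψ l p.2)))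

lemma pairIntegral_comm (hsymm : ∀ x y, v x y = v y x) (i j k l : Fin N) :
    pairIntegral ψ v i j k l = pairIntegral ψ v k l i j := by
  rw [pairIntegral, pairIntegral, Measure.volume_eq_prod, ← integral_prod_swap]
  refine integral_congr_ae (Filter.Eventually.of_forall fun p => ?_)
  simp only [Prod.fst_swap, Prod.snd_swap]
  rw [hsymm p.2 p.1, mul_comm (inner ℂ (ψ i p.2) (ψ j p.2))]

lemma mul_norm_sq_slaterFun (w : ℝ) (x : Config N) :
    ((w * ‖slaterFun ψ x‖ ^ 2 : ℝ) : ℂ) = ((N.factorial : ℝ) : ℂ)⁻¹ *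
      ∑ σ : Equiv.Perm (Fin N), ∑ τ : Equiv.Perm (Fin N), signProd σ τ *
        ((w : ℂ) * ∏ k, inner ℂ (ψ (σ k) (particle x k)) (ψ (τ k) (particle x k))) := by
  rw [Complex.ofReal_mul, norm_sq_slaterFun, mul_left_comm, Finset.mul_sum]
  congr 1
  refine Finset.sum_congr rfl fun σ _ => ?_
  rw [Finset.mul_sum]
  exact Finset.sum_congr rfl fun τ _ => mul_left_comm _ _ _

include hψ hv in
lemma integrable_twoBody_term {μ ν : Fin N} (hμν : μ ≠ ν) (σ τ : Equiv.Perm (Fin N)) :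
    Integrable fun x : Config N => signProd σ τ * ((v (particle x μ) (particle x ν) : ℂ) *
      ∏ k, inner ℂ (ψ (σ k) (particle x k)) (ψ (τ k) (particle x k))) :=
  (integrable_config_pair hμν v (fun k => hψ.integrable (σ k) (τ k)) (hv _ _ _ _)).const_mul _

include hψ hv in
lemma integrable_twoBody {μ ν : Fin N} (hμν : μ ≠ ν) : Integrable fun x : Config N =>
    v (particle x μ) (particle x ν) * ‖slaterFun ψ x‖ ^ 2 := by
  have : Integrable fun x : Config N =>
      ((v (particle x μ) (particle x ν) * ‖slaterFun ψ x‖ ^ 2 : ℝ) : ℂ) := by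
    simp_rw [mul_norm_sq_slaterFun]
    exact (integrable_finsetSum _ fun σ _ => integrable_finsetSum _ fun τ _ =>
      integrable_twoBody_term hψ hv hμν σ τ).const_mul _
  have h := this.re
  simpa only [RCLike.re_eq_complex_re, Complex.ofReal_re] using h

include hψ hv in
lemma integral_twoBody {μ ν : Fin N} (hμν : μ ≠ ν) :
    (((∫ x : Config N, v (particle x μ) (particle x ν) * ‖slaterFun ψ x‖ ^ 2) : ℝ) : ℂ)
      = ((N.factorial : ℝ) : ℂ)⁻¹ * ∑ σ : Equiv.Perm (Fin N),
        (pairIntegral ψ v (σ μ) (σ μ) (σ ν) (σ ν) - pairIntegral ψ v (σ μ) (σ ν) (σ ν) (σ μ)) := by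
  have hint := fun σ τ => integrable_twoBody_term hψ hv hμν σ τ
  rw [← integral_complex_ofReal]
  simp_rw [mul_norm_sq_slaterFun]
  rw [integral_const_mul, integral_finsetSum _ fun σ _ => integrable_finsetSum _ fun τ _ => hint σ τ]
  congr 1
  refine Finset.sum_congr rfl fun σ _ => ?_
  have hne : σ ≠ σ * Equiv.swap μ ν := by
    intro h
    have := congrArg (fun ρ : Equiv.Perm (Fin N) => ρ μ) h
    simp only [Equiv.Perm.mul_apply, Equiv.swap_apply_left] at this
    exact hμν (σ.injective this)
  have hterm : ∀ τ : Equiv.Perm (Fin N), ∫ x : Config N, signProd σ τ *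
      ((v (particle x μ) (particle x ν) : ℂ) *
        ∏ k, inner ℂ (ψ (σ k) (particle x k)) (ψ (τ k) (particle x k)))
      = signProd σ τ * (pairIntegral ψ v (σ μ) (τ μ) (σ ν) (τ ν)
        * ∏ k ∈ {μ, ν}ᶜ, if σ k = τ k then 1 else 0) := by
    intro τ
    rw [integral_const_mul, integral_config_pair hμν v
      (fun k y => inner ℂ (ψ (σ k) y) (ψ (τ k) y))]
    simp_rw [hψ.integral_eq]
    rfl
  rw [integral_finsetSum _ fun τ _ => hint σ τ]
  simp_rw [hterm]
  rw [Finset.sum_eq_add σ (σ * Equiv.swap μ ν) hne]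
  · rw [signProd_self, signProd_swap σ hμν, Finset.prod_eq_one, Finset.prod_eq_one]
    · simp only [Equiv.Perm.mul_apply, Equiv.swap_apply_left, Equiv.swap_apply_right]
      ring
    · intro k hk
      simp only [Finset.mem_compl, Finset.mem_insert, Finset.mem_singleton, not_or] at hk
      rw [Equiv.Perm.mul_apply, Equiv.swap_apply_of_ne_of_ne hk.1 hk.2, if_pos rfl]
    · intro k _
      rw [if_pos rfl]
  · rintro τ _ ⟨h1, h2⟩
    obtain ⟨k, hkμ, hkν, hk⟩ : ∃ k, k ≠ μ ∧ k ≠ ν ∧ σ k ≠ τ k := by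
      by_contra! h
      rcases eq_or_eq_mul_swap h with h | h
      · exact h1 h
      · exact h2 h
    rw [Finset.prod_eq_zero (i := k) (by simp [hkμ, hkν]) (if_neg hk), mul_zero, mul_zero]
  · simp
  · simp

/-- The one-particle density. -/
def density {N : ℕ} (ψ : Fin N → Space → Spinor) (x : Space) : ℝ := ∑ i, ‖ψ i x‖ ^ 2

include hψ hv in
/-- The expectation of a nonnegative pair interaction in a Slater determinant is at most its
direct part. -/
lemma sum_integral_twoBody_le (hsymm : ∀ x y, v x y = v y x) (hnn : ∀ x y, 0 ≤ v x y) :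
    ∑ ν : Fin N, ∑ μ ∈ Finset.Iio ν,
        ∫ x : Config N, v (particle x μ) (particle x ν) * ‖slaterFun ψ x‖ ^ 2
      ≤ 1 / 2 * ∫ p : Space × Space, v p.1 p.2 * (density ψ p.1 * density ψ p.2) := by
  -- `W` is direct minus exchange. It vanishes on the diagonal, so the restricted sum over pairs may
  -- be replaced by half of the full double sum, self-interactions included.
  set W : Fin N → Fin N → ℂ := fun i j =>
    pairIntegral ψ v i i j j - pairIntegral ψ v i j j i with hW
  set F : Fin N → Fin N → ℂ := fun μ ν =>
    ((N.factorial : ℝ) : ℂ)⁻¹ * ∑ σ : Equiv.Perm (Fin N), W (σ μ) (σ ν) with hF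
  have hWsymm : ∀ i j, W i j = W j i := fun i j => by
    simp only [hW]
    rw [pairIntegral_comm hsymm i i j j, pairIntegral_comm hsymm i j j i]
  have hFsymm : ∀ i j, F i j = F j i := fun i j => by
    simp only [hF]
    congr 1
    exact Finset.sum_congr rfl fun σ _ => hWsymm _ _
  have hFdiag : ∀ i, F i i = 0 := fun i => by simp [hF, hW]
  have hfac : ((N.factorial : ℝ) : ℂ)⁻¹ * ((N.factorial : ℕ) : ℂ) = 1 := by
    have hf : ((N.factorial : ℕ) : ℂ) ≠ 0 := by exact_mod_cast Nat.factorial_ne_zero N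
    rw [Complex.ofReal_natCast, inv_mul_cancel₀ hf]
  -- For each permutation the double sum over particles is a relabelling of the double sum over
  -- orbitals, so averaging over permutations changes nothing.
  have hFsum : ∑ μ, ∑ ν, F μ ν = ∑ i, ∑ j, W i j := by
    simp only [hF, ← Finset.mul_sum]
    have h1 : ∑ μ, ∑ ν, ∑ σ : Equiv.Perm (Fin N), W (σ μ) (σ ν)
        = ∑ σ : Equiv.Perm (Fin N), ∑ μ, ∑ ν, W (σ μ) (σ ν) := by
      rw [Finset.sum_comm]
      refine (Finset.sum_congr rfl fun ν _ => Finset.sum_comm).trans ?_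
      rw [Finset.sum_comm]
      exact Finset.sum_congr rfl fun σ _ => Finset.sum_comm
    have h2 : ∀ σ : Equiv.Perm (Fin N), ∑ μ, ∑ ν, W (σ μ) (σ ν) = ∑ i, ∑ j, W i j := fun σ => by
      rw [← Equiv.sum_comp σ fun i => ∑ j, W i j]
      exact Finset.sum_congr rfl fun μ _ => Equiv.sum_comp σ fun j => W (σ μ) j
    rw [h1]
    simp_rw [h2]
    rw [Finset.sum_const, Finset.card_univ, Fintype.card_perm, Fintype.card_fin, nsmul_eq_mul,
      ← mul_assoc, hfac, one_mul]
  have hlhs : ((∑ ν : Fin N, ∑ μ ∈ Finset.Iio ν,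
      ∫ x : Config N, v (particle x μ) (particle x ν) * ‖slaterFun ψ x‖ ^ 2 : ℝ) : ℂ)
      = ∑ ν, ∑ μ ∈ Finset.Iio ν, F μ ν := by
    push_cast
    refine Finset.sum_congr rfl fun ν _ => Finset.sum_congr rfl fun μ hμ => ?_
    exact integral_twoBody hψ hv (Finset.mem_Iio.1 hμ).ne
  have htwo := two_mul_sum_Iio hFsymm hFdiag
  rw [← hlhs, hFsum] at htwo
  have hre := congrArg Complex.re htwo
  have hdir : (∑ i, ∑ j, pairIntegral ψ v i i j j).re
      = ∫ p : Space × Space, v p.1 p.2 * (density ψ p.1 * density ψ p.2) := by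
    simp only [pairIntegral]
    simp_rw [← integral_finsetSum Finset.univ fun j _ => hv _ _ j j]
    rw [← integral_finsetSum _ fun i _ => integrable_finsetSum _ fun j _ => hv i i j j]
    have : ∀ p : Space × Space, ∑ i, ∑ j, (v p.1 p.2 : ℂ) *
        (inner ℂ (ψ i p.1) (ψ i p.1) * inner ℂ (ψ j p.2) (ψ j p.2))
        = ((v p.1 p.2 * (density ψ p.1 * density ψ p.2) : ℝ) : ℂ) := by
      intro p
      simp only [density]
      rw [Finset.sum_mul_sum]
      simp only [Finset.mul_sum]
      push_cast
      simp only [inner_self_eq_norm_sq_to_K]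
      rfl
    simp_rw [this]
    rw [integral_complex_ofReal, Complex.ofReal_re]
  have hex : 0 ≤ (∑ i, ∑ j, pairIntegral ψ v i j j i).re := by
    simp only [pairIntegral]
    simp_rw [← integral_finsetSum Finset.univ fun j _ => hv _ j j _]
    rw [← integral_finsetSum _ fun i _ => integrable_finsetSum _ fun j _ => hv i j j i]
    have := integral_re (integrable_finsetSum Finset.univ fun i _ =>
      integrable_finsetSum Finset.univ fun j _ => hv i j j i)
    simp only [RCLike.re_eq_complex_re] at this
    rw [← this]
    refine integral_nonneg fun p => ?_
    simp only [← Finset.mul_sum]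
    rw [Complex.re_ofReal_mul]
    exact mul_nonneg (hnn _ _) (exchange_nonneg _ _)
  simp only [hW, Finset.sum_sub_distrib, Complex.sub_re] at hre
  rw [hdir, show (2 : ℂ) = ((2 : ℝ) : ℂ) by norm_num, Complex.re_ofReal_mul,
    Complex.ofReal_re] at hre
  linarith

end TwoBody

/-! ### Smooth tensor products and their Fourier transforms -/

/-- The configuration with given positions. -/
def glue {N : ℕ} (y : Fin N → Space) : Config N := WithLp.toLp 2 fun i => y i.1 i.2

lemma glue_particles {N : ℕ} (x : Config N) : glue (particles x) = x := rfl

lemma continuous_glue {N : ℕ} : Continuous (glue : (Fin N → Space) → Config N) := by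
  unfold glue
  fun_prop

lemma contDiff_particle {N : ℕ} (ν : Fin N) : ContDiff ℝ ∞ fun x : Config N => particle x ν := by
  rw [contDiff_euclidean]
  intro j
  exact contDiff_euclidean.1 contDiff_id (ν, j)

lemma hasCompactSupport_spinTensor {N : ℕ} {u : Fin N → 𝓢(Space, Spinor)}
    (hu : ∀ i, HasCompactSupport (u i)) :
    HasCompactSupport fun x : Config N => spinTensor fun ν => u ν (particle x ν) := by
  have hK : IsCompact (glue '' Set.univ.pi fun ν => tsupport (u ν) : Set (Config N)) :=
    (isCompact_univ_pi fun ν => hu ν).image continuous_glue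
  refine HasCompactSupport.of_support_subset_isCompact hK fun x hx => ?_
  refine ⟨particles x, fun ν _ => subset_tsupport _ ?_, glue_particles x⟩
  intro h0
  apply hx
  ext s
  simp only [spinTensor, PiLp.zero_apply]
  exact Finset.prod_eq_zero (Finset.mem_univ ν) (by
    rw [show u ν (particle x ν) = 0 from h0]; rfl)

lemma contDiff_spinTensor {N : ℕ} (u : Fin N → 𝓢(Space, Spinor)) :
    ContDiff ℝ ∞ fun x : Config N => spinTensor fun ν => u ν (particle x ν) := by
  rw [contDiff_piLp]
  intro s
  change ContDiff ℝ ∞ fun x : Config N => ∏ ν, u ν (particle x ν) (s ν)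
  refine contDiff_prod fun ν _ => ?_
  exact (contDiff_piLp 2).1 ((u ν).smooth ⊤ |>.comp (contDiff_particle ν)) (s ν)

/-- The tensor product of smooth compactly supported one-particle functions. -/
def tensorSchwartz {N : ℕ} (u : Fin N → 𝓢(Space, Spinor)) (hu : ∀ i, HasCompactSupport (u i)) :
    𝓢(Config N, NSpin N) :=
  (hasCompactSupport_spinTensor hu).toSchwartzMap (contDiff_spinTensor u)

lemma inner_config {N : ℕ} (x y : Config N) :
    inner ℝ x y = ∑ ν, inner ℝ (particle x ν) (particle y ν) := by
  simp only [PiLp.inner_apply, particle]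
  rw [Fintype.sum_prod_type]

lemma schwartz_fourierInv_apply {V : Type*} [NormedAddCommGroup V] [InnerProductSpace ℝ V]
    [FiniteDimensional ℝ V] [MeasurableSpace V] [BorelSpace V] {ι : Type*} [Fintype ι]
    (f : 𝓢(V, EuclideanSpace ℂ ι)) (x : V) (i : ι) :
    (𝓕⁻ f) x i = ∫ ξ, Complex.exp (↑(2 * π * inner ℝ ξ x) * Complex.I) * f ξ i := by
  rw [SchwartzMap.fourierInv_coe, Real.fourierInv_eq']
  have hint : Integrable fun ξ => Complex.exp (↑(2 * π * inner ℝ ξ x) * Complex.I) • f ξ := by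
    have h1 : Continuous fun ξ : V => Complex.exp (↑(2 * π * inner ℝ ξ x) * Complex.I) • f ξ := by
      have := f.continuous
      fun_prop
    exact f.integrable.mono h1.aestronglyMeasurable
      (Filter.Eventually.of_forall fun ξ => by
        rw [norm_smul, Complex.norm_exp_ofReal_mul_I, one_mul])
  have := (EuclideanSpace.proj (𝕜 := ℂ) i).integral_comp_comm hint
  exact this.symm

/-- The phase of the inverse transform factors over the particles, since the inner product on
configurations is a sum over them; Fubini then splits the integral. -/
lemma fourierInv_tensorSchwartz {N : ℕ} (u : Fin N → 𝓢(Space, Spinor))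
    (hu : ∀ i, HasCompactSupport (u i)) (x : Config N) :
    (𝓕⁻ (tensorSchwartz u hu)) x = spinTensor fun ν => (𝓕⁻ (u ν)) (particle x ν) := by
  ext s
  rw [schwartz_fourierInv_apply]
  simp only [spinTensor]
  simp_rw [schwartz_fourierInv_apply]
  rw [← integral_config_prod
    (fun ν ξ => Complex.exp (↑(2 * π * inner ℝ ξ (particle x ν)) * Complex.I) * u ν ξ (s ν))]
  refine integral_congr_ae (Filter.Eventually.of_forall fun ξ => ?_)
  simp only [tensorSchwartz, HasCompactSupport.toSchwartzMap_toFun, spinTensor]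
  rw [Finset.prod_mul_distrib, inner_config]
  congr 1
  rw [← Complex.exp_sum]
  congr 1
  push_cast
  rw [Finset.mul_sum, Finset.sum_mul]

/-- The Slater determinant of smooth compactly supported functions. -/
def slaterSchwartz {N : ℕ} (u : Fin N → 𝓢(Space, Spinor)) (hu : ∀ i, HasCompactSupport (u i)) :
    𝓢(Config N, NSpin N) :=
  (((√(N.factorial : ℝ))⁻¹ : ℝ) : ℂ) • ∑ σ : Equiv.Perm (Fin N),
    ((Equiv.Perm.sign σ : ℤ) : ℂ) • tensorSchwartz (fun ν => u (σ ν)) fun ν => hu (σ ν)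

lemma slaterSchwartz_apply {N : ℕ} (u : Fin N → 𝓢(Space, Spinor))
    (hu : ∀ i, HasCompactSupport (u i)) (ξ : Config N) :
    slaterSchwartz u hu ξ = slaterFun (fun i => u i) ξ := by
  simp only [slaterSchwartz, slaterFun, slater, smul_apply, sum_apply]
  rfl

lemma fourierInv_slaterSchwartz {N : ℕ} (u : Fin N → 𝓢(Space, Spinor))
    (hu : ∀ i, HasCompactSupport (u i)) : 𝓕⁻ (slaterSchwartz u hu)
      = (((√(N.factorial : ℝ))⁻¹ : ℝ) : ℂ) • ∑ σ : Equiv.Perm (Fin N),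
        ((Equiv.Perm.sign σ : ℤ) : ℂ) •
          𝓕⁻ (tensorSchwartz (fun ν => u (σ ν)) fun ν => hu (σ ν)) := by
  rw [slaterSchwartz, FourierTransform.fourierInv_smul, FourierTransform.fourierInv_sum]
  simp_rw [FourierTransform.fourierInv_smul]

/-- The position space representation of a momentum space orbital. -/
abbrev positionOrbital (f : 𝓢(Space, Spinor)) : 𝓢(Space, Spinor) := 𝓕⁻ f

lemma fourierInv_slaterSchwartz_apply {N : ℕ} (u : Fin N → 𝓢(Space, Spinor))
    (hu : ∀ i, HasCompactSupport (u i)) (x : Config N) :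
    (𝓕⁻ (slaterSchwartz u hu)) x = slaterFun (fun i => positionOrbital (u i)) x := by
  simp only [fourierInv_slaterSchwartz, slaterFun, slater, smul_apply,
    sum_apply, fourierInv_tensorSchwartz]

/-! ### Slater determinants as allowed states -/

lemma particle_permute {N : ℕ} (σ : Equiv.Perm (Fin N)) (x : Config N) (ν : Fin N) :
    particle (permute σ x) ν = particle x (σ ν) := rfl

lemma measurePreserving_permute {N : ℕ} (σ : Equiv.Perm (Fin N)) :
    MeasurePreserving (permute σ) := by
  have := (LinearIsometryEquiv.piLpCongrLeft 2 ℝ ℝ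
    ((σ.prodCongr (Equiv.refl (Fin 3))).symm)).measurePreserving
  exact this

/-- Relabelling the particles amounts to the substitution `τ ↦ τ σ` in the sum over permutations,
which produces the sign of `σ`. -/
lemma slaterFun_permute {N : ℕ} (ψ : Fin N → Space → Spinor) (σ : Equiv.Perm (Fin N))
    (x : Config N) (s : Fin N → Spin) :
    slaterFun ψ (permute σ x) (s ∘ σ) = ((Equiv.Perm.sign σ : ℤ) : ℂ) * slaterFun ψ x s := by
  simp only [slaterFun, slater, PiLp.smul_apply, WithLp.ofLp_sum, Finset.sum_apply,
    WithLp.ofLp_smul, Pi.smul_apply, smul_eq_mul, particle_permute, spinTensor]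
  rw [mul_left_comm, Finset.mul_sum (a := ((Equiv.Perm.sign σ : ℤ) : ℂ))]
  congr 1
  rw [← Equiv.sum_comp (Equiv.mulRight σ)]
  refine Finset.sum_congr rfl fun τ _ => ?_
  simp only [Equiv.coe_mulRight, Equiv.Perm.sign_mul, Equiv.Perm.mul_apply, Function.comp_apply]
  rw [Equiv.prod_comp σ fun k => ψ (τ k) (particle x k) (s k)]
  push_cast
  ring

/-- The symbol `√(p² + m²)` of the absolute value of the Dirac operator at `p = 2 π ξ`. -/
def diracEnergy (m : ℝ) (ξ : Space) : ℝ := √(‖(2 * π) • ξ‖ ^ 2 + m ^ 2)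

/-- Momentum space orbitals: smooth compactly supported orthonormal functions with values in the
positive eigenspaces of the Dirac symbol. -/
structure IsOrbitals (m : ℝ) {N : ℕ} (u : Fin N → 𝓢(Space, Spinor)) : Prop where
  compact : ∀ i, HasCompactSupport (u i)
  positive : ∀ i ξ, diracSymbol m ((2 * π) • ξ) *ᵥ WithLp.ofLp (u i ξ)
    = (diracEnergy m ξ : ℂ) • WithLp.ofLp (u i ξ)
  orthonormal : ∀ i j, ∫ ξ, inner ℂ (u i ξ) (u j ξ) = if i = j then 1 else 0

lemma integrable_inner_schwartz {V F : Type*} [NormedAddCommGroup V] [NormedSpace ℝ V]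
    [MeasureSpace V] [BorelSpace V] [SecondCountableTopology V]
    [NormedAddCommGroup F] [InnerProductSpace ℂ F]
    [(volume : Measure V).HasTemperateGrowth] (f g : 𝓢(V, F)) :
    Integrable fun x => inner ℂ (f x) (g x) := by
  obtain ⟨C, -, hC⟩ := f.decay 0 0
  refine ((g.integrable (μ := volume)).norm.const_mul C).mono'
    (f.continuous.inner g.continuous).aestronglyMeasurable
    (Filter.Eventually.of_forall fun x => (norm_inner_le_norm _ _).trans ?_)
  have := hC x
  simp only [pow_zero, one_mul, norm_iteratedFDeriv_zero] at this
  gcongr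

lemma isOrthonormal_momentum {m : ℝ} {N : ℕ} {u : Fin N → 𝓢(Space, Spinor)}
    (hu : IsOrbitals m u) : IsOrthonormal fun i => (u i : Space → Spinor) where
  integrable _ _ := integrable_inner_schwartz _ _
  integral_eq := hu.orthonormal

lemma integral_inner_fourierInv (f g : 𝓢(Space, Spinor)) :
    ∫ x, inner ℂ ((𝓕⁻ f) x) ((𝓕⁻ g) x) = ∫ ξ, inner ℂ (f ξ) (g ξ) := by
  rw [← SchwartzMap.integral_inner_fourier_fourier (𝓕⁻ f) (𝓕⁻ g),
    FourierTransform.fourier_fourierInv_eq, FourierTransform.fourier_fourierInv_eq]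

lemma isOrthonormal_position {m : ℝ} {N : ℕ} {u : Fin N → 𝓢(Space, Spinor)}
    (hu : IsOrbitals m u) : IsOrthonormal fun i => (positionOrbital (u i) : Space → Spinor) where
  integrable _ _ := integrable_inner_schwartz _ _
  integral_eq i j := (integral_inner_fourierInv _ _).trans (hu.orthonormal i j)

/-- The state given by momentum space orbitals. -/
def slaterState {N : ℕ} (u : Fin N → 𝓢(Space, Spinor)) (hu : ∀ i, HasCompactSupport (u i)) :
    NParticle N :=
  (𝓕⁻ (slaterSchwartz u hu)).toLp 2

lemma slaterState_ae {N : ℕ} (u : Fin N → 𝓢(Space, Spinor)) (hu : ∀ i, HasCompactSupport (u i)) :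
    ∀ᵐ x : Config N, slaterState u hu x = slaterFun (fun i => positionOrbital (u i)) x := by
  filter_upwards [(𝓕⁻ (slaterSchwartz u hu)).coeFn_toLp 2] with x hx
  exact hx.trans (fourierInv_slaterSchwartz_apply u hu x)

lemma fourier_slaterState_ae {N : ℕ} (u : Fin N → 𝓢(Space, Spinor))
    (hu : ∀ i, HasCompactSupport (u i)) :
    ∀ᵐ ξ : Config N, (𝓕 (slaterState u hu) : NParticle N) ξ = slaterFun (fun i => u i) ξ := by
  rw [slaterState, SchwartzMap.toLp_fourier_eq, FourierTransform.fourier_fourierInv_eq]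
  filter_upwards [(slaterSchwartz u hu).coeFn_toLp 2] with ξ hξ
  exact hξ.trans (slaterSchwartz_apply u hu ξ)

/-- The wave function is a finite combination of products of positive energy orbitals, so it lies in
the span before any closure is taken. Being a Schwartz function, it has Sobolev regularity of every
order. -/
lemma isState_slaterState {m : ℝ} {N : ℕ} {u : Fin N → 𝓢(Space, Spinor)} (hu : IsOrbitals m u) :
    IsState m (slaterState u hu.compact) where
  norm_eq_one := by
    have h1 : ‖slaterState u hu.compact‖ ^ 2 = 1 := by
      rw [← integral_norm_sq_slaterFun (isOrthonormal_position hu)]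
      have h2 : inner ℂ (slaterState u hu.compact) (slaterState u hu.compact)
        = ∫ x, inner ℂ (slaterState u hu.compact x) (slaterState u hu.compact x) := rfl
      have h3 : ((‖slaterState u hu.compact‖ ^ 2 : ℝ) : ℂ)
          = (((∫ x : Config N, ‖slaterFun (fun i => positionOrbital (u i)) x‖ ^ 2) : ℝ) : ℂ) := by
        rw [← integral_complex_ofReal]
        have h4 := inner_self_eq_norm_sq_to_K (𝕜 := ℂ) (slaterState u hu.compact)
        rw [h2] at h4
        rw [Complex.ofReal_pow]
        refine h4.symm.trans (integral_congr_ae ?_)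
        filter_upwards [slaterState_ae u hu.compact] with x hx
        rw [hx, inner_self_eq_norm_sq_to_K]
        norm_cast
      exact_mod_cast h3
    exact (pow_eq_one_iff_of_nonneg (norm_nonneg _) two_ne_zero).1 h1
  antisymmetric σ := by
    have h1 := slaterState_ae u hu.compact
    filter_upwards [h1, (measurePreserving_permute σ).quasiMeasurePreserving.ae h1] with x hx hx' s
    rw [hx, hx', slaterFun_permute]
  mem_positive := by
    apply Submodule.le_topologicalClosure
    have : slaterState u hu.compact
        = (((√(N.factorial : ℝ))⁻¹ : ℝ) : ℂ) • ∑ σ : Equiv.Perm (Fin N),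
          ((Equiv.Perm.sign σ : ℤ) : ℂ) • (𝓕⁻ (tensorSchwartz (fun ν => u (σ ν))
            fun ν => hu.compact (σ ν))).toLp 2 := by
      rw [slaterState, fourierInv_slaterSchwartz, ← SchwartzMap.toLpCLM_apply (𝕜 := ℂ), map_smul,
        map_sum]
      simp_rw [map_smul, SchwartzMap.toLpCLM_apply]
    rw [this]
    refine Submodule.smul_mem _ _ (Submodule.sum_mem _ fun σ _ => Submodule.smul_mem _ _ ?_)
    refine Submodule.subset_span ⟨fun ν => (positionOrbital (u (σ ν))).toLp 2, fun ν => ?_, ?_⟩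
    · change ∀ᵐ ξ : Space, _
      rw [SchwartzMap.toLp_fourier_eq, FourierTransform.fourier_fourierInv_eq]
      filter_upwards [(u (σ ν)).coeFn_toLp 2] with ξ hξ
      rw [hξ]
      exact hu.positive _ _
    · have h1 := (𝓕⁻ (tensorSchwartz (fun ν => u (σ ν)) fun ν => hu.compact (σ ν))).coeFn_toLp 2
      have h2 : ∀ᵐ x : Config N, ∀ ν, ((positionOrbital (u (σ ν))).toLp 2 : OneParticle)
          (particle x ν) = positionOrbital (u (σ ν)) (particle x ν) := by
        rw [ae_all_iff]
        intro ν
        have h3 : ∀ᵐ y : Space, ((positionOrbital (u (σ ν))).toLp 2 : OneParticle) y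
            = positionOrbital (u (σ ν)) y := (positionOrbital (u (σ ν))).coeFn_toLp 2 volume
        exact (quasiMeasurePreserving_particle ν).ae h3
      filter_upwards [h1, h2] with x hx hx' s
      rw [hx, fourierInv_tensorSchwartz]
      simp only [spinTensor, hx']
  finite_kinetic := by
    rw [slaterState, MeasureTheory.Lp.toTemperedDistribution_toLp_eq]
    exact SchwartzMap.memSobolev _

/-! ### Integrability of the Coulomb kernel -/

/-- The Coulomb kernel, cut off at distance one. -/
def coulombCore (x : Space) : ℝ := (Metric.ball (0 : Space) 1).indicator (fun y => 1 / ‖y‖) x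

lemma integrable_coulombCore : Integrable coulombCore := by
  have h : IntegrableOn (fun x : Space => (fun r : ℝ => 1 / r) ‖x‖) (Metric.ball (0 : Space) 1) := by
    rw [integrableOn_fun_norm_addHaar]
    have : IntegrableOn (fun y : ℝ => y) (Set.Ioo 0 1) :=
      (continuous_id.integrableOn_Icc (a := 0) (b := 1)).mono_set Set.Ioo_subset_Icc_self
    refine this.congr_fun (fun y hy => ?_) measurableSet_Ioo
    have hy0 : y ≠ 0 := hy.1.ne'
    simp only [finrank_euclideanSpace, Fintype.card_fin, smul_eq_mul]
    field_simp
  exact (integrable_indicator_iff Metric.isOpen_ball.measurableSet).2 h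

lemma coulombCore_nonneg (x : Space) : 0 ≤ coulombCore x :=
  Set.indicator_nonneg (fun _ _ => by positivity) _

/-- The total mass of the cut off Coulomb kernel. -/
def coreMass : ℝ := ∫ x, coulombCore x

/-- This splits the kernel into an integrable part near the origin and a bounded part. The former is
controlled by the supremum of a density, the latter by its total charge. -/
lemma inv_norm_le_core (x : Space) : 1 / ‖x‖ ≤ coulombCore x + 1 := by
  by_cases hx : x ∈ Metric.ball (0 : Space) 1
  · rw [coulombCore, Set.indicator_of_mem hx]
    linarith
  · rw [coulombCore, Set.indicator_of_notMem hx, zero_add]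
    rw [mem_ball_zero_iff, not_lt] at hx
    rw [div_le_one (by linarith)]
    exact hx

lemma measurable_inv_norm_sub : Measurable fun p : Space × Space => 1 / ‖p.1 - p.2‖ := by
  fun_prop

lemma integrable_coulomb_potential {h : Space → ℂ} (hint : Integrable h) {C : ℝ}
    (hC : ∀ x, ‖h x‖ ≤ C) (R : Space) : Integrable fun x => ((1 / ‖x - R‖ : ℝ) : ℂ) * h x := by
  have h1 : Integrable fun x => C * coulombCore (x - R) + ‖h x‖ :=
    ((integrable_coulombCore.comp_sub_right R).const_mul C).add hint.norm
  refine h1.mono' ?_ (Filter.Eventually.of_forall fun x => ?_)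
  · refine AEStronglyMeasurable.mul ?_ hint.1
    exact (Complex.measurable_ofReal.comp
      (measurable_const.div (measurable_id.sub_const R).norm)).aestronglyMeasurable
  · rw [norm_mul, Complex.norm_real, Real.norm_of_nonneg (by positivity)]
    have h2 := inv_norm_le_core (x - R)
    have h3 := coulombCore_nonneg (x - R)
    calc 1 / ‖x - R‖ * ‖h x‖ ≤ (coulombCore (x - R) + 1) * ‖h x‖ := by gcongr
      _ = coulombCore (x - R) * ‖h x‖ + ‖h x‖ := by ring
      _ ≤ coulombCore (x - R) * C + ‖h x‖ := by gcongr; exact hC x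
      _ = _ := by ring

lemma integrable_core_pair {f : Space → ℝ} (hf : Integrable f) :
    Integrable fun p : Space × Space => f p.2 * coulombCore (p.1 - p.2) :=
  hf.convolution_integrand (ContinuousLinearMap.mul ℝ ℝ) integrable_coulombCore

lemma integral_core_pair {f : Space → ℝ} (hf : Integrable f) :
    ∫ p : Space × Space, f p.2 * coulombCore (p.1 - p.2) = (∫ x, f x) * coreMass := by
  rw [Measure.volume_eq_prod, integral_prod _ (integrable_core_pair hf)]
  exact integral_convolution (ContinuousLinearMap.mul ℝ ℝ) hf integrable_coulombCore

lemma norm_coulomb_pair_le {h₁ h₂ : Space → ℂ} {C : ℝ} (hC : ∀ x, ‖h₁ x‖ ≤ C)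
    (p : Space × Space) : ‖((1 / ‖p.1 - p.2‖ : ℝ) : ℂ) * (h₁ p.1 * h₂ p.2)‖
      ≤ C * (‖h₂ p.2‖ * coulombCore (p.1 - p.2)) + ‖h₁ p.1‖ * ‖h₂ p.2‖ := by
  rw [norm_mul, norm_mul, Complex.norm_real, Real.norm_of_nonneg (by positivity)]
  have h2 := inv_norm_le_core (p.1 - p.2)
  have h3 := coulombCore_nonneg (p.1 - p.2)
  calc 1 / ‖p.1 - p.2‖ * (‖h₁ p.1‖ * ‖h₂ p.2‖)
      ≤ (coulombCore (p.1 - p.2) + 1) * (‖h₁ p.1‖ * ‖h₂ p.2‖) := by gcongr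
    _ = ‖h₁ p.1‖ * (‖h₂ p.2‖ * coulombCore (p.1 - p.2)) + ‖h₁ p.1‖ * ‖h₂ p.2‖ := by ring
    _ ≤ _ := by gcongr; exact hC p.1

lemma integrable_coulomb_pair {h₁ h₂ : Space → ℂ} (hint₁ : Integrable h₁) (hint₂ : Integrable h₂)
    {C : ℝ} (hC : ∀ x, ‖h₁ x‖ ≤ C) : Integrable fun p : Space × Space =>
      ((1 / ‖p.1 - p.2‖ : ℝ) : ℂ) * (h₁ p.1 * h₂ p.2) := by
  have h1 := ((integrable_core_pair hint₂.norm).const_mul C).add (hint₁.norm.mul_prod hint₂.norm)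
  refine h1.mono' ?_ (Filter.Eventually.of_forall fun p => norm_coulomb_pair_le hC p)
  exact (Complex.measurable_ofReal.comp measurable_inv_norm_sub).aestronglyMeasurable.mul
    (hint₁.mul_prod hint₂).1

/-- Real densities with integrable bounded values. -/
structure IsDensity (ρ : Space → ℝ) : Prop where
  continuous : Continuous ρ
  nonneg : ∀ x, 0 ≤ ρ x
  integrable : Integrable ρ
  bounded : ∃ C, ∀ x, ρ x ≤ C

lemma IsDensity.integrable_ofReal {ρ : Space → ℝ} (h : IsDensity ρ) :
    Integrable fun x => (ρ x : ℂ) := h.integrable.ofReal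

lemma IsDensity.integrable_pair {ρ₁ ρ₂ : Space → ℝ} (h₁ : IsDensity ρ₁) (h₂ : IsDensity ρ₂) :
    Integrable fun p : Space × Space => 1 / ‖p.1 - p.2‖ * (ρ₁ p.1 * ρ₂ p.2) := by
  obtain ⟨C, hC⟩ := h₁.bounded
  have := (integrable_coulomb_pair h₁.integrable_ofReal h₂.integrable_ofReal (C := C)
    (fun x => by rw [Complex.norm_real, Real.norm_of_nonneg (h₁.nonneg x)]; exact hC x)).re
  refine this.congr (Filter.Eventually.of_forall fun p => ?_)
  simp only [RCLike.re_eq_complex_re]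
  rw [← Complex.ofReal_mul, ← Complex.ofReal_mul, Complex.ofReal_re]

lemma IsDensity.integrable_potential {ρ : Space → ℝ} (h : IsDensity ρ) (R : Space) :
    Integrable fun x => 1 / ‖x - R‖ * ρ x := by
  obtain ⟨C, hC⟩ := h.bounded
  have := (integrable_coulomb_potential h.integrable_ofReal (C := C)
    (fun x => by rw [Complex.norm_real, Real.norm_of_nonneg (h.nonneg x)]; exact hC x) R).re
  refine this.congr (Filter.Eventually.of_forall fun p => ?_)
  simp only [RCLike.re_eq_complex_re]
  rw [← Complex.ofReal_mul, Complex.ofReal_re]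

/-- The Coulomb interaction of two densities. -/
def coulombEnergy (ρ₁ ρ₂ : Space → ℝ) : ℝ :=
  ∫ p : Space × Space, 1 / ‖p.1 - p.2‖ * (ρ₁ p.1 * ρ₂ p.2)

lemma coulombEnergy_nonneg {ρ₁ ρ₂ : Space → ℝ} (h₁ : IsDensity ρ₁) (h₂ : IsDensity ρ₂) :
    0 ≤ coulombEnergy ρ₁ ρ₂ :=
  integral_nonneg fun p => mul_nonneg (by positivity) (mul_nonneg (h₁.nonneg _) (h₂.nonneg _))

lemma coulombEnergy_comm (ρ₁ ρ₂ : Space → ℝ) : coulombEnergy ρ₁ ρ₂ = coulombEnergy ρ₂ ρ₁ := by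
  rw [coulombEnergy, coulombEnergy, Measure.volume_eq_prod, ← integral_prod_swap]
  refine integral_congr_ae (Filter.Eventually.of_forall fun p => ?_)
  simp only [Prod.fst_swap, Prod.snd_swap]
  rw [norm_sub_rev, mul_comm (ρ₁ p.2)]

/-- Only the supremum and mass of `ρ₁` and the mass of `ρ₂` enter. With `ρ₁` the fixed excess
electrons and `ρ₂` the cluster, the bound is uniform in the momentum scale, although the cluster
density concentrates. -/
lemma coulombEnergy_le {ρ₁ ρ₂ : Space → ℝ} (h₁ : IsDensity ρ₁) (h₂ : IsDensity ρ₂) {C : ℝ}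
    (hC : ∀ x, ρ₁ x ≤ C) :
    coulombEnergy ρ₁ ρ₂ ≤ (C * coreMass + ∫ x, ρ₁ x) * ∫ x, ρ₂ x := by
  have hi := ((integrable_core_pair h₂.integrable).const_mul C).add
    (h₁.integrable.mul_prod h₂.integrable)
  have h := integral_mono (h₁.integrable_pair h₂) hi (fun p => by
    have := norm_coulomb_pair_le (h₁ := fun x => (ρ₁ x : ℂ)) (h₂ := fun x => (ρ₂ x : ℂ)) (C := C)
      (fun x => by rw [Complex.norm_real, Real.norm_of_nonneg (h₁.nonneg x)]; exact hC x) p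
    rw [← Complex.ofReal_mul, ← Complex.ofReal_mul] at this
    simp only [Complex.norm_real, Real.norm_of_nonneg (h₁.nonneg _),
      Real.norm_of_nonneg (h₂.nonneg _)] at this
    exact (le_abs_self _).trans this)
  refine h.trans (le_of_eq ?_)
  have h1 := integral_add ((integrable_core_pair h₂.integrable).const_mul C)
    (h₁.integrable.mul_prod h₂.integrable)
  refine h1.trans ?_
  rw [integral_const_mul, integral_core_pair h₂.integrable]
  have h2 := integral_prod_mul (μ := (volume : Measure Space)) (ν := (volume : Measure Space)) ρ₁ ρ₂
  rw [Measure.volume_eq_prod, h2]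
  ring

lemma IsDensity.add {ρ₁ ρ₂ : Space → ℝ} (h₁ : IsDensity ρ₁) (h₂ : IsDensity ρ₂) :
    IsDensity fun x => ρ₁ x + ρ₂ x where
  continuous := h₁.continuous.add h₂.continuous
  nonneg x := add_nonneg (h₁.nonneg x) (h₂.nonneg x)
  integrable := h₁.integrable.add h₂.integrable
  bounded := by
    obtain ⟨C, hC⟩ := h₁.bounded
    obtain ⟨D, hD⟩ := h₂.bounded
    exact ⟨C + D, fun x => add_le_add (hC x) (hD x)⟩

lemma coulombEnergy_add {ρ₁ ρ₂ : Space → ℝ} (h₁ : IsDensity ρ₁) (h₂ : IsDensity ρ₂) :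
    coulombEnergy (fun x => ρ₁ x + ρ₂ x) (fun x => ρ₁ x + ρ₂ x)
      = coulombEnergy ρ₁ ρ₁ + 2 * coulombEnergy ρ₂ ρ₁ + coulombEnergy ρ₂ ρ₂ := by
  have h12 : coulombEnergy ρ₁ ρ₂ + coulombEnergy ρ₂ ρ₁ = 2 * coulombEnergy ρ₂ ρ₁ := by
    rw [coulombEnergy_comm ρ₁ ρ₂]; ring
  have : coulombEnergy (fun x => ρ₁ x + ρ₂ x) (fun x => ρ₁ x + ρ₂ x)
      = (coulombEnergy ρ₁ ρ₁ + coulombEnergy ρ₁ ρ₂)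
        + (coulombEnergy ρ₂ ρ₁ + coulombEnergy ρ₂ ρ₂) := by
    simp only [coulombEnergy]
    rw [← integral_add (h₁.integrable_pair h₁) (h₁.integrable_pair h₂),
      ← integral_add (h₂.integrable_pair h₁) (h₂.integrable_pair h₂)]
    refine Eq.trans ?_ (integral_add ((h₁.integrable_pair h₁).add (h₁.integrable_pair h₂))
      ((h₂.integrable_pair h₁).add (h₂.integrable_pair h₂)))
    refine integral_congr_ae (Filter.Eventually.of_forall fun p => ?_)
    simp only
    ring
  rw [this]
  linarith

/-! ### The energy of a Slater determinant -/

lemma exists_norm_le_schwartz {F : Type*} [NormedAddCommGroup F] [NormedSpace ℝ F]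
    (f : 𝓢(Space, F)) : ∃ C, 0 ≤ C ∧ ∀ x, ‖f x‖ ≤ C := by
  obtain ⟨C, hC0, hC⟩ := f.decay 0 0
  refine ⟨C, hC0.le, fun x => ?_⟩
  simpa using hC x

lemma integrable_norm_sq_schwartz (f : 𝓢(Space, Spinor)) : Integrable fun x => ‖f x‖ ^ 2 := by
  have h := (integrable_inner_schwartz f f).re
  refine h.congr (Filter.Eventually.of_forall fun x => ?_)
  exact inner_self_eq_norm_sq (f x)

lemma isDensity_norm_sq (f : 𝓢(Space, Spinor)) : IsDensity fun x => ‖f x‖ ^ 2 where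
  continuous := by have := f.continuous; fun_prop
  nonneg x := by positivity
  integrable := integrable_norm_sq_schwartz f
  bounded := by
    obtain ⟨C, hC0, hC⟩ := exists_norm_le_schwartz f
    exact ⟨C ^ 2, fun x => pow_le_pow_left₀ (norm_nonneg _) (hC x) 2⟩

lemma isDensity_sum {ι : Type*} (s : Finset ι) (f : ι → 𝓢(Space, Spinor)) :
    IsDensity fun x => ∑ i ∈ s, ‖f i x‖ ^ 2 := by
  classical
  induction s using Finset.induction_on with
  | empty => exact ⟨by simpa using continuous_const, by simp, by simp, ⟨0, by simp⟩⟩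
  | insert a s ha ih =>
    simp_rw [Finset.sum_insert ha]
    exact (isDensity_norm_sq (f a)).add ih

lemma norm_inner_le_of_le {f g : 𝓢(Space, Spinor)} {C D : ℝ} (hC0 : 0 ≤ C) (hC : ∀ x, ‖f x‖ ≤ C)
    (hD : ∀ x, ‖g x‖ ≤ D) (x : Space) : ‖(inner ℂ (f x) (g x) : ℂ)‖ ≤ C * D :=
  (norm_inner_le_norm _ _).trans (mul_le_mul (hC x) (hD x) (norm_nonneg _) hC0)

section Energy

variable {m : ℝ} {N : ℕ} {u : Fin N → 𝓢(Space, Spinor)}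

lemma continuous_diracEnergy (m : ℝ) : Continuous (diracEnergy m) := by
  unfold diracEnergy
  fun_prop

/-- The orbitals take values in the positive eigenspaces, so the matrix symbol acts on them as the
scalar `diracEnergy`, and the one-body formula is applied in momentum space. -/
lemma sum_freeDiracForm (hu : IsOrbitals m u) :
    ∑ ν, freeDiracForm m ν (slaterState u hu.compact)
      = ∑ i, ∫ ξ, diracEnergy m ξ * ‖u i ξ‖ ^ 2 := by
  have hact : ∀ i ξ, actSpinor (diracSymbol m ((2 * π) • ξ)) (u i ξ)
      = (diracEnergy m ξ : ℂ) • u i ξ := fun i ξ => by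
    ext s
    simp [actSpinor, hu.positive i ξ]
  have hM : ∀ i j, Integrable fun ξ =>
      inner ℂ (u i ξ) (actSpinor (diracSymbol m ((2 * π) • ξ)) (u j ξ)) := by
    intro i j
    simp_rw [hact]
    refine Continuous.integrable_of_hasCompactSupport ?_ ?_
    · have h1 := (u i).continuous
      have h2 := (u j).continuous
      have h3 := continuous_diracEnergy m
      fun_prop
    · refine (hu.compact i).mono fun ξ hξ h0 => hξ ?_
      simp only [h0, inner_zero_left]
  have h1 := sum_integral_oneBody (isOrthonormal_momentum hu) hM
  have h2 : ∀ ν, freeDiracForm m ν (slaterState u hu.compact)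
      = ∫ x : Config N, (inner ℂ (slaterFun (fun i => u i) x)
        (onSpin (diracSymbol m ((2 * π) • particle x ν)) ν (slaterFun (fun i => u i) x))).re := by
    intro ν
    refine integral_congr_ae ?_
    filter_upwards [fourier_slaterState_ae u hu.compact] with ξ hξ
    rw [hξ]
  simp_rw [h2]
  refine h1.trans (Finset.sum_congr rfl fun i _ => integral_congr_ae
    (Filter.Eventually.of_forall fun ξ => ?_))
  simp only []
  rw [hact, inner_smul_right, Complex.re_ofReal_mul]
  congr 1
  exact inner_self_eq_norm_sq (𝕜 := ℂ) (u i ξ)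

lemma sum_magneticForm (hu : IsOrbitals m u) {e : ℝ} {A : Space → Space}
    (hM : ∀ i j, Integrable fun x => inner ℂ (positionOrbital (u i) x)
      (actSpinor (alphaDot (e • A x)) (positionOrbital (u j) x))) :
    ∑ ν, magneticForm e A ν (slaterState u hu.compact)
      = ∑ i, ∫ x, (inner ℂ (positionOrbital (u i) x)
        (actSpinor (alphaDot (e • A x)) (positionOrbital (u i) x))).re := by
  rw [← sum_integral_oneBody (isOrthonormal_position hu) hM]
  refine Finset.sum_congr rfl fun ν _ => integral_congr_ae ?_
  filter_upwards [slaterState_ae u hu.compact] with x hx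
  rw [hx]

/-- The electron density of a family of orbitals. -/
abbrev orbitalDensity (u : Fin N → 𝓢(Space, Spinor)) : Space → ℝ :=
  density fun i => (positionOrbital (u i) : Space → Spinor)

lemma isDensity_orbitalDensity (u : Fin N → 𝓢(Space, Spinor)) : IsDensity (orbitalDensity u) :=
  isDensity_sum Finset.univ fun i => positionOrbital (u i)

/-- The attraction energy of a density in the field of a unit charge at `R`. -/
def attraction (ρ : Space → ℝ) (R : Space) : ℝ := ∫ x, 1 / ‖x - R‖ * ρ x

lemma attraction_nonneg {ρ : Space → ℝ} (h : IsDensity ρ) (R : Space) : 0 ≤ attraction ρ R :=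
  integral_nonneg fun x => mul_nonneg (by positivity) (h.nonneg x)

/-- The mutual repulsion of the nuclei. -/
def nuclearRepulsion {K : ℕ} (Z : Fin K → ℝ) (R : Fin K → Space) : ℝ :=
  ∑ l : Fin K, ∑ κ ∈ Finset.Iio l, Z κ * Z l / ‖R κ - R l‖

/-- The nuclear attraction is treated as a one-body operator whose matrix is a multiple of the
identity, so that the general one-body formula applies to it. -/
lemma actSpinor_inv (c : ℝ) (a b : Spinor) :
    inner ℂ a (actSpinor ((c : ℂ) • (1 : Matrix Spin Spin ℂ)) b) = (c : ℂ) * inner ℂ a b := by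
  rw [actSpinor_smul_one, inner_smul_right]

lemma integrable_overlap_pair (f g f' g' : 𝓢(Space, Spinor)) :
    Integrable fun p : Space × Space => ((1 / ‖p.1 - p.2‖ : ℝ) : ℂ) *
      (inner ℂ (f p.1) (g p.1) * inner ℂ (f' p.2) (g' p.2)) := by
  obtain ⟨C, hC0, hC⟩ := exists_norm_le_schwartz f
  obtain ⟨D, hD0, hD⟩ := exists_norm_le_schwartz g
  have h1 : Integrable fun x => (inner ℂ (f x) (g x) : ℂ) := integrable_inner_schwartz f g
  have h2 : Integrable fun x => (inner ℂ (f' x) (g' x) : ℂ) := integrable_inner_schwartz f' g'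
  exact integrable_coulomb_pair (h₁ := fun x => inner ℂ (f x) (g x))
    (h₂ := fun x => inner ℂ (f' x) (g' x)) h1 h2 (C := C * D) (norm_inner_le_of_le hC0 hC hD)

lemma integrable_attraction_orbital (f g : 𝓢(Space, Spinor)) (S : Space) :
    Integrable fun x => inner ℂ (positionOrbital f x)
      (actSpinor (((1 / ‖x - S‖ : ℝ) : ℂ) • (1 : Matrix Spin Spin ℂ)) (positionOrbital g x)) := by
  simp_rw [actSpinor_inv]
  obtain ⟨C, hC0, hC⟩ := exists_norm_le_schwartz (positionOrbital f)
  obtain ⟨D, hD0, hD⟩ := exists_norm_le_schwartz (positionOrbital g)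
  have h1 : Integrable fun x => inner ℂ (positionOrbital f x) (positionOrbital g x) :=
    integrable_inner_schwartz _ _
  exact integrable_coulomb_potential h1 (C := C * D) (norm_inner_le_of_le hC0 hC hD) S

lemma inner_onSpin_inv (ψ : Fin N → Space → Spinor) (S : Space) (ν : Fin N) (x : Config N) :
    inner ℂ (slaterFun ψ x) (onSpin (((1 / ‖particle x ν - S‖ : ℝ) : ℂ) •
      (1 : Matrix Spin Spin ℂ)) ν (slaterFun ψ x))
      = ((1 / ‖particle x ν - S‖ * ‖slaterFun ψ x‖ ^ 2 : ℝ) : ℂ) := by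
  rw [onSpin_smul_one, inner_smul_right, inner_self_eq_norm_sq_to_K]
  push_cast
  rfl

lemma integrable_attraction_slater (hu : IsOrbitals m u) (S : Space) (ν : Fin N) :
    Integrable fun x : Config N =>
      1 / ‖particle x ν - S‖ * ‖slaterFun (fun i => positionOrbital (u i)) x‖ ^ 2 := by
  have := (integrable_oneBody (isOrthonormal_position hu)
    (fun i j => integrable_attraction_orbital (u i) (u j) S) ν).re
  refine this.congr (Filter.Eventually.of_forall fun x => ?_)
  simp only [RCLike.re_eq_complex_re]
  rw [inner_onSpin_inv, Complex.ofReal_re]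

lemma sum_integral_attraction (hu : IsOrbitals m u) (S : Space) :
    ∑ ν, ∫ x : Config N,
        1 / ‖particle x ν - S‖ * ‖slaterFun (fun i => positionOrbital (u i)) x‖ ^ 2
      = attraction (orbitalDensity u) S := by
  have h := sum_integral_oneBody (isOrthonormal_position hu)
    (fun i j => integrable_attraction_orbital (u i) (u j) S)
  simp only [inner_onSpin_inv, Complex.ofReal_re, actSpinor_inv] at h
  rw [h, attraction]
  simp only [orbitalDensity, density, Finset.mul_sum]
  rw [integral_finsetSum _ fun i _ =>
    (isDensity_norm_sq (positionOrbital (u i))).integrable_potential S]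
  refine Finset.sum_congr rfl fun i _ => integral_congr_ae
    (Filter.Eventually.of_forall fun x => ?_)
  simp only []
  rw [Complex.re_ofReal_mul]
  congr 1
  exact inner_self_eq_norm_sq (𝕜 := ℂ) (positionOrbital (u i) x)

lemma integrable_repulsion_slater (hu : IsOrbitals m u) {μ ν : Fin N} (hμν : μ ≠ ν) :
    Integrable fun x : Config N => 1 / ‖particle x μ - particle x ν‖ *
      ‖slaterFun (fun i => positionOrbital (u i)) x‖ ^ 2 :=
  integrable_twoBody (v := fun x y => 1 / ‖x - y‖) (isOrthonormal_position hu)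
    (fun i j k l => integrable_overlap_pair (positionOrbital (u i)) (positionOrbital (u j))
      (positionOrbital (u k)) (positionOrbital (u l))) hμν

lemma sum_integral_repulsion_le (hu : IsOrbitals m u) :
    ∑ ν : Fin N, ∑ μ ∈ Finset.Iio ν, ∫ x : Config N, 1 / ‖particle x μ - particle x ν‖ *
      ‖slaterFun (fun i => positionOrbital (u i)) x‖ ^ 2
      ≤ 1 / 2 * coulombEnergy (orbitalDensity u) (orbitalDensity u) :=
  sum_integral_twoBody_le (v := fun x y => 1 / ‖x - y‖) (isOrthonormal_position hu)
    (fun i j k l => integrable_overlap_pair (positionOrbital (u i)) (positionOrbital (u j))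
      (positionOrbital (u k)) (positionOrbital (u l)))
    (fun x y => by rw [norm_sub_rev]) (fun x y => by positivity)

lemma coulomb_mul {K : ℕ} (Z : Fin K → ℝ) (R : Fin K → Space) (x : Config N) (w : ℝ) :
    coulomb Z R x * w = (-(∑ κ, Z κ * ∑ ν, 1 / ‖particle x ν - R κ‖ * w)
      + ∑ ν, ∑ μ ∈ Finset.Iio ν, 1 / ‖particle x μ - particle x ν‖ * w)
      + nuclearRepulsion Z R * w := by
  have h1 : (∑ ν : Fin N, ∑ κ, Z κ / ‖particle x ν - R κ‖) * w
      = ∑ κ, Z κ * ∑ ν, 1 / ‖particle x ν - R κ‖ * w := by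
    rw [Finset.sum_comm, Finset.sum_mul]
    refine Finset.sum_congr rfl fun κ _ => ?_
    rw [Finset.sum_mul, Finset.mul_sum]
    exact Finset.sum_congr rfl fun ν _ => by ring
  have h2 : (∑ ν : Fin N, ∑ μ ∈ Finset.Iio ν, 1 / ‖particle x μ - particle x ν‖) * w
      = ∑ ν, ∑ μ ∈ Finset.Iio ν, 1 / ‖particle x μ - particle x ν‖ * w := by
    rw [Finset.sum_mul]
    exact Finset.sum_congr rfl fun ν _ => Finset.sum_mul _ _ _
  rw [← h1, ← h2, coulomb, nuclearRepulsion]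
  ring

lemma integral_neg_add_add {X : Type*} [MeasurableSpace X] {ν : Measure X} {f g h : X → ℝ}
    (hf : Integrable f ν) (hg : Integrable g ν) (hh : Integrable h ν) :
    ∫ x, (-f x + g x + h x) ∂ν = -(∫ x, f x ∂ν) + (∫ x, g x ∂ν) + ∫ x, h x ∂ν := by
  rw [← integral_neg]
  refine (integral_add (hf.neg.add hg) hh).trans ?_
  congr 1
  exact integral_add hf.neg hg

lemma integral_coulomb_le (hu : IsOrbitals m u) {K : ℕ} (Z : Fin K → ℝ) (R : Fin K → Space) :
    ∫ x : Config N, coulomb Z R x * ‖slaterState u hu.compact x‖ ^ 2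
      ≤ -(∑ κ, Z κ * attraction (orbitalDensity u) (R κ))
        + 1 / 2 * coulombEnergy (orbitalDensity u) (orbitalDensity u)
        + nuclearRepulsion Z R := by
  have hi1 := fun S ν => integrable_attraction_slater hu S ν
  have hi2 : ∀ ν, ∀ μ ∈ Finset.Iio ν, Integrable fun x : Config N =>
      1 / ‖particle x μ - particle x ν‖ * ‖slaterFun (fun i => positionOrbital (u i)) x‖ ^ 2 :=
    fun ν μ hμ => integrable_repulsion_slater hu (Finset.mem_Iio.1 hμ).ne
  have hcongr : ∫ x : Config N, coulomb Z R x * ‖slaterState u hu.compact x‖ ^ 2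
      = ∫ x : Config N, coulomb Z R x *
        ‖slaterFun (fun i => positionOrbital (u i)) x‖ ^ 2 := by
    refine integral_congr_ae ?_
    filter_upwards [slaterState_ae u hu.compact] with x hx
    rw [hx]
  have hA : ∀ κ, ∫ x : Config N, Z κ * ∑ ν, 1 / ‖particle x ν - R κ‖ *
      ‖slaterFun (fun i => positionOrbital (u i)) x‖ ^ 2
      = Z κ * attraction (orbitalDensity u) (R κ) := fun κ => by
    rw [integral_const_mul, integral_finsetSum _ fun ν _ => hi1 (R κ) ν,
      sum_integral_attraction hu]
  rw [hcongr]
  simp_rw [coulomb_mul]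
  rw [integral_neg_add_add
    (integrable_finsetSum _ fun κ _ =>
      (integrable_finsetSum _ fun ν _ => hi1 (R κ) ν).const_mul (Z κ))
    (integrable_finsetSum _ fun ν _ => integrable_finsetSum _ fun μ hμ => hi2 ν μ hμ)
    ((integrable_norm_sq_slaterFun (isOrthonormal_position hu)).const_mul _),
    integral_const_mul, integral_norm_sq_slaterFun (isOrthonormal_position hu), mul_one,
    integral_finsetSum _ fun κ _ =>
      (integrable_finsetSum _ fun ν _ => hi1 (R κ) ν).const_mul (Z κ),
    integral_finsetSum _ fun ν _ => integrable_finsetSum _ fun μ hμ => hi2 ν μ hμ]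
  have h2 := sum_integral_repulsion_le hu
  have h3 : ∀ ν : Fin N, ∫ x : Config N, ∑ μ ∈ Finset.Iio ν,
      1 / ‖particle x μ - particle x ν‖ * ‖slaterFun (fun i => positionOrbital (u i)) x‖ ^ 2
      = ∑ μ ∈ Finset.Iio ν, ∫ x : Config N, 1 / ‖particle x μ - particle x ν‖ *
        ‖slaterFun (fun i => positionOrbital (u i)) x‖ ^ 2 := fun ν =>
    integral_finsetSum _ fun μ hμ => hi2 ν μ hμ
  rw [Finset.sum_congr rfl fun κ _ => hA κ, Finset.sum_congr rfl fun ν _ => h3 ν]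
  linarith

/-- Upper bound for the energy of a Slater determinant. -/
lemma energy_slaterState_le (hu : IsOrbitals m u) {α : ℝ} (hα : 0 ≤ α) {K : ℕ} (Z : Fin K → ℝ)
    (R : Fin K → Space) {A : Space → Space} (B : Space → Space)
    (hM : ∀ i j, Integrable fun x => inner ℂ (positionOrbital (u i) x)
      (actSpinor (alphaDot (√α • A x)) (positionOrbital (u j) x))) :
    energy α m Z R A B (slaterState u hu.compact)
      ≤ (∑ i, ∫ ξ, diracEnergy m ξ * ‖u i ξ‖ ^ 2)
        + (∑ i, ∫ x, (inner ℂ (positionOrbital (u i) x)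
          (actSpinor (alphaDot (√α • A x)) (positionOrbital (u i) x))).re)
        + α * (-(∑ κ, Z κ * attraction (orbitalDensity u) (R κ))
          + 1 / 2 * coulombEnergy (orbitalDensity u) (orbitalDensity u)
          + nuclearRepulsion Z R)
        + 1 / (8 * π) * ∫ x : Space, ‖B x‖ ^ 2 := by
  rw [energy, Finset.sum_add_distrib, sum_freeDiracForm hu, sum_magneticForm hu hM]
  gcongr
  exact integral_coulomb_le hu Z R

end Energy

/-! ### Vector potentials generated by a scalar function -/

/-- The partial derivative in direction `i`. -/
def pderiv (i : Fin 3) (f : Space → ℝ) (x : Space) : ℝ :=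
  fderiv ℝ f x (EuclideanSpace.single i 1)

lemma contDiff_pderiv {f : Space → ℝ} (hf : ContDiff ℝ ∞ f) (i : Fin 3) :
    ContDiff ℝ ∞ (pderiv i f) :=
  (hf.fderiv_right (m := ∞) le_rfl).clm_apply contDiff_const

lemma hasCompactSupport_pderiv {f : Space → ℝ} (hf : HasCompactSupport f) (i : Fin 3) :
    HasCompactSupport (pderiv i f) :=
  hf.fderiv_apply ℝ _

lemma pderiv_comm {f : Space → ℝ} (hf : ContDiff ℝ ∞ f) (i j : Fin 3) (x : Space) :
    pderiv i (pderiv j f) x = pderiv j (pderiv i f) x := by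
  have hd : DifferentiableAt ℝ (fderiv ℝ f) x :=
    (hf.fderiv_right (m := ∞) le_rfl).differentiable (by simp) x
  have h : ∀ k l : Fin 3, pderiv k (pderiv l f) x
      = fderiv ℝ (fderiv ℝ f) x (EuclideanSpace.single k 1) (EuclideanSpace.single l 1) := by
    intro k l
    change fderiv ℝ (fun y => fderiv ℝ f y (EuclideanSpace.single l 1)) x _ = _
    rw [fderiv_clm_apply hd (differentiableAt_const _)]
    simp
  rw [h, h]
  have h2 : ContDiff ℝ 2 f := contDiff_infty.1 hf 2
  exact (h2.contDiffAt.isSymmSndFDerivAt (by simp)) _ _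

lemma integral_mul_pderiv {f φ : Space → ℝ} (hf : ContDiff ℝ ∞ f) (hφ : ContDiff ℝ ∞ φ)
    (hc : HasCompactSupport φ) (i : Fin 3) :
    ∫ x, f x * pderiv i φ x = -∫ x, pderiv i f x * φ x := by
  have h1 := (contDiff_pderiv hf i).continuous
  have h2 := (contDiff_pderiv hφ i).continuous
  refine integral_mul_fderiv_eq_neg_fderiv_mul_of_integrable ?_ ?_ ?_
    (fun x _ => hf.differentiable (by simp) x) (fun x _ => hφ.differentiable (by simp) x)
  · exact (h1.mul hφ.continuous).integrable_of_hasCompactSupport hc.mul_left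
  · exact (hf.continuous.mul h2).integrable_of_hasCompactSupport
      (hasCompactSupport_pderiv hc i).mul_left
  · exact (hf.continuous.mul hφ.continuous).integrable_of_hasCompactSupport hc.mul_left

lemma gradient_apply (φ : Space → ℝ) (x : Space) (i : Fin 3) : (∇ φ x) i = pderiv i φ x := by
  rw [pderiv, ← inner_gradient_left, EuclideanSpace.inner_single_right]
  simp

lemma pderiv_const_mul_comp_smul {f : Space → ℝ} (hf : ContDiff ℝ ∞ f) (c s : ℝ) (i : Fin 3)
    (x : Space) : pderiv i (fun y => c * f (s • y)) x = c * s * pderiv i f (s • x) := by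
  have h1 : HasFDerivAt f (fderiv ℝ f (s • x)) (s • x) :=
    (hf.differentiable (by simp) _).hasFDerivAt
  have h2 : HasFDerivAt (fun y : Space => s • y) (s • ContinuousLinearMap.id ℝ Space) x :=
    (hasFDerivAt_id x).const_smul s
  have h3 := (h1.comp x h2).const_mul c
  rw [pderiv, pderiv]
  have h4 : fderiv ℝ (fun y => c * f (s • y)) x
      = c • (fderiv ℝ f (s • x)).comp (s • ContinuousLinearMap.id ℝ Space) := h3.fderiv
  rw [h4]
  simp [mul_assoc]

/-- The divergence free vector field `(-∂₂ f, 0, ∂₀ f)`. -/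
def curlPotential (f : Space → ℝ) (x : Space) : Space :=
  WithLp.toLp 2 ![-pderiv 2 f x, 0, pderiv 0 f x]

/-- The curl of `curlPotential f`. -/
def curlField (f : Space → ℝ) (x : Space) : Space :=
  WithLp.toLp 2 ![pderiv 1 (pderiv 0 f) x,
    -pderiv 2 (pderiv 2 f) x - pderiv 0 (pderiv 0 f) x, pderiv 1 (pderiv 2 f) x]

section Potential

variable {f : Space → ℝ} (hf : ContDiff ℝ ∞ f) (hc : HasCompactSupport f)

include hf in
lemma continuous_curlPotential : Continuous (curlPotential f) := by
  have h1 := (contDiff_pderiv hf 2).continuous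
  have h2 := (contDiff_pderiv hf 0).continuous
  unfold curlPotential
  refine (PiLp.continuous_toLp 2 _).comp (continuous_pi fun i => ?_)
  fin_cases i
  · exact h1.neg
  · exact continuous_const
  · exact h2

include hf in
lemma continuous_curlField : Continuous (curlField f) := by
  have h (i j : Fin 3) := (contDiff_pderiv (contDiff_pderiv hf i) j).continuous
  unfold curlField
  refine (PiLp.continuous_toLp 2 _).comp (continuous_pi fun i => ?_)
  fin_cases i
  · exact h 0 1
  · exact (h 2 2).neg.sub (h 0 0)
  · exact h 2 1

include hc in
lemma hasCompactSupport_curlPotential : HasCompactSupport (curlPotential f) := by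
  refine HasCompactSupport.of_support_subset_isCompact
    ((hasCompactSupport_pderiv hc 2).isCompact.union (hasCompactSupport_pderiv hc 0).isCompact) ?_
  intro x hx
  by_contra hn
  rw [Set.mem_union, not_or] at hn
  apply hx
  ext i
  have h1 := image_eq_zero_of_notMem_tsupport hn.1
  have h2 := image_eq_zero_of_notMem_tsupport hn.2
  fin_cases i <;> simp [curlPotential, h1, h2]

include hc in
lemma hasCompactSupport_curlField : HasCompactSupport (curlField f) := by
  have h (i j : Fin 3) := hasCompactSupport_pderiv (hasCompactSupport_pderiv hc i) j
  refine HasCompactSupport.of_support_subset_isCompact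
    (((h 0 1).isCompact.union (h 2 1).isCompact).union
      ((h 2 2).isCompact.union (h 0 0).isCompact)) ?_
  intro x hx
  by_contra hn
  simp only [Set.mem_union, not_or] at hn
  apply hx
  ext i
  have h1 := image_eq_zero_of_notMem_tsupport hn.1.1
  have h2 := image_eq_zero_of_notMem_tsupport hn.1.2
  have h3 := image_eq_zero_of_notMem_tsupport hn.2.1
  have h4 := image_eq_zero_of_notMem_tsupport hn.2.2
  fin_cases i <;> simp [curlField, h1, h2, h3, h4]

include hf in
-- After integration by parts the two terms are mixed second derivatives of `f` with opposite signs.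
lemma isWeaklyDivFree_curlPotential : IsWeaklyDivFree (curlPotential f) := by
  intro φ hφ hφc
  have hp (i : Fin 3) := contDiff_pderiv hf i
  have hint (i j : Fin 3) : Integrable fun x => pderiv i f x * pderiv j φ x :=
    ((hp i).continuous.mul (contDiff_pderiv hφ j).continuous).integrable_of_hasCompactSupport
      (hasCompactSupport_pderiv hφc j).mul_left
  have h1 : ∀ x, inner ℝ (curlPotential f x) (∇ φ x)
      = pderiv 0 f x * pderiv 2 φ x - pderiv 2 f x * pderiv 0 φ x := by
    intro x
    simp only [PiLp.inner_apply, gradient_apply, Fin.sum_univ_three, curlPotential]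
    simp
    ring
  simp_rw [h1]
  rw [integral_sub (hint 0 2) (hint 2 0), integral_mul_pderiv (hp 0) hφ hφc,
    integral_mul_pderiv (hp 2) hφ hφc]
  simp_rw [pderiv_comm hf 2 0]
  ring

include hf in
lemma isWeakCurl_curlPotential : IsWeakCurl (curlPotential f) (curlField f) := by
  intro φ hφ hφc i
  have hp (i : Fin 3) := contDiff_pderiv hf i
  have hint (i j : Fin 3) : Integrable fun x => pderiv i f x * pderiv j φ x :=
    ((hp i).continuous.mul (contDiff_pderiv hφ j).continuous).integrable_of_hasCompactSupport
      (hasCompactSupport_pderiv hφc j).mul_left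
  have hint' (i j : Fin 3) : Integrable fun x => pderiv j (pderiv i f) x * φ x :=
    ((contDiff_pderiv (hp i) j).continuous.mul hφ.continuous).integrable_of_hasCompactSupport
      hφc.mul_left
  fin_cases i
  · have h1 : ∀ x, (WithLp.ofLp (curlPotential f x) ⨯₃ WithLp.ofLp (∇ φ x)) 0
        = -(pderiv 0 f x * pderiv 1 φ x) := by
      intro x
      simp [crossProduct, curlPotential, gradient_apply]
    have h2 : ∀ x, φ x * curlField f x 0 = pderiv 1 (pderiv 0 f) x * φ x := by
      intro x
      simp [curlField, mul_comm]
    simp only [Fin.zero_eta]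
    simp_rw [h1, h2]
    rw [integral_neg, integral_mul_pderiv (hp 0) hφ hφc, neg_neg]
  · have h1 : ∀ x, (WithLp.ofLp (curlPotential f x) ⨯₃ WithLp.ofLp (∇ φ x)) 1
        = pderiv 0 f x * pderiv 0 φ x + pderiv 2 f x * pderiv 2 φ x := by
      intro x
      simp [crossProduct, curlPotential, gradient_apply]
    have h2 : ∀ x, φ x * curlField f x 1
        = -(pderiv 0 (pderiv 0 f) x * φ x + pderiv 2 (pderiv 2 f) x * φ x) := by
      intro x
      simp [curlField]
      ring
    simp only [Fin.mk_one]
    simp_rw [h1, h2]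
    rw [integral_neg, integral_add (hint 0 0) (hint 2 2), integral_add (hint' 0 0) (hint' 2 2),
      integral_mul_pderiv (hp 0) hφ hφc, integral_mul_pderiv (hp 2) hφ hφc]
    ring
  · have h1 : ∀ x, (WithLp.ofLp (curlPotential f x) ⨯₃ WithLp.ofLp (∇ φ x)) 2
        = -(pderiv 2 f x * pderiv 1 φ x) := by
      intro x
      simp [crossProduct, curlPotential, gradient_apply]
    have h2 : ∀ x, φ x * curlField f x 2 = pderiv 1 (pderiv 2 f) x * φ x := by
      intro x
      simp [curlField, mul_comm]
    simp only [Fin.reduceFinMk]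
    simp_rw [h1, h2]
    rw [integral_neg, integral_mul_pderiv (hp 2) hφ hφc, neg_neg]

include hf hc in
lemma isCoulombPotential_curlPotential : IsCoulombPotential (curlPotential f) (curlField f) where
  memLp := (continuous_curlPotential hf).memLp_of_hasCompactSupport
    (hasCompactSupport_curlPotential hc)
  div_free := isWeaklyDivFree_curlPotential hf
  memLp_field := (continuous_curlField hf).memLp_of_hasCompactSupport
    (hasCompactSupport_curlField hc)
  curl_eq := isWeakCurl_curlPotential hf

end Potential

lemma curlPotential_scale {f : Space → ℝ} (hf : ContDiff ℝ ∞ f) (c s : ℝ) (x : Space) :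
    curlPotential (fun y => c * f (s • y)) x = (c * s) • curlPotential f (s • x) := by
  ext i
  fin_cases i <;> simp [curlPotential, pderiv_const_mul_comp_smul hf]

lemma curlField_scale {f : Space → ℝ} (hf : ContDiff ℝ ∞ f) (c s : ℝ) (x : Space) :
    curlField (fun y => c * f (s • y)) x = (c * s ^ 2) • curlField f (s • x) := by
  have h (i j : Fin 3) : pderiv j (pderiv i fun y => c * f (s • y)) x
      = c * s ^ 2 * pderiv j (pderiv i f) (s • x) := by
    have : pderiv i (fun y => c * f (s • y)) = fun y => (c * s) * pderiv i f (s • y) :=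
      funext fun y => pderiv_const_mul_comp_smul hf c s i y
    rw [this, pderiv_const_mul_comp_smul (contDiff_pderiv hf i)]
    ring
  ext i
  fin_cases i <;> simp [curlField, h]
  ring

/-- There are a smooth compactly supported Coulomb gauge potential that is `e₂` at the origin, and
all its rescalings. -/
lemma exists_scaled_potential : ∃ A B : Space → Space, Continuous A ∧ HasCompactSupport A ∧
    A 0 2 = 1 ∧ Continuous B ∧ HasCompactSupport B ∧
    ∀ c s : ℝ, 0 < s →
      IsCoulombPotential (fun x => (c * s) • A (s • x)) (fun x => (c * s ^ 2) • B (s • x)) := by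
  let η : ContDiffBump (0 : Space) := ⟨1, 2, one_pos, one_lt_two⟩
  have hη1 : ContDiff ℝ ∞ η := η.contDiff
  have hcoord : ContDiff ℝ ∞ fun x : Space => x 0 := contDiff_euclidean.1 contDiff_id 0
  -- Near the origin the cutoff equals 1 and `f` is the coordinate `x 0`, whence the third component
  -- `∂₀ f` of the potential is 1 there.
  set f : Space → ℝ := fun x => x 0 * η x with hfdef
  have hf : ContDiff ℝ ∞ f := hcoord.mul hη1
  have hc : HasCompactSupport f := η.hasCompactSupport.mul_left
  refine ⟨curlPotential f, curlField f, continuous_curlPotential hf,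
    hasCompactSupport_curlPotential hc, ?_, continuous_curlField hf,
    hasCompactSupport_curlField hc, ?_⟩
  · have hd : HasFDerivAt (fun x : Space => x 0) (EuclideanSpace.proj (𝕜 := ℝ) (0 : Fin 3)) 0 :=
      (EuclideanSpace.proj (𝕜 := ℝ) (0 : Fin 3) : Space →L[ℝ] ℝ).hasFDerivAt
    have h1 := hd.mul (hη1.differentiable (by simp) 0).hasFDerivAt
    have h2 : fderiv ℝ f 0 = _ := h1.fderiv
    have h3 : η (0 : Space) = 1 := η.one_of_mem_closedBall (by simp [η])
    simp [curlPotential, pderiv, h2, h3]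
  · intro c s hs
    have hf' : ContDiff ℝ ∞ fun y => c * f (s • y) := by fun_prop
    have hc' : HasCompactSupport fun y => c * f (s • y) :=
      (hc.comp_smul hs.ne').mul_left
    have := isCoulombPotential_curlPotential hf' hc'
    rwa [funext fun x => curlPotential_scale hf c s x,
      funext fun x => curlField_scale hf c s x] at this

/-! ### Positive energy spinors -/

lemma diracEnergy_sq (m : ℝ) (ξ : Space) :
    diracEnergy m ξ ^ 2 = ‖(2 * π) • ξ‖ ^ 2 + m ^ 2 :=
  Real.sq_sqrt (by positivity)

lemma diracEnergy_pos (m : ℝ) {ξ : Space} (hξ : ξ ≠ 0) : 0 < diracEnergy m ξ := by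
  have h : 0 < ‖(2 * π) • ξ‖ := norm_pos_iff.2 (smul_ne_zero (by positivity) hξ)
  exact Real.sqrt_pos.2 (by positivity)

lemma diracEnergy_le {m : ℝ} (hm : 0 ≤ m) (ξ : Space) :
    diracEnergy m ξ ≤ 2 * π * ‖ξ‖ + m := by
  have h : ‖(2 * π) • ξ‖ = 2 * π * ‖ξ‖ := by
    rw [norm_smul, Real.norm_of_nonneg (by positivity)]
  rw [diracEnergy, h]
  refine Real.sqrt_le_iff.2 ⟨by positivity, ?_⟩
  have : 0 ≤ 2 * π * ‖ξ‖ * m := by positivity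
  nlinarith

lemma mass_le_diracEnergy {m : ℝ} (ξ : Space) : m ≤ diracEnergy m ξ :=
  Real.le_sqrt_of_sq_le (by nlinarith [sq_nonneg ‖(2 * π) • ξ‖])

/-- The unnormalized positive energy spinor at momentum `p` and energy `E`, with spin up. -/
def rawSpinor (m E : ℝ) (p : Space) : Spinor :=
  WithLp.toLp 2 (Sum.elim ![((E + m : ℝ) : ℂ), 0] ![(p 2 : ℂ), (p 0 : ℂ) + Complex.I * (p 1 : ℂ)])

lemma norm_sq_space (p : Space) : ‖p‖ ^ 2 = p 0 ^ 2 + p 1 ^ 2 + p 2 ^ 2 := by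
  rw [EuclideanSpace.norm_sq_eq, Fin.sum_univ_three]
  simp

lemma alphaDot_mulVec (p : Space) (w : Spin → ℂ) :
    alphaDot p *ᵥ w = Sum.elim
      ![(p 2 : ℂ) * w (Sum.inr 0) + ((p 0 : ℂ) - Complex.I * (p 1 : ℂ)) * w (Sum.inr 1),
        ((p 0 : ℂ) + Complex.I * (p 1 : ℂ)) * w (Sum.inr 0) - (p 2 : ℂ) * w (Sum.inr 1)]
      ![(p 2 : ℂ) * w (Sum.inl 0) + ((p 0 : ℂ) - Complex.I * (p 1 : ℂ)) * w (Sum.inl 1),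
        ((p 0 : ℂ) + Complex.I * (p 1 : ℂ)) * w (Sum.inl 0) - (p 2 : ℂ) * w (Sum.inl 1)] := by
  ext s
  rcases s with s | s <;> fin_cases s <;>
    simp [Matrix.mulVec, dotProduct, alphaDot, diracAlpha, pauli, Fin.sum_univ_three,
      Matrix.fromBlocks, -mul_eq_mul_right_iff] <;> ring

/-- With `H = 𝛂 · p + m β`, the raw spinor is the first column of `H + E`, and `(H - E) (H + E) = H
^ 2 - E ^ 2 = 0`. -/
lemma diracSymbol_mulVec_rawSpinor {m E : ℝ} {p : Space} (hE : E ^ 2 = ‖p‖ ^ 2 + m ^ 2) :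
    diracSymbol m p *ᵥ WithLp.ofLp (rawSpinor m E p) = (E : ℂ) • WithLp.ofLp (rawSpinor m E p) := by
  have hE' : (E : ℂ) ^ 2 = (p 0 : ℂ) ^ 2 + (p 1 : ℂ) ^ 2 + (p 2 : ℂ) ^ 2 + (m : ℂ) ^ 2 := by
    rw [norm_sq_space] at hE
    exact_mod_cast hE
  have hβ : ∀ w : Spin → ℂ, diracBeta *ᵥ w = Sum.elim (fun i => w (Sum.inl i))
      (fun i => -w (Sum.inr i)) := by
    intro w
    ext s
    rcases s with s | s <;> fin_cases s <;>
      simp [Matrix.mulVec, dotProduct, diracBeta, Matrix.fromBlocks]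
  rw [diracSymbol, Matrix.add_mulVec, Matrix.smul_mulVec, alphaDot_mulVec, hβ]
  ext s
  rcases s with s | s <;> fin_cases s
  · simp [rawSpinor]
    linear_combination (-1 : ℂ) * hE' - (p 1 : ℂ) ^ 2 * Complex.I_sq
  · simp [rawSpinor]
    ring
  · simp [rawSpinor]
    ring
  · simp [rawSpinor]
    ring

lemma norm_sq_spinor (w : Spinor) : ‖w‖ ^ 2
    = ‖w (Sum.inl 0)‖ ^ 2 + ‖w (Sum.inl 1)‖ ^ 2 + (‖w (Sum.inr 0)‖ ^ 2 + ‖w (Sum.inr 1)‖ ^ 2) := by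
  rw [EuclideanSpace.norm_sq_eq, Fintype.sum_sum_type, Fin.sum_univ_two, Fin.sum_univ_two]

lemma norm_sq_rawSpinor {m E : ℝ} {p : Space} (hE : E ^ 2 = ‖p‖ ^ 2 + m ^ 2) :
    ‖rawSpinor m E p‖ ^ 2 = 2 * E * (E + m) := by
  rw [norm_sq_space] at hE
  have h : ‖(p 0 : ℂ) + Complex.I * (p 1 : ℂ)‖ ^ 2 = p 0 ^ 2 + p 1 ^ 2 := by
    rw [← Complex.normSq_eq_norm_sq, mul_comm, Complex.normSq_add_mul_I]
  rw [norm_sq_spinor]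
  simp only [rawSpinor, Sum.elim_inl, Sum.elim_inr, Matrix.cons_val_zero, Matrix.cons_val_one, h,
    Complex.norm_real, Real.norm_eq_abs, sq_abs, norm_zero]
  linear_combination -hE

/-- The normalized positive energy spinor with spin up. -/
def spinorField (m : ℝ) (ξ : Space) : Spinor :=
  (√(2 * diracEnergy m ξ * (diracEnergy m ξ + m)))⁻¹ •
    rawSpinor m (diracEnergy m ξ) ((2 * π) • ξ)

lemma diracSymbol_mulVec_spinorField (m : ℝ) (ξ : Space) :
    diracSymbol m ((2 * π) • ξ) *ᵥ WithLp.ofLp (spinorField m ξ)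
      = (diracEnergy m ξ : ℂ) • WithLp.ofLp (spinorField m ξ) := by
  rw [spinorField, WithLp.ofLp_smul, Matrix.mulVec_smul,
    diracSymbol_mulVec_rawSpinor (diracEnergy_sq m ξ), smul_comm]

lemma norm_spinorField {m : ℝ} (hm : 0 ≤ m) {ξ : Space} (hξ : ξ ≠ 0) : ‖spinorField m ξ‖ = 1 := by
  have hE := diracEnergy_pos m hξ
  have hN : 0 < 2 * diracEnergy m ξ * (diracEnergy m ξ + m) := by positivity
  have h1 : ‖rawSpinor m (diracEnergy m ξ) ((2 * π) • ξ)‖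
      = √(2 * diracEnergy m ξ * (diracEnergy m ξ + m)) := by
    rw [← norm_sq_rawSpinor (diracEnergy_sq m ξ), Real.sqrt_sq (norm_nonneg _)]
  rw [spinorField, norm_smul, h1, norm_inv, Real.norm_of_nonneg (Real.sqrt_nonneg _),
    inv_mul_cancel₀ (Real.sqrt_pos.2 hN).ne']

lemma contDiffAt_spinorField {m : ℝ} (hm : 0 ≤ m) {ξ : Space} (hξ : ξ ≠ 0) :
    ContDiffAt ℝ ∞ (spinorField m) ξ := by
  have hE := diracEnergy_pos m hξ
  have hpos : 0 < ‖(2 * π) • ξ‖ ^ 2 + m ^ 2 := Real.sqrt_pos.1 hE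
  have hsm : ContDiffAt ℝ ∞ (fun ζ : Space => ‖(2 * π) • ζ‖ ^ 2 + m ^ 2) ξ := by
    have : ContDiff ℝ ∞ fun ζ : Space => (2 * π) • ζ := by fun_prop
    exact ((this.norm_sq ℝ).add contDiff_const).contDiffAt
  have h1 : ContDiffAt ℝ ∞ (diracEnergy m) ξ := hsm.sqrt hpos.ne'
  have h2 : ContDiffAt ℝ ∞
      (fun ζ => (√(2 * diracEnergy m ζ * (diracEnergy m ζ + m)))⁻¹) ξ := by
    have hN : 0 < 2 * diracEnergy m ξ * (diracEnergy m ξ + m) := by positivity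
    refine ContDiffAt.inv (ContDiffAt.sqrt ?_ hN.ne') (Real.sqrt_pos.2 hN).ne'
    exact (contDiffAt_const.mul h1).mul (h1.add contDiffAt_const)
  have hof : ∀ {h : Space → ℝ}, ContDiffAt ℝ ∞ h ξ → ContDiffAt ℝ ∞ (fun ζ => (h ζ : ℂ)) ξ :=
    fun hh => Complex.ofRealCLM.contDiff.contDiffAt.comp ξ hh
  have hc : ∀ j : Fin 3, ContDiffAt ℝ ∞ (fun ζ : Space => (((2 * π) • ζ) j : ℂ)) ξ := fun j => by
    refine hof ?_
    have : ContDiff ℝ ∞ fun ζ : Space => (2 * π) • ζ := by fun_prop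
    exact (contDiff_euclidean.1 this j).contDiffAt
  have h3 : ContDiffAt ℝ ∞ (fun ζ => rawSpinor m (diracEnergy m ζ) ((2 * π) • ζ)) ξ := by
    refine (contDiffAt_piLp 2).2 fun s => ?_
    rcases s with s | s <;> fin_cases s
    · exact hof (h1.add contDiffAt_const)
    · exact contDiffAt_const
    · exact hc 2
    · exact (hc 0).add (contDiffAt_const.mul (hc 1))
  exact h2.smul h3

/-- The limiting spinor for momenta in direction `e₂`. -/
def limitSpinor : Spinor :=
  WithLp.toLp 2 (Sum.elim ![(((√2)⁻¹ : ℝ) : ℂ), 0] ![(((√2)⁻¹ : ℝ) : ℂ), 0])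

lemma norm_limitSpinor : ‖limitSpinor‖ = 1 := by
  have h : ‖limitSpinor‖ ^ 2 = 1 := by
    rw [norm_sq_spinor]
    simp only [limitSpinor, Sum.elim_inl, Sum.elim_inr, Matrix.cons_val_zero, Matrix.cons_val_one,
      Complex.norm_real, Real.norm_eq_abs, sq_abs, norm_zero, inv_pow]
    norm_num
  exact (pow_eq_one_iff_of_nonneg (norm_nonneg _) two_ne_zero).1 h

/-- The spinor is an eigenvector of `α₃` with eigenvalue 1, and the expectations of the transverse
matrices vanish. The current therefore couples to the third component of the potential only. -/
lemma inner_limitSpinor_alphaDot (v : Space) :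
    inner ℂ limitSpinor (actSpinor (alphaDot v) limitSpinor) = (v 2 : ℂ) := by
  have h : ((√2 : ℝ) : ℂ) ^ 2 = 2 := by exact_mod_cast Real.sq_sqrt (by norm_num : (0 : ℝ) ≤ 2)
  have h0 : ((√2 : ℝ) : ℂ) ≠ 0 := by
    exact_mod_cast (Real.sqrt_pos.2 (by norm_num : (0 : ℝ) < 2)).ne'
  simp only [PiLp.inner_apply, actSpinor, alphaDot_mulVec, Fintype.sum_sum_type, Fin.sum_univ_two]
  simp [limitSpinor]
  field_simp
  rw [h]
  ring

/-- The Dirac spinor is close to the limiting spinor if the momentum is almost parallel to `e₂`. -/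
lemma norm_spinorField_sub_sq_le {m : ℝ} (hm : 0 ≤ m) {ξ : Space} {ε : ℝ} (hξ : 0 < ξ 2)
    (h : 2 * π * (|ξ 0| + |ξ 1|) + 2 * m ≤ ε * (2 * π * ξ 2)) :
    ‖spinorField m ξ - limitSpinor‖ ^ 2 ≤ ε := by
  have hξ0 : ξ ≠ 0 := by rintro rfl; simp at hξ
  set E := diracEnergy m ξ with hEdef
  have hE : 0 < E := diracEnergy_pos m hξ0
  have hmE : m ≤ E := mass_le_diracEnergy ξ
  set S := √(2 * E * (E + m)) with hS
  have hN : 0 < 2 * E * (E + m) := by positivity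
  have hS0 : 0 < S := Real.sqrt_pos.2 hN
  have hS2 : S ^ 2 = 2 * E * (E + m) := Real.sq_sqrt hN.le
  have hs2 : √2 ^ 2 = (2 : ℝ) := Real.sq_sqrt (by norm_num)
  have hs0 : 0 < √(2 : ℝ) := Real.sqrt_pos.2 (by norm_num)
  have hinner : (inner ℂ (spinorField m ξ) limitSpinor).re
      = S⁻¹ * (√2)⁻¹ * (E + m + 2 * π * ξ 2) := by
    simp only [PiLp.inner_apply, Fintype.sum_sum_type, Fin.sum_univ_two]
    simp [spinorField, limitSpinor, rawSpinor]
    rw [← hEdef, ← hS]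
    have hs3 : (√2)⁻¹ = √2 / 2 := by
      rw [inv_eq_one_div, div_eq_div_iff hs0.ne' two_ne_zero, one_mul, ← sq, hs2]
    simp only [hs3]
    ring
  have hE2 : E ≤ 2 * π * (|ξ 0| + |ξ 1| + ξ 2) + m := by
    refine (diracEnergy_le hm ξ).trans ?_
    have : ‖ξ‖ ≤ |ξ 0| + |ξ 1| + ξ 2 := by
      rw [← abs_of_pos hξ]
      refine abs_le_of_sq_le_sq' ?_ (by positivity) |>.2
      rw [norm_sq_space, ← sq_abs (ξ 0), ← sq_abs (ξ 1), ← sq_abs (ξ 2)]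
      nlinarith [abs_nonneg (ξ 0), abs_nonneg (ξ 1), abs_nonneg (ξ 2),
        mul_nonneg (abs_nonneg (ξ 0)) (abs_nonneg (ξ 1)),
        mul_nonneg (abs_nonneg (ξ 0)) (abs_nonneg (ξ 2)),
        mul_nonneg (abs_nonneg (ξ 1)) (abs_nonneg (ξ 2))]
    have hpi := Real.pi_pos
    gcongr
  have hSle : S ≤ √2 * (E + m) := by
    refine Real.sqrt_le_iff.2 ⟨by positivity, ?_⟩
    rw [mul_pow, hs2]
    nlinarith
  have hSle' : S * √2 ≤ 2 * (E + m) := by nlinarith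
  rw [norm_sub_sq (𝕜 := ℂ), norm_spinorField hm hξ0, norm_limitSpinor]
  simp only [RCLike.re_eq_complex_re]
  rw [hinner]
  -- With `p = 2 π ξ` and `p₃ = 2 π ξ 2` this says `p₃ ≥ (1 - ε) (E + m)`. The hypothesis together
  -- with the bound on `E` gives `E + m ≤ (1 + ε) p₃`, and `p₃ ≤ E + m`.
  have hkey : E + m + 2 * π * ξ 2 ≥ (1 - ε / 2) * (2 * (E + m)) := by
    have hpi := Real.pi_pos
    have hp : 0 < 2 * π * ξ 2 := by positivity
    have hEp : 2 * π * ξ 2 ≤ E + m := by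
      have : 2 * π * ξ 2 ≤ E := by
        refine Real.le_sqrt_of_sq_le ?_
        rw [norm_smul, Real.norm_of_nonneg (by positivity), mul_pow _ ‖ξ‖, norm_sq_space]
        nlinarith [sq_nonneg (ξ 0), sq_nonneg (ξ 1), sq_nonneg m, sq_nonneg (2 * π * ξ 0),
          sq_nonneg (2 * π * ξ 1)]
      linarith
    have hε : 0 ≤ ε := by
      by_contra hneg
      push Not at hneg
      have h1 : 0 ≤ 2 * π * (|ξ 0| + |ξ 1|) + 2 * m := by positivity
      nlinarith
    nlinarith
  by_cases hε1 : 1 - ε / 2 ≤ 0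
  · have h1 : 0 ≤ S⁻¹ * (√2)⁻¹ * (E + m + 2 * π * ξ 2) := by
      have hpi := Real.pi_pos
      positivity
    nlinarith
  · push Not at hε1
    have h1 : (1 - ε / 2) ≤ S⁻¹ * (√2)⁻¹ * (E + m + 2 * π * ξ 2) := by
      rw [← mul_inv, inv_mul_eq_div, le_div_iff₀ (by positivity)]
      calc (1 - ε / 2) * (S * √2) ≤ (1 - ε / 2) * (2 * (E + m)) := by gcongr
        _ ≤ _ := hkey
    nlinarith

/-- Since `(𝛂 · v) ^ 2 = ‖v‖ ^ 2`, the Hermitian matrix `𝛂 · v` is `‖v‖` times an isometry; the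
bound is in fact an equality. -/
lemma norm_actSpinor_alphaDot_le (v : Space) (w : Spinor) :
    ‖actSpinor (alphaDot v) w‖ ≤ ‖v‖ * ‖w‖ := by
  refine abs_le_of_sq_le_sq' ?_ (by positivity) |>.2
  have hsq : ∀ z : ℂ, ‖z‖ ^ 2 = z.re ^ 2 + z.im ^ 2 := fun z => by
    rw [← Complex.normSq_eq_norm_sq, Complex.normSq_apply]; ring
  rw [mul_pow, norm_sq_space, norm_sq_spinor, norm_sq_spinor]
  simp only [actSpinor, alphaDot_mulVec, Sum.elim_inl, Sum.elim_inr, Matrix.cons_val_zero,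
    Matrix.cons_val_one, hsq]
  apply le_of_eq
  simp
  ring

/-! ### Orbitals localized in momentum space -/

/-- A normalized smooth momentum profile. -/
structure IsProfile (g : Space → ℝ) : Prop where
  contDiff : ContDiff ℝ ∞ g
  support : ∀ x, 1 / 2 ≤ ‖x‖ → g x = 0
  integral_sq : ∫ x, g x ^ 2 = 1

lemma exists_isProfile : ∃ g : Space → ℝ, IsProfile g := by
  let η : ContDiffBump (0 : Space) := ⟨1 / 4, 1 / 2, by norm_num, by norm_num⟩
  have hη : ContDiff ℝ ∞ η := η.contDiff
  have hsupp : ∀ x : Space, 1 / 2 ≤ ‖x‖ → η x = 0 := fun x hx =>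
    η.zero_of_le_dist (by simpa [η] using hx)
  have hpos : 0 < ∫ x, η x ^ 2 := by
    have hc : Continuous fun x => η x ^ 2 := hη.continuous.pow 2
    refine hc.integral_pos_of_hasCompactSupport_nonneg_nonzero (x := 0) ?_
      (fun x => sq_nonneg _) ?_
    · exact η.hasCompactSupport.comp_left (g := fun t : ℝ => t ^ 2) (by norm_num)
    · have : η (0 : Space) = 1 := η.one_of_mem_closedBall (by simp [η])
      simp [this]
  refine ⟨fun x => (√(∫ x, η x ^ 2))⁻¹ * η x, contDiff_const.mul hη, fun x hx => ?_, ?_⟩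
  · rw [hsupp x hx, mul_zero]
  · simp_rw [mul_pow, inv_pow, Real.sq_sqrt hpos.le]
    rw [integral_const_mul, inv_mul_cancel₀ hpos.ne']

/-- The profile `g`, scaled by `l` and centred at the momentum `l k`. -/
def amplitude (g : Space → ℝ) (l : ℝ) (k ξ : Space) : ℝ := (√(l ^ 3))⁻¹ * g (l⁻¹ • ξ - k)

section Amplitude

variable {g : Space → ℝ} (hg : IsProfile g) {l : ℝ} (hl : 0 < l) {k : Space}

include hg hl in
lemma norm_sub_lt_of_amplitude_ne_zero {ξ : Space} (h : amplitude g l k ξ ≠ 0) :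
    ‖ξ - l • k‖ < l / 2 := by
  have h1 : ‖l⁻¹ • ξ - k‖ < 1 / 2 := by
    by_contra hn
    exact h (by rw [amplitude, hg.support _ (not_lt.1 hn), mul_zero])
  have h2 : ξ - l • k = l • (l⁻¹ • ξ - k) := by rw [smul_sub, smul_inv_smul₀ hl.ne']
  rw [h2, norm_smul, Real.norm_of_nonneg hl.le]
  nlinarith

include hg in
lemma contDiff_amplitude : ContDiff ℝ ∞ (amplitude g l k) := by
  have := hg.contDiff
  unfold amplitude
  fun_prop

include hg hl in
lemma hasCompactSupport_amplitude : HasCompactSupport (amplitude g l k) := by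
  refine HasCompactSupport.of_support_subset_isCompact
    (isCompact_closedBall (l • k) (l / 2)) fun ξ hξ => ?_
  rw [mem_closedBall_iff_norm]
  exact (norm_sub_lt_of_amplitude_ne_zero hg hl hξ).le

include hl in
lemma integral_scale (F : Space → ℝ) : ∫ x, l ^ 3 * F (l • x) = ∫ x, F x := by
  rw [integral_const_mul, Measure.integral_comp_smul_of_nonneg _ _ _ (hR := hl.le)]
  simp only [finrank_euclideanSpace, Fintype.card_fin, smul_eq_mul]
  rw [← mul_assoc, mul_inv_cancel₀ (by positivity), one_mul]

include hg hl in
lemma integral_amplitude_sq : ∫ ξ, amplitude g l k ξ ^ 2 = 1 := by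
  rw [← hg.integral_sq, ← integral_sub_right_eq_self (fun x => g x ^ 2) k,
    ← integral_scale (inv_pos.2 hl) fun x => g (x - k) ^ 2]
  refine integral_congr_ae (Filter.Eventually.of_forall fun ξ => ?_)
  simp only [amplitude]
  rw [mul_pow, inv_pow, Real.sq_sqrt (by positivity), inv_pow]

include hg hl in
lemma amplitude_eq_zero_at_zero (hk : 1 ≤ ‖k‖) : amplitude g l k 0 = 0 := by
  by_contra h
  have h1 := norm_sub_lt_of_amplitude_ne_zero hg hl h
  rw [zero_sub, norm_neg, norm_smul, Real.norm_of_nonneg hl.le] at h1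
  nlinarith

include hg hl in
-- For `m = 0` the spinor field is singular at zero momentum. The support of the amplitude avoids a
-- neighbourhood of zero, because its centre has norm at least `l` and its radius is at most `l /
-- 2`.
lemma contDiff_diracOrbital {m : ℝ} (hm : 0 ≤ m) (hk : 1 ≤ ‖k‖) :
    ContDiff ℝ ∞ fun ξ => amplitude g l k ξ • spinorField m ξ := by
  rw [contDiff_iff_contDiffAt]
  intro ξ
  by_cases hξ : ξ = 0
  · have h0 : (0 : Space) ∉ tsupport (amplitude g l k) := by
      intro h
      have hsub : tsupport (amplitude g l k) ⊆ Metric.closedBall (l • k) (l / 2) :=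
        closure_minimal (fun ζ hζ => by
          rw [mem_closedBall_iff_norm]
          exact (norm_sub_lt_of_amplitude_ne_zero hg hl hζ).le) Metric.isClosed_closedBall
      have h1 := hsub h
      rw [mem_closedBall_iff_norm, zero_sub, norm_neg, norm_smul,
        Real.norm_of_nonneg hl.le] at h1
      nlinarith
    have h1 : (fun ζ => amplitude g l k ζ • spinorField m ζ) =ᶠ[nhds ξ] fun _ => 0 := by
      rw [hξ]
      filter_upwards [notMem_tsupport_iff_eventuallyEq.1 h0] with ζ hζ
      rw [hζ]
      simp
    exact contDiffAt_const.congr_of_eventuallyEq h1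
  · exact (contDiff_amplitude hg).contDiffAt.smul (contDiffAt_spinorField hm hξ)

/-- The positive energy orbital with momentum profile `g`, scale `l` and centre `l k`. -/
def diracOrbital {m : ℝ} (hm : 0 ≤ m) (hk : 1 ≤ ‖k‖) : 𝓢(Space, Spinor) :=
  (hasCompactSupport_amplitude (k := k) hg hl).smul_right.toSchwartzMap
    (contDiff_diracOrbital hg hl hm hk)

/-- The orbital with momentum profile `g`, scale `l`, centre `l k` and constant spinor. -/
def plainOrbital (k : Space) : 𝓢(Space, Spinor) :=
  (hasCompactSupport_amplitude (k := k) hg hl).smul_right.toSchwartzMap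
    (f := fun ξ => amplitude g l k ξ • limitSpinor)
    ((contDiff_amplitude hg).smul contDiff_const)

lemma diracOrbital_apply {m : ℝ} (hm : 0 ≤ m) (hk : 1 ≤ ‖k‖) (ξ : Space) :
    diracOrbital hg hl hm hk ξ = amplitude g l k ξ • spinorField m ξ := rfl

lemma plainOrbital_apply (k ξ : Space) :
    plainOrbital hg hl k ξ = amplitude g l k ξ • limitSpinor := rfl

lemma norm_sq_diracOrbital {m : ℝ} (hm : 0 ≤ m) (hk : 1 ≤ ‖k‖) (ξ : Space) :
    ‖diracOrbital hg hl hm hk ξ‖ ^ 2 = amplitude g l k ξ ^ 2 := by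
  rw [diracOrbital_apply, norm_smul, mul_pow, Real.norm_eq_abs, sq_abs]
  by_cases hξ : ξ = 0
  · rw [hξ, amplitude_eq_zero_at_zero hg hl hk]
    simp
  · rw [norm_spinorField hm hξ, one_pow, mul_one]

lemma norm_sq_plainOrbital (k ξ : Space) :
    ‖plainOrbital hg hl k ξ‖ ^ 2 = amplitude g l k ξ ^ 2 := by
  rw [plainOrbital_apply, norm_smul, mul_pow, Real.norm_eq_abs, sq_abs, norm_limitSpinor, one_pow,
    mul_one]

/-- Momentum orbitals with disjoint supports. -/
lemma isOrbitals_diracOrbital {m : ℝ} (hm : 0 ≤ m) {N : ℕ} {scale : Fin N → ℝ}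
    {center : Fin N → Space} (hs : ∀ i, 0 < scale i) (hk : ∀ i, 1 ≤ ‖center i‖)
    (hdisj : ∀ i j, i ≠ j → ∀ ξ, amplitude g (scale i) (center i) ξ = 0 ∨
      amplitude g (scale j) (center j) ξ = 0) :
    IsOrbitals m fun i => diracOrbital hg (hs i) hm (hk i) where
  compact i := (hasCompactSupport_amplitude hg (hs i)).smul_right
  positive i ξ := by
    rw [diracOrbital_apply, WithLp.ofLp_smul, Matrix.mulVec_smul,
      diracSymbol_mulVec_spinorField, smul_comm]
  orthonormal i j := by
    by_cases hij : i = j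
    · subst hij
      rw [if_pos rfl]
      have h1 : ∀ ξ, inner ℂ (diracOrbital hg (hs i) hm (hk i) ξ)
          (diracOrbital hg (hs i) hm (hk i) ξ)
          = ((amplitude g (scale i) (center i) ξ ^ 2 : ℝ) : ℂ) := fun ξ => by
        rw [inner_self_eq_norm_sq_to_K, ← norm_sq_diracOrbital hg (hs i) hm (hk i) ξ]
        norm_cast
      simp_rw [h1]
      rw [integral_complex_ofReal, integral_amplitude_sq hg (hs i), Complex.ofReal_one]
    · rw [if_neg hij]
      have h1 : ∀ ξ, inner ℂ (diracOrbital hg (hs i) hm (hk i) ξ)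
          (diracOrbital hg (hs j) hm (hk j) ξ) = (0 : ℂ) := fun ξ => by
        simp only [diracOrbital_apply]
        rcases hdisj i j hij ξ with h | h <;> simp [h]
      simp [h1]

include hg hl in
lemma integrable_amplitude_sq : Integrable fun ξ => amplitude g l k ξ ^ 2 := by
  refine ((integrable_norm_sq_schwartz (plainOrbital hg hl k))).congr
    (Filter.Eventually.of_forall fun ξ => norm_sq_plainOrbital hg hl k ξ)

include hg hl in
lemma norm_lt_of_amplitude_ne_zero {ξ : Space} (h : amplitude g l k ξ ≠ 0) :
    ‖ξ‖ < l * (‖k‖ + 1 / 2) := by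
  have h1 := norm_sub_lt_of_amplitude_ne_zero hg hl h
  have h2 : ‖ξ‖ ≤ ‖ξ - l • k‖ + ‖l • k‖ := by simpa using norm_add_le (ξ - l • k) (l • k)
  rw [norm_smul, Real.norm_of_nonneg hl.le] at h2
  linarith

lemma integral_kinetic_le {m : ℝ} (hm : 0 ≤ m) (hk : 1 ≤ ‖k‖) :
    ∫ ξ, diracEnergy m ξ * ‖diracOrbital hg hl hm hk ξ‖ ^ 2
      ≤ 2 * π * (l * (‖k‖ + 1 / 2)) + m := by
  have h1 : ∀ ξ, diracEnergy m ξ * ‖diracOrbital hg hl hm hk ξ‖ ^ 2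
      ≤ (2 * π * (l * (‖k‖ + 1 / 2)) + m) * amplitude g l k ξ ^ 2 := by
    intro ξ
    rw [norm_sq_diracOrbital]
    by_cases h : amplitude g l k ξ = 0
    · simp [h]
    · have h2 := diracEnergy_le hm ξ
      have h3 := norm_lt_of_amplitude_ne_zero hg hl h
      have hpi := Real.pi_pos
      gcongr
      exact h2.trans (by gcongr)
  have hi : Integrable fun ξ => (2 * π * (l * (‖k‖ + 1 / 2)) + m) * amplitude g l k ξ ^ 2 :=
    (integrable_amplitude_sq hg hl).const_mul _
  have h2 := integral_mono_of_nonneg (Filter.Eventually.of_forall fun ξ =>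
    mul_nonneg (Real.sqrt_nonneg _) (sq_nonneg _)) hi (Filter.Eventually.of_forall h1)
  refine h2.trans ?_
  rw [integral_const_mul, integral_amplitude_sq hg hl, mul_one]

/-! ### The scalar wave function of an orbital -/

/-- The inverse Fourier transform of the amplitude. -/
def scalarWave (g : Space → ℝ) (l : ℝ) (k x : Space) : ℂ :=
  ∫ ξ, Complex.exp (↑(2 * π * inner ℝ ξ x) * Complex.I) * (amplitude g l k ξ : ℂ)

lemma positionOrbital_plainOrbital (k x : Space) :
    positionOrbital (plainOrbital hg hl k) x = scalarWave g l k x • limitSpinor := by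
  ext s
  rw [schwartz_fourierInv_apply]
  simp only [plainOrbital_apply, PiLp.smul_apply, smul_eq_mul, scalarWave]
  rw [← integral_mul_const]
  refine integral_congr_ae (Filter.Eventually.of_forall fun ξ => ?_)
  simp only [Complex.real_smul]
  ring

include hl in
-- The shift of the momentum by `l k` becomes a phase of modulus one, and the dilation of the
-- momentum becomes the inverse dilation of the position. So the density does not depend on `k`: all
-- orbitals of the cluster sit at the same place.
lemma norm_sq_scalarWave (g : Space → ℝ) (k x : Space) :
    ‖scalarWave g l k x‖ ^ 2 = l ^ 3 * ‖scalarWave g 1 0 (l • x)‖ ^ 2 := by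
  have h0 : ((l ^ 3 : ℝ) : ℂ) ≠ 0 := by exact_mod_cast (by positivity : l ^ 3 ≠ 0)
  have h1 : scalarWave g l k x = ((l ^ 3 : ℝ) : ℂ) *
      (((√(l ^ 3))⁻¹ : ℝ) * (Complex.exp (↑(2 * π * inner ℝ (l • k) x) * Complex.I) *
        scalarWave g 1 0 (l • x))) := by
    have e1 := Measure.integral_comp_smul_of_nonneg (volume : Measure Space)
      (fun ξ => Complex.exp (↑(2 * π * inner ℝ ξ x) * Complex.I) * (amplitude g l k ξ : ℂ)) l
      (hR := hl.le)
    rw [finrank_euclideanSpace, Fintype.card_fin] at e1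
    have e2 : scalarWave g l k x = ((l ^ 3 : ℝ) : ℂ) * ∫ ξ : Space,
        Complex.exp (↑(2 * π * inner ℝ (l • ξ) x) * Complex.I) * (amplitude g l k (l • ξ) : ℂ) := by
      rw [e1, Complex.real_smul, ← mul_assoc, ← Complex.ofReal_mul,
        mul_inv_cancel₀ (by positivity), Complex.ofReal_one, one_mul]
      rfl
    rw [e2, ← integral_add_right_eq_self _ k]
    congr 1
    simp only [scalarWave]
    rw [← integral_const_mul, ← integral_const_mul]
    refine integral_congr_ae (Filter.Eventually.of_forall fun ξ => ?_)
    simp only [amplitude, inv_smul_smul₀ hl.ne', add_sub_cancel_right, one_pow, Real.sqrt_one,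
      inv_one, one_smul, sub_zero, one_mul]
    rw [show inner ℝ (l • (ξ + k)) x = inner ℝ (l • k) x + inner ℝ ξ (l • x) by
      rw [smul_add, inner_add_left, real_inner_smul_left, real_inner_smul_right]; ring]
    rw [mul_add, Complex.ofReal_add, add_mul, Complex.exp_add]
    push_cast
    ring
  rw [h1, norm_mul, norm_mul, norm_mul, Complex.norm_exp_ofReal_mul_I, one_mul, Complex.norm_real,
    Complex.norm_real, Real.norm_of_nonneg (by positivity), Real.norm_of_nonneg (by positivity),
    mul_pow, mul_pow, inv_pow, Real.sq_sqrt (by positivity)]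
  field_simp

lemma integral_norm_sq_position (f : 𝓢(Space, Spinor)) :
    ∫ x, ‖positionOrbital f x‖ ^ 2 = ∫ ξ, ‖f ξ‖ ^ 2 := by
  have := SchwartzMap.integral_norm_sq_fourier (positionOrbital f)
  rw [FourierTransform.fourier_fourierInv_eq] at this
  exact this.symm

lemma norm_sq_position_plainOrbital (k x : Space) :
    ‖positionOrbital (plainOrbital hg hl k) x‖ ^ 2 = ‖scalarWave g l k x‖ ^ 2 := by
  rw [positionOrbital_plainOrbital, norm_smul, norm_limitSpinor, mul_one]

include hg in
lemma integral_norm_sq_scalarWave : ∫ x, ‖scalarWave g 1 0 x‖ ^ 2 = 1 := by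
  simp_rw [← norm_sq_position_plainOrbital hg one_pos]
  rw [integral_norm_sq_position]
  simp_rw [norm_sq_plainOrbital]
  exact integral_amplitude_sq hg one_pos

include hg in
lemma integrable_norm_sq_scalarWave : Integrable fun x => ‖scalarWave g 1 0 x‖ ^ 2 := by
  simp_rw [← norm_sq_position_plainOrbital hg one_pos]
  exact integrable_norm_sq_schwartz _

end Amplitude

/-! ### The magnetic energy of an orbital -/

lemma continuous_alphaDot_act {A : Space → Space} (hA : Continuous A) (f : 𝓢(Space, Spinor)) :
    Continuous fun x => actSpinor (alphaDot (A x)) (f x) := by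
  have hf := f.continuous
  have h1 : Continuous fun x => alphaDot (A x) := by
    unfold alphaDot
    fun_prop
  unfold actSpinor
  have h2 : Continuous fun x => WithLp.ofLp (f x) := by fun_prop
  exact (PiLp.continuous_toLp 2 _).comp (h1.matrix_mulVec h2)

lemma norm_inner_alphaDot_le (v : Space) (a b : Spinor) :
    ‖(inner ℂ a (actSpinor (alphaDot v) b) : ℂ)‖ ≤ ‖v‖ * (‖a‖ * ‖b‖) := by
  refine (norm_inner_le_norm _ _).trans ?_
  have := norm_actSpinor_alphaDot_le v b
  calc ‖a‖ * ‖actSpinor (alphaDot v) b‖ ≤ ‖a‖ * (‖v‖ * ‖b‖) := by gcongr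
    _ = _ := by ring

lemma integrable_magnetic {A : Space → Space} (hA : Continuous A) {a : ℝ}
    (ha : ∀ x, ‖A x‖ ≤ a) (f h : 𝓢(Space, Spinor)) :
    Integrable fun x => (inner ℂ (f x) (actSpinor (alphaDot (A x)) (h x)) : ℂ) := by
  have hi : Integrable fun x => a * (‖f x‖ ^ 2 + ‖h x‖ ^ 2) :=
    ((integrable_norm_sq_schwartz f).add (integrable_norm_sq_schwartz h)).const_mul a
  refine hi.mono' (f.continuous.inner (continuous_alphaDot_act hA h)).aestronglyMeasurable
    (Filter.Eventually.of_forall fun x => (norm_inner_alphaDot_le _ _ _).trans ?_)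
  have ha0 : 0 ≤ a := (norm_nonneg _).trans (ha x)
  refine mul_le_mul (ha x) ?_ (by positivity) ha0
  nlinarith [sq_nonneg (‖f x‖ - ‖h x‖), norm_nonneg (f x), norm_nonneg (h x)]

lemma actSpinor_sub (M : Matrix Spin Spin ℂ) (a b : Spinor) :
    actSpinor M (a - b) = actSpinor M a - actSpinor M b := by
  rw [actSpinor, WithLp.ofLp_sub, Matrix.mulVec_sub]
  rfl

lemma integral_mul_add_mul_add {F G H : Space → ℝ} (hF : Integrable F) (hG : Integrable G)
    (hH : Integrable H) (a b : ℝ) :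
    ∫ x, (a * F x + b * (G x + H x)) = a * (∫ x, F x) + b * ((∫ x, G x) + ∫ x, H x) := by
  rw [← integral_add hG hH, ← integral_const_mul, ← integral_const_mul]
  exact integral_add (hF.const_mul a) ((hG.add hH).const_mul b)

/-- The magnetic energies of two nearby orbitals are close. -/
lemma abs_magnetic_sub_le {A : Space → Space} (hA : Continuous A) {a : ℝ} (ha : ∀ x, ‖A x‖ ≤ a)
    (f h : 𝓢(Space, Spinor)) {δ : ℝ} (hδ : 0 < δ) (hf : ∫ ξ, ‖f ξ‖ ^ 2 = 1)
    (hh : ∫ ξ, ‖h ξ‖ ^ 2 = 1) (hd : ∫ ξ, ‖f ξ - h ξ‖ ^ 2 ≤ δ ^ 2) :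
    |(∫ x, (inner ℂ (positionOrbital f x)
        (actSpinor (alphaDot (A x)) (positionOrbital f x))).re)
      - ∫ x, (inner ℂ (positionOrbital h x)
        (actSpinor (alphaDot (A x)) (positionOrbital h x))).re| ≤ 2 * a * δ := by
  have ha0 : 0 ≤ a := (norm_nonneg _).trans (ha 0)
  have hsub : ∀ x, positionOrbital (f - h) x = positionOrbital f x - positionOrbital h x := by
    intro x
    have : positionOrbital (f - h) = positionOrbital f - positionOrbital h := by
      rw [positionOrbital, sub_eq_add_neg, FourierTransform.fourierInv_add,
        FourierTransform.fourierInv_neg, ← sub_eq_add_neg]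
    rw [this]
    rfl
  have hif := (integrable_magnetic hA ha (positionOrbital f) (positionOrbital f)).re
  have hih := (integrable_magnetic hA ha (positionOrbital h) (positionOrbital h)).re
  simp only [RCLike.re_eq_complex_re] at hif hih
  rw [← integral_sub hif hih, ← Real.norm_eq_abs]
  -- The pointwise bound is `a ‖F - H‖ (‖F‖ + ‖H‖)`, split by Young's inequality with weight `δ`.
  -- Since `F - H` has squared norm at most `δ ^ 2`, both halves integrate to at most `a δ`.
  set D : Space → ℝ := fun x => a * (δ⁻¹ * ‖positionOrbital (f - h) x‖ ^ 2
    + δ / 2 * (‖positionOrbital f x‖ ^ 2 + ‖positionOrbital h x‖ ^ 2)) with hD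
  have hDi : Integrable D :=
    (((integrable_norm_sq_schwartz _).const_mul _).add
      (((integrable_norm_sq_schwartz _).add (integrable_norm_sq_schwartz _)).const_mul _)).const_mul a
  have hle : ∀ x, ‖(inner ℂ (positionOrbital f x)
        (actSpinor (alphaDot (A x)) (positionOrbital f x))).re
      - (inner ℂ (positionOrbital h x)
        (actSpinor (alphaDot (A x)) (positionOrbital h x))).re‖ ≤ D x := by
    intro x
    simp only [hD, hsub]
    set F := positionOrbital f x
    set H := positionOrbital h x
    have e1 : inner ℂ F (actSpinor (alphaDot (A x)) F) - inner ℂ H (actSpinor (alphaDot (A x)) H)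
        = inner ℂ (F - H) (actSpinor (alphaDot (A x)) F)
          + (inner ℂ H (actSpinor (alphaDot (A x)) (F - H)) : ℂ) := by
      rw [actSpinor_sub, inner_sub_left, inner_sub_right]
      ring
    rw [← Complex.sub_re, e1]
    refine (Complex.abs_re_le_norm _).trans ((norm_add_le _ _).trans ?_)
    have e2 := norm_inner_alphaDot_le (A x) (F - H) F
    have e3 := norm_inner_alphaDot_le (A x) H (F - H)
    have e4 : ‖F - H‖ * (‖F‖ + ‖H‖)
        ≤ δ⁻¹ * ‖F - H‖ ^ 2 + δ / 2 * (‖F‖ ^ 2 + ‖H‖ ^ 2) := by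
      have h1 : ∀ t : ℝ, ‖F - H‖ * t ≤ δ⁻¹ / 2 * ‖F - H‖ ^ 2 + δ / 2 * t ^ 2 := by
        intro t
        have h2 : δ⁻¹ / 2 * ‖F - H‖ ^ 2 + δ / 2 * t ^ 2 - ‖F - H‖ * t
            = δ⁻¹ / 2 * (‖F - H‖ - δ * t) ^ 2 := by
          field_simp
          ring
        have h3 : 0 ≤ δ⁻¹ / 2 * (‖F - H‖ - δ * t) ^ 2 := by positivity
        linarith
      have h4 := h1 ‖F‖
      have h5 := h1 ‖H‖
      linarith
    calc _ ≤ ‖A x‖ * (‖F - H‖ * ‖F‖) + ‖A x‖ * (‖H‖ * ‖F - H‖) := add_le_add e2 e3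
      _ = ‖A x‖ * (‖F - H‖ * (‖F‖ + ‖H‖)) := by ring
      _ ≤ a * (‖F - H‖ * (‖F‖ + ‖H‖)) := by gcongr; exact ha x
      _ ≤ _ := by gcongr
  refine (norm_integral_le_of_norm_le hDi (Filter.Eventually.of_forall hle)).trans ?_
  have hval : ∫ x, D x = a * (δ⁻¹ * (∫ ξ, ‖f ξ - h ξ‖ ^ 2) + δ / 2 * (1 + 1)) := by
    have hpf : ∫ x, ‖positionOrbital f x‖ ^ 2 = 1 := (integral_norm_sq_position f).trans hf
    have hph : ∫ x, ‖positionOrbital h x‖ ^ 2 = 1 := (integral_norm_sq_position h).trans hh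
    have hpd : ∫ x, ‖positionOrbital (f - h) x‖ ^ 2 = ∫ ξ, ‖f ξ - h ξ‖ ^ 2 :=
      integral_norm_sq_position (f - h)
    rw [hD, integral_const_mul, integral_mul_add_mul_add (integrable_norm_sq_schwartz _)
      (integrable_norm_sq_schwartz _) (integrable_norm_sq_schwartz _), hpf, hph, hpd]
  rw [hval]
  have h1 : δ⁻¹ * (∫ ξ, ‖f ξ - h ξ‖ ^ 2) ≤ δ := by
    rw [inv_mul_le_iff₀ hδ, ← sq]
    exact hd
  calc a * (δ⁻¹ * (∫ ξ, ‖f ξ - h ξ‖ ^ 2) + δ / 2 * (1 + 1)) ≤ a * (δ + δ / 2 * (1 + 1)) := by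
        gcongr
    _ = 2 * a * δ := by ring

/-! ### Magnetic energy of concentrated and of fixed orbitals -/

section Magnetic

variable {g : Space → ℝ} (hg : IsProfile g) {A : Space → Space} (hA : Continuous A) {a : ℝ}
  (ha : ∀ x, ‖A x‖ ≤ a)

/-- The average of the third component of the rescaled potential in the profile density. -/
def averagedPotential (g : Space → ℝ) (A : Space → Space) (r : ℝ) : ℝ :=
  ∫ y, A (r⁻¹ • y) 2 * ‖scalarWave g 1 0 y‖ ^ 2

lemma abs_apply_le_norm (v : Space) (i : Fin 3) : |v i| ≤ ‖v‖ := by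
  simpa using PiLp.norm_apply_le v i

include hg hA ha in
-- By dominated convergence the average tends to `A 0 2 = 1` as the potential is stretched. A fixed
-- ratio `r` between the lengths of the potential and of the orbitals thus suffices for all scales.
lemma exists_radius (hA0 : A 0 2 = 1) : ∃ r : ℝ, 1 ≤ r ∧ 1 / 2 ≤ averagedPotential g A r := by
  have hcoord : Continuous fun x => A x 2 := by fun_prop
  have hwm : AEStronglyMeasurable (fun y => ‖scalarWave g 1 0 y‖ ^ 2) volume :=
    (integrable_norm_sq_scalarWave hg).1
  have hlim : Filter.Tendsto (averagedPotential g A) Filter.atTop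
      (nhds (∫ y, A 0 2 * ‖scalarWave g 1 0 y‖ ^ 2)) := by
    refine tendsto_integral_filter_of_dominated_convergence
      (fun y => a * ‖scalarWave g 1 0 y‖ ^ 2) ?_ ?_
      ((integrable_norm_sq_scalarWave hg).const_mul a) ?_
    · refine Filter.Eventually.of_forall fun r => ?_
      exact (hcoord.comp (continuous_const_smul r⁻¹)).aestronglyMeasurable.mul hwm
    · refine Filter.Eventually.of_forall fun r => Filter.Eventually.of_forall fun y => ?_
      rw [norm_mul, Real.norm_eq_abs, Real.norm_of_nonneg (sq_nonneg ‖scalarWave g 1 0 y‖)]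
      gcongr
      exact (abs_apply_le_norm _ _).trans (ha _)
    · refine Filter.Eventually.of_forall fun y => ?_
      refine Filter.Tendsto.mul_const _ ?_
      have h1 : Filter.Tendsto (fun r : ℝ => r⁻¹ • y) Filter.atTop (nhds ((0 : ℝ) • y)) :=
        tendsto_inv_atTop_zero.smul_const y
      rw [zero_smul] at h1
      exact (hcoord.tendsto 0).comp h1
  rw [integral_const_mul, integral_norm_sq_scalarWave hg, hA0, mul_one] at hlim
  have h1 := hlim.eventually (eventually_ge_nhds (by norm_num : (1 : ℝ) / 2 < 1))
  obtain ⟨r, hr⟩ := (h1.and (Filter.eventually_ge_atTop 1)).exists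
  exact ⟨r, hr.2, hr.1⟩

lemma inner_smul_limitSpinor (v : Space) (z : ℂ) :
    (inner ℂ (z • limitSpinor) (actSpinor (alphaDot v) (z • limitSpinor))).re
      = v 2 * ‖z‖ ^ 2 := by
  have h : actSpinor (alphaDot v) (z • limitSpinor) = z • actSpinor (alphaDot v) limitSpinor := by
    rw [actSpinor, WithLp.ofLp_smul, Matrix.mulVec_smul]
    rfl
  rw [h, inner_smul_left, inner_smul_right, inner_limitSpinor_alphaDot, ← mul_assoc,
    ← Complex.normSq_eq_conj_mul_self, Complex.normSq_eq_norm_sq, ← Complex.ofReal_mul,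
    Complex.ofReal_re, mul_comm]

/-- With the constant spinor the energy is the exact average of the third component of the potential
in the common density. The scale `l` cancels because potential and orbital shrink together. -/
lemma integral_magnetic_plainOrbital {l r : ℝ} (hl : 0 < l) (k : Space) (A : Space → Space)
    (t : ℝ) :
    ∫ x, (inner ℂ (positionOrbital (plainOrbital hg hl k) x)
      (actSpinor (alphaDot (t • A ((l / r) • x))) (positionOrbital (plainOrbital hg hl k) x))).re
      = t * averagedPotential g A r := by
  rw [averagedPotential,
    ← integral_scale hl fun y => A (r⁻¹ • y) 2 * ‖scalarWave g 1 0 y‖ ^ 2, ← integral_const_mul]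
  refine integral_congr_ae (Filter.Eventually.of_forall fun x => ?_)
  simp only [positionOrbital_plainOrbital]
  rw [inner_smul_limitSpinor, norm_sq_scalarWave hl, smul_smul, div_eq_inv_mul]
  simp only [PiLp.smul_apply, smul_eq_mul]
  ring

lemma integral_norm_diracOrbital_sub_le {l : ℝ} (hl : 0 < l) {k : Space} {m : ℝ} (hm : 0 ≤ m)
    (hk : 1 ≤ ‖k‖) {ε : ℝ} (h : ∀ ξ, amplitude g l k ξ ≠ 0 →
      0 < ξ 2 ∧ 2 * π * (|ξ 0| + |ξ 1|) + 2 * m ≤ ε * (2 * π * ξ 2)) :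
    ∫ ξ, ‖diracOrbital hg hl hm hk ξ - plainOrbital hg hl k ξ‖ ^ 2 ≤ ε := by
  have h1 : ∀ ξ, ‖diracOrbital hg hl hm hk ξ - plainOrbital hg hl k ξ‖ ^ 2
      ≤ ε * amplitude g l k ξ ^ 2 := by
    intro ξ
    rw [diracOrbital_apply, plainOrbital_apply, ← smul_sub, norm_smul, mul_pow, Real.norm_eq_abs,
      sq_abs, mul_comm ε]
    by_cases h0 : amplitude g l k ξ = 0
    · simp [h0]
    · obtain ⟨h2, h3⟩ := h ξ h0
      gcongr
      exact norm_spinorField_sub_sq_le hm h2 h3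
  have h2 := integral_mono_of_nonneg (Filter.Eventually.of_forall fun ξ => sq_nonneg _)
    ((integrable_amplitude_sq hg hl).const_mul ε) (Filter.Eventually.of_forall h1)
  refine h2.trans ?_
  rw [integral_const_mul, integral_amplitude_sq hg hl, mul_one]

include hA ha in
/-- The magnetic energy of an orbital with momenta almost parallel to `e₂`. -/
lemma integral_magnetic_diracOrbital_le {l r : ℝ} (hl : 0 < l) {k : Space} {m : ℝ}
    (hm : 0 ≤ m) (hk : 1 ≤ ‖k‖) {δ : ℝ} (hδ : 0 < δ) (haδ : 2 * a * δ ≤ 1 / 4)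
    (havg : 1 / 2 ≤ averagedPotential g A r) (h : ∀ ξ, amplitude g l k ξ ≠ 0 →
      0 < ξ 2 ∧ 2 * π * (|ξ 0| + |ξ 1|) + 2 * m ≤ δ ^ 2 * (2 * π * ξ 2)) {t : ℝ} (ht : t ≤ 0) :
    ∫ x, (inner ℂ (positionOrbital (diracOrbital hg hl hm hk) x)
      (actSpinor (alphaDot (t • A ((l / r) • x)))
        (positionOrbital (diracOrbital hg hl hm hk) x))).re ≤ t / 4 := by
  have hA' : Continuous fun x => t • A ((l / r) • x) := by fun_prop
  have ha' : ∀ x, ‖t • A ((l / r) • x)‖ ≤ -t * a := fun x => by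
    rw [norm_smul, Real.norm_of_nonpos ht]
    exact mul_le_mul_of_nonneg_left (ha _) (by linarith)
  have h1 := abs_magnetic_sub_le hA' ha' (diracOrbital hg hl hm hk) (plainOrbital hg hl k) hδ
    (by simp_rw [norm_sq_diracOrbital]; exact integral_amplitude_sq hg hl)
    (by simp_rw [norm_sq_plainOrbital]; exact integral_amplitude_sq hg hl)
    (integral_norm_diracOrbital_sub_le hg hl hm hk h)
  rw [integral_magnetic_plainOrbital hg hl k A t] at h1
  -- The main term is at most `t / 2`, and replacing the spinor costs at most `2 a δ |t| ≤ |t| / 4`.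
  have h2 := (le_abs_self _).trans h1
  nlinarith

include hA ha in
-- For a fixed orbital the supremum of its density is paired with the `L¹` norm of the rescaled
-- potential, which carries the factor `s⁻³`. This outweighs a coupling `t` growing linearly in `s`.
lemma integral_magnetic_le_of_bounded (hAi : Integrable A) (f : 𝓢(Space, Spinor)) {C : ℝ}
    (hC0 : 0 ≤ C) (hC : ∀ x, ‖positionOrbital f x‖ ≤ C) {s : ℝ} (hs : 0 < s) (t : ℝ) :
    ∫ x, (inner ℂ (positionOrbital f x)
      (actSpinor (alphaDot (t • A (s • x))) (positionOrbital f x))).re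
      ≤ |t| * C ^ 2 * ((s ^ 3)⁻¹ * ∫ x, ‖A x‖) := by
  have hi : Integrable fun x => |t| * C ^ 2 * ‖A (s • x)‖ :=
    ((hAi.comp_smul hs.ne').norm).const_mul _
  have hA' : Continuous fun x => t • A (s • x) := by fun_prop
  have ha' : ∀ x, ‖t • A (s • x)‖ ≤ |t| * a := fun x => by
    rw [norm_smul, Real.norm_eq_abs]
    exact mul_le_mul_of_nonneg_left (ha _) (abs_nonneg t)
  have hint := (integrable_magnetic hA' ha' (positionOrbital f) (positionOrbital f)).re
  have h1 := integral_mono hint hi (fun x => by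
    refine (Complex.re_le_norm _).trans ((norm_inner_alphaDot_le _ _ _).trans ?_)
    rw [norm_smul, Real.norm_eq_abs]
    have h2 : ‖positionOrbital f x‖ * ‖positionOrbital f x‖ ≤ C ^ 2 := by
      rw [sq]
      exact mul_le_mul (hC x) (hC x) (norm_nonneg _) hC0
    calc |t| * ‖A (s • x)‖ * (‖positionOrbital f x‖ * ‖positionOrbital f x‖)
        ≤ |t| * ‖A (s • x)‖ * C ^ 2 := by gcongr
      _ = _ := by ring)
  refine h1.trans (le_of_eq ?_)
  rw [integral_const_mul, Measure.integral_comp_smul_of_nonneg volume (fun x => ‖A x‖) s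
    (hR := hs.le)]
  simp

end Magnetic

/-! ### The lattice of momenta -/

/-- The momentum centre number `i` in a cube of side `n`, shifted by `M n` in direction `e₂`. -/
def clusterCenter (M n i : ℕ) : Space :=
  WithLp.toLp 2 ![((i % n : ℕ) : ℝ), ((i / n % n : ℕ) : ℝ), ((M * n + i / n / n : ℕ) : ℝ)]

/-- The momentum centres of the remaining orbitals. -/
def axisCenter (j : ℕ) : Space := WithLp.toLp 2 ![0, 0, ((j + 1 : ℕ) : ℝ)]

lemma one_le_abs_sub_of_ne {p q : ℕ} (h : p ≠ q) : 1 ≤ |(p : ℝ) - q| := by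
  have h1 : (1 : ℤ) ≤ |(p : ℤ) - q| := Int.one_le_abs (sub_ne_zero.2 (by exact_mod_cast h))
  exact_mod_cast h1

lemma one_le_norm_clusterCenter_sub {M n i j : ℕ} (hij : i ≠ j) :
    1 ≤ ‖clusterCenter M n i - clusterCenter M n j‖ := by
  -- The components of the centre are digits of `i` in base `n`, the last one unbounded and shifted.
  -- They determine `i`, so some integer component differs, by at least 1.
  have h : i % n ≠ j % n ∨ i / n % n ≠ j / n % n ∨ M * n + i / n / n ≠ M * n + j / n / n := by
    by_contra! hc
    obtain ⟨h1, h2, h3⟩ := hc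
    have h4 : i / n = j / n := by
      rw [← Nat.mod_add_div (i / n) n, ← Nat.mod_add_div (j / n) n, h2, Nat.add_left_cancel h3]
    exact hij (by rw [← Nat.mod_add_div i n, ← Nat.mod_add_div j n, h1, h4])
  rcases h with h | h | h
  · exact (one_le_abs_sub_of_ne h).trans
      (abs_apply_le_norm (clusterCenter M n i - clusterCenter M n j) 0)
  · exact (one_le_abs_sub_of_ne h).trans
      (abs_apply_le_norm (clusterCenter M n i - clusterCenter M n j) 1)
  · exact (one_le_abs_sub_of_ne h).trans
      (abs_apply_le_norm (clusterCenter M n i - clusterCenter M n j) 2)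

lemma one_le_norm_axisCenter_sub {i j : ℕ} (hij : i ≠ j) :
    1 ≤ ‖axisCenter i - axisCenter j‖ :=
  (one_le_abs_sub_of_ne (fun h => hij (Nat.succ_injective h))).trans
    (abs_apply_le_norm (axisCenter i - axisCenter j) 2)

lemma norm_axisCenter (j : ℕ) : ‖axisCenter j‖ = j + 1 := by
  have h : ‖axisCenter j‖ ^ 2 = ((j : ℝ) + 1) ^ 2 := by
    rw [norm_sq_space]
    simp [axisCenter]
  exact (pow_left_inj₀ (norm_nonneg _) (by positivity) two_ne_zero).1 h

lemma le_norm_clusterCenter (M n i : ℕ) : (M * n : ℝ) ≤ ‖clusterCenter M n i‖ := by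
  have h1 : (M * n : ℝ) ≤ clusterCenter M n i 2 := by
    simp [clusterCenter]
  exact h1.trans ((le_abs_self _).trans (abs_apply_le_norm _ 2))

lemma sum_sq_le_sq {x y z M n : ℝ} (hM : 0 ≤ M) (hn : 0 ≤ n) (hx : 0 ≤ x) (hy : 0 ≤ y)
    (hz : 0 ≤ z) (hxn : x ≤ n) (hyn : y ≤ n) (hzn : z ≤ n) :
    x ^ 2 + y ^ 2 + (M * n + z) ^ 2 ≤ ((M + 3) * n) ^ 2 := by
  have h0 : x ^ 2 ≤ n ^ 2 := by gcongr
  have h1 : y ^ 2 ≤ n ^ 2 := by gcongr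
  have h2 : (M * n + z) ^ 2 ≤ (M * n + n) ^ 2 := by gcongr
  have h3 : 0 ≤ M * n ^ 2 := by positivity
  nlinarith [sq_nonneg n]

lemma norm_clusterCenter_le {M n i : ℕ} (hn : 0 < n) (hi : i < n ^ 3) :
    ‖clusterCenter M n i‖ ≤ (M + 3) * n := by
  have h0 : ((i % n : ℕ) : ℝ) ≤ n := by exact_mod_cast (Nat.mod_lt i hn).le
  have h1 : ((i / n % n : ℕ) : ℝ) ≤ n := by exact_mod_cast (Nat.mod_lt (i / n) hn).le
  have h2 : ((i / n / n : ℕ) : ℝ) ≤ n := by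
    have : i / n / n < n := by
      rw [Nat.div_lt_iff_lt_mul hn, Nat.div_lt_iff_lt_mul hn]
      calc i < n ^ 3 := hi
        _ = n * n * n := by ring
    exact_mod_cast this.le
  have e : ‖clusterCenter M n i‖ ^ 2 = ((i % n : ℕ) : ℝ) ^ 2 + ((i / n % n : ℕ) : ℝ) ^ 2
      + (M * n + ((i / n / n : ℕ) : ℝ)) ^ 2 := by
    rw [norm_sq_space]
    simp [clusterCenter]
  refine abs_le_of_sq_le_sq' ?_ (by positivity) |>.2
  rw [e]
  exact sum_sq_le_sq (Nat.cast_nonneg _) (Nat.cast_nonneg _) (Nat.cast_nonneg _)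
    (Nat.cast_nonneg _) (Nat.cast_nonneg _) h0 h1 h2

/-- Two amplitudes with the same scale and distant centres have disjoint supports. -/
lemma amplitude_disjoint {g : Space → ℝ} (hg : IsProfile g) {l : ℝ} (hl : 0 < l) {k k' : Space}
    (h : 1 ≤ ‖k - k'‖) (ξ : Space) : amplitude g l k ξ = 0 ∨ amplitude g l k' ξ = 0 := by
  by_contra! hc
  have h1 := norm_sub_lt_of_amplitude_ne_zero hg hl hc.1
  have h2 := norm_sub_lt_of_amplitude_ne_zero hg hl hc.2
  have h3 : ‖l • (k - k')‖ ≤ ‖ξ - l • k'‖ + ‖ξ - l • k‖ := by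
    have : l • (k - k') = (ξ - l • k') - (ξ - l • k) := by rw [smul_sub]; abel
    rw [this]
    exact norm_sub_le _ _
  rw [norm_smul, Real.norm_of_nonneg hl.le] at h3
  nlinarith

/-- Momenta in the support of a cluster orbital are almost parallel to `e₂`. -/
lemma cluster_momentum {g : Space → ℝ} (hg : IsProfile g) {l : ℝ} (hl : 1 ≤ l) {m : ℝ}
    (hml : m ≤ l) {M n i : ℕ} (hn : 0 < n) {ε : ℝ} (hM : 3 ≤ ε * ((M : ℝ) - 1))
    (hM1 : 2 ≤ M) {ξ : Space} (h : amplitude g l (clusterCenter M n i) ξ ≠ 0) :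
    0 < ξ 2 ∧ 2 * π * (|ξ 0| + |ξ 1|) + 2 * m ≤ ε * (2 * π * ξ 2) := by
  have hl0 : 0 < l := by linarith
  have hb := norm_sub_lt_of_amplitude_ne_zero hg hl0 h
  have hbi : ∀ j, |ξ j - l * clusterCenter M n i j| < l / 2 := fun j =>
    (abs_apply_le_norm (ξ - l • clusterCenter M n i) j).trans_lt hb
  have e0 : clusterCenter M n i 0 = ((i % n : ℕ) : ℝ) := rfl
  have e1 : clusterCenter M n i 1 = ((i / n % n : ℕ) : ℝ) := rfl
  have e2 : clusterCenter M n i 2 = M * n + ((i / n / n : ℕ) : ℝ) := by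
    simp [clusterCenter]
  have hn1 : (1 : ℝ) ≤ n := by exact_mod_cast hn
  have hM2 : (2 : ℝ) ≤ M := by exact_mod_cast hM1
  have k0 : ((i % n : ℕ) : ℝ) + 1 ≤ n := by exact_mod_cast Nat.mod_lt i hn
  have k1 : ((i / n % n : ℕ) : ℝ) + 1 ≤ n := by exact_mod_cast Nat.mod_lt (i / n) hn
  have p0 : (0 : ℝ) ≤ ((i % n : ℕ) : ℝ) := by positivity
  have p1 : (0 : ℝ) ≤ ((i / n % n : ℕ) : ℝ) := by positivity
  have p2 : (0 : ℝ) ≤ ((i / n / n : ℕ) : ℝ) := by positivity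
  have h0 := abs_lt.1 (hbi 0)
  have h1 := abs_lt.1 (hbi 1)
  have h2 := abs_lt.1 (hbi 2)
  rw [e0] at h0
  rw [e1] at h1
  rw [e2] at h2
  -- The transverse components of the centre are at most `n - 1`, which leaves room for the radius
  -- `l / 2` of the support. Likewise the third component loses less than `l n` from `l M n`.
  have q0 : |ξ 0| ≤ l * n := abs_le.2 ⟨by nlinarith, by nlinarith⟩
  have q1 : |ξ 1| ≤ l * n := abs_le.2 ⟨by nlinarith, by nlinarith⟩
  have q2 : l * ((M - 1) * n) ≤ ξ 2 := by nlinarith [mul_nonneg hl0.le p2]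
  have hpos : 0 < l * ((M - 1) * n) := by
    have : (0 : ℝ) < M - 1 := by linarith
    positivity
  have hε : 0 < ε := by
    by_contra hneg
    nlinarith
  refine ⟨hpos.trans_le q2, ?_⟩
  have hpi := Real.pi_gt_three
  have hln : l ≤ l * n := by nlinarith
  -- Each transverse component costs `l n`, and the mass term costs another `l n` since `m ≤ l ≤ l
  -- n` and `π ≥ 1`. This is the 3 in the condition on `M`.
  have hlhs : 2 * π * (|ξ 0| + |ξ 1|) + 2 * m ≤ 2 * π * (3 * (l * n)) := by
    have h3 : |ξ 0| + |ξ 1| ≤ 2 * (l * n) := by linarith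
    have h4 : 2 * π * (|ξ 0| + |ξ 1|) ≤ 2 * π * (2 * (l * n)) := by gcongr
    have h5 : 1 * (l * n) ≤ π * (l * n) := by gcongr; linarith
    calc 2 * π * (|ξ 0| + |ξ 1|) + 2 * m ≤ 2 * π * (2 * (l * n)) + 2 * (π * (l * n)) := by linarith
      _ = 2 * π * (3 * (l * n)) := by ring
  have hrhs : 2 * π * (3 * (l * n)) ≤ ε * (2 * π * ξ 2) := by
    calc 2 * π * (3 * (l * n)) ≤ 2 * π * (ε * ((M : ℝ) - 1) * (l * n)) := by gcongr
      _ = ε * (2 * π * (l * ((M - 1) * n))) := by ring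
      _ ≤ _ := by gcongr
  exact hlhs.trans hrhs

/-! ### Placing the nuclei -/

/-- The mutual repulsion of the nuclei in `s`. -/
def repulsionOn {ι : Type*} (Z : ι → ℝ) (R : ι → Space) (s : Finset ι) : ℝ :=
  1 / 2 * ∑ κ ∈ s, ∑ l ∈ s, Z κ * Z l / ‖R κ - R l‖

/-- Half of the full double sum counts each pair once; the diagonal contributes nothing, since
division by `‖0‖ = 0` gives 0. -/
lemma nuclearRepulsion_eq {K : ℕ} (Z : Fin K → ℝ) (R : Fin K → Space) :
    nuclearRepulsion Z R = repulsionOn Z R Finset.univ := by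
  have h : ∀ l : Fin K, ∑ κ, Z κ * Z l / ‖R κ - R l‖
      = ∑ κ ∈ Finset.Iio l, Z κ * Z l / ‖R κ - R l‖
        + ∑ κ ∈ Finset.Ioi l, Z κ * Z l / ‖R κ - R l‖ := fun l => by
    have hd : Disjoint (Finset.Iio l) (Finset.Ioi l) :=
      Finset.disjoint_left.2 fun κ h1 h2 =>
        lt_asymm (Finset.mem_Iio.1 h1) (Finset.mem_Ioi.1 h2)
    rw [← Finset.sum_union hd]
    refine (Finset.sum_subset (Finset.subset_univ _) fun κ _ hκ => ?_).symm
    have : κ = l := by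
      by_contra hne
      rcases lt_or_gt_of_ne hne with h1 | h1
      · exact hκ (Finset.mem_union_left _ (Finset.mem_Iio.2 h1))
      · exact hκ (Finset.mem_union_right _ (Finset.mem_Ioi.2 h1))
    simp [this]
  have hswap : ∑ l, ∑ κ ∈ Finset.Ioi l, Z κ * Z l / ‖R κ - R l‖ = nuclearRepulsion Z R := by
    rw [nuclearRepulsion]
    rw [Finset.sum_comm' (t' := Finset.univ) (s' := fun κ => Finset.Iio κ) (by simp)]
    refine Finset.sum_congr rfl fun κ _ => Finset.sum_congr rfl fun l _ => ?_
    rw [norm_sub_rev, mul_comm (Z κ)]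
  rw [repulsionOn, Finset.sum_comm]
  simp_rw [h]
  rw [Finset.sum_add_distrib, hswap]
  simp only [nuclearRepulsion]
  ring

lemma repulsionOn_insert {ι : Type*} [DecidableEq ι] (Z : ι → ℝ) (R : ι → Space) {s : Finset ι}
    {a : ι} (ha : a ∉ s) :
    repulsionOn Z R (insert a s) = repulsionOn Z R s + Z a * ∑ κ ∈ s, Z κ * (1 / ‖R κ - R a‖) := by
  have h1 : ∑ l ∈ s, Z a * Z l / ‖R a - R l‖ = Z a * ∑ κ ∈ s, Z κ * (1 / ‖R κ - R a‖) := by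
    rw [Finset.mul_sum]
    exact Finset.sum_congr rfl fun κ _ => by rw [norm_sub_rev]; ring
  have h2 : ∑ l ∈ s, Z l * Z a / ‖R l - R a‖ = Z a * ∑ κ ∈ s, Z κ * (1 / ‖R κ - R a‖) := by
    rw [Finset.mul_sum]
    exact Finset.sum_congr rfl fun κ _ => by ring
  simp only [repulsionOn, Finset.sum_insert ha, Finset.sum_add_distrib]
  rw [h1, h2, sub_self, norm_zero, div_zero]
  ring

lemma repulsionOn_congr {ι : Type*} (Z : ι → ℝ) {R R' : ι → Space} {s : Finset ι}
    (h : ∀ κ ∈ s, R κ = R' κ) : repulsionOn Z R s = repulsionOn Z R' s := by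
  rw [repulsionOn, repulsionOn]
  congr 1
  exact Finset.sum_congr rfl fun κ hκ => Finset.sum_congr rfl fun l hl => by rw [h κ hκ, h l hl]

/-! ### Screening a charge density by averaging over nuclear positions -/

section Nuclei

variable {ρ : Space → ℝ} (h : IsDensity ρ)

include h in
/-- A function is not above its average everywhere. -/
lemma exists_le_average (hq : 0 < ∫ x, ρ x) {f : Space → ℝ}
    (hf : Integrable fun x => f x * ρ x) (F : Finset Space) :
    ∃ x ∉ F, f x * ∫ x, ρ x ≤ ∫ x, f x * ρ x := by
  by_contra! hc
  set q := ∫ x, ρ x with hqd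
  -- A finite set is null, so the new point can avoid all earlier nuclei; this keeps the positions
  -- distinct.
  have hae : ∀ᵐ x : Space, x ∉ F := by
    have := (F.finite_toSet.measure_zero (volume : Measure Space))
    exact measure_eq_zero_iff_ae_notMem.1 this
  have hi : Integrable fun x => q * (f x * ρ x) - (∫ x, f x * ρ x) * ρ x :=
    (hf.const_mul q).sub (h.integrable.const_mul _)
  have hnn : 0 ≤ᵐ[volume] fun x => q * (f x * ρ x) - (∫ x, f x * ρ x) * ρ x := by
    filter_upwards [hae] with x hx
    have h1 := mul_nonneg (sub_nonneg.2 (hc x hx).le) (h.nonneg x)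
    simp only [Pi.zero_apply]
    linarith
  have h0 : ∫ x, (q * (f x * ρ x) - (∫ x, f x * ρ x) * ρ x) = 0 := by
    rw [integral_sub (hf.const_mul q) (h.integrable.const_mul _), integral_const_mul,
      integral_const_mul, ← hqd]
    ring
  -- If `f` exceeded its average off `F`, a nonnegative function would have integral zero, hence `ρ`
  -- would vanish almost everywhere, against its positive mass.
  have h2 := (integral_eq_zero_iff_of_nonneg_ae hnn hi).1 h0
  have h3 : ρ =ᵐ[volume] fun _ => 0 := by
    filter_upwards [h2, hae] with x hx hxF
    have h4 := hc x hxF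
    have h5 : (f x * q - ∫ x, f x * ρ x) * ρ x = 0 := by
      simp only [Pi.zero_apply] at hx
      linarith
    exact (mul_eq_zero.1 h5).resolve_left (sub_pos.2 h4).ne'
  rw [hqd, integral_congr_ae h3] at hq
  simp at hq

include h in
lemma integrable_attraction_mul : Integrable fun x => attraction ρ x * ρ x := by
  have h1 := (h.integrable_pair h).integral_prod_right
  refine h1.congr (Filter.Eventually.of_forall fun y => ?_)
  simp only [attraction, ← integral_mul_const]
  exact integral_congr_ae (Filter.Eventually.of_forall fun x => by ring)

include h in
lemma integral_attraction_mul : ∫ x, attraction ρ x * ρ x = coulombEnergy ρ ρ := by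
  rw [coulombEnergy, Measure.volume_eq_prod, integral_prod_symm _ (h.integrable_pair h)]
  refine integral_congr_ae (Filter.Eventually.of_forall fun y => ?_)
  simp only [attraction, ← integral_mul_const]
  exact integral_congr_ae (Filter.Eventually.of_forall fun x => by ring)

include h in
/-- Nuclei placed one after the other, each no worse than on the average. -/
lemma exists_positions {ι : Type*} [DecidableEq ι] (hq : 0 < ∫ x, ρ x) {Z : ι → ℝ}
    (hZ : ∀ κ, 0 ≤ Z κ) (s : Finset ι) : ∀ c : ℝ, ∃ R : ι → Space, Set.InjOn R s ∧
      -c * ∑ κ ∈ s, Z κ * attraction ρ (R κ) + repulsionOn Z R s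
        ≤ coulombEnergy ρ ρ / (∫ x, ρ x) * (-c * ∑ κ ∈ s, Z κ)
          + coulombEnergy ρ ρ / (∫ x, ρ x) ^ 2 * (1 / 2) *
            ((∑ κ ∈ s, Z κ) ^ 2 - ∑ κ ∈ s, Z κ ^ 2) := by
  induction s using Finset.induction_on with
  | empty => exact fun c => ⟨fun _ => 0, by simp, by simp [repulsionOn]⟩
  | insert a s ha ih =>
    intro c
    set q := ∫ x, ρ x with hqd
    -- Averaging the new nucleus over `ρ / q` turns its repulsion from each earlier nucleus into a
    -- multiple `Z a / q` of that nucleus's attraction energy. This only shifts the coupling `c`,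
    -- which is why the induction is over all `c`.
    obtain ⟨R, hR, hle⟩ := ih (c - Z a / q)
    have hi1 : Integrable fun x => -c * (attraction ρ x * ρ x) :=
      (integrable_attraction_mul h).const_mul _
    have hi2 : ∀ κ ∈ s, Integrable fun x => Z κ * (1 / ‖x - R κ‖ * ρ x) := fun κ _ =>
      (h.integrable_potential (R κ)).const_mul _
    have heq : ∀ x, (-c * attraction ρ x + ∑ κ ∈ s, Z κ * (1 / ‖R κ - x‖)) * ρ x
        = -c * (attraction ρ x * ρ x) + ∑ κ ∈ s, Z κ * (1 / ‖x - R κ‖ * ρ x) := fun x => by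
      rw [add_mul, Finset.sum_mul]
      congr 1
      · ring
      · exact Finset.sum_congr rfl fun κ _ => by rw [norm_sub_rev]; ring
    obtain ⟨x, hxF, hx⟩ := exists_le_average h hq
      (f := fun x => -c * attraction ρ x + ∑ κ ∈ s, Z κ * (1 / ‖R κ - x‖))
      (by simp_rw [heq]; exact hi1.add (integrable_finsetSum _ hi2)) (s.image R)
    simp_rw [heq] at hx
    rw [integral_add hi1 (integrable_finsetSum _ hi2), integral_const_mul,
      integral_attraction_mul h, integral_finsetSum _ hi2, ← hqd] at hx
    simp_rw [integral_const_mul] at hx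
    change _ ≤ _ + ∑ κ ∈ s, Z κ * attraction ρ (R κ) at hx
    have hup : ∀ κ ∈ s, Function.update R a x κ = R κ := fun κ hκ =>
      Function.update_of_ne (ne_of_mem_of_not_mem hκ ha) _ _
    refine ⟨Function.update R a x, ?_, ?_⟩
    · rw [Finset.coe_insert, Set.injOn_insert (by simpa using ha)]
      refine ⟨fun κ hκ l hl hkl => hR hκ hl ?_, ?_⟩
      · rwa [hup κ hκ, hup l hl] at hkl
      · rintro ⟨κ, hκ, hκx⟩
        rw [hup κ hκ, Function.update_self] at hκx
        exact hxF (Finset.mem_image.2 ⟨κ, hκ, hκx⟩)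
    · rw [repulsionOn_insert Z _ ha, repulsionOn_congr Z hup, Finset.sum_insert ha,
        Finset.sum_insert ha, Finset.sum_insert ha, Function.update_self]
      have e1 : ∑ κ ∈ s, Z κ * attraction ρ (Function.update R a x κ)
          = ∑ κ ∈ s, Z κ * attraction ρ (R κ) :=
        Finset.sum_congr rfl fun κ hκ => by rw [hup κ hκ]
      have e2 : ∑ κ ∈ s, Z κ * (1 / ‖Function.update R a x κ - x‖)
          = ∑ κ ∈ s, Z κ * (1 / ‖R κ - x‖) :=
        Finset.sum_congr rfl fun κ hκ => by rw [hup κ hκ]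
      rw [e1, e2]
      generalize (∑ κ ∈ s, Z κ * attraction ρ (R κ)) = S at *
      generalize (∑ κ ∈ s, Z κ * (1 / ‖R κ - x‖)) = T at *
      generalize (∑ κ ∈ s, Z κ ^ 2) = U at *
      generalize (∑ κ ∈ s, Z κ) = V at *
      have h1 : -c * attraction ρ x + T ≤ (-c * coulombEnergy ρ ρ + S) / q := by
        rw [le_div_iff₀ hq]; exact hx
      have h2 := mul_le_mul_of_nonneg_left h1 (hZ a)
      have e3 : coulombEnergy ρ ρ / q * (-(c - Z a / q) * V)
          = coulombEnergy ρ ρ / q * (-c * V) + coulombEnergy ρ ρ / q ^ 2 * (Z a * V) := by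
        field_simp; ring
      rw [e3] at hle
      have e4 : -c * (Z a * attraction ρ x + S) + (repulsionOn Z R s + Z a * T)
          = (-(c - Z a / q) * S + repulsionOn Z R s)
            + (Z a * (-c * attraction ρ x + T) - Z a / q * S) := by ring
      have e5 : Z a * ((-c * coulombEnergy ρ ρ + S) / q) - Z a / q * S
          = -c * Z a * (coulombEnergy ρ ρ / q) := by ring
      rw [e4]
      calc _ ≤ _ := add_le_add hle (sub_le_sub_right h2 _)
        _ = _ := by rw [e5]; ring

lemma exists_subset_sum {K : ℕ} {Z : Fin K → ℝ} {q : ℝ} (hq : 0 < q)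
    (hqZ : q ≤ ∑ κ, Z κ) :
    ∃ s : Finset (Fin K), (q - ∑ κ ∈ s, Z κ) ^ 2 ≤ ∑ κ ∈ s, Z κ ^ 2 := by
  classical
  -- In a set of least cardinality with sum at least `q`, removing any element `a` brings the sum
  -- below `q`. The overshoot is therefore at most `Z a`.
  obtain ⟨s, hs, hmin⟩ := (Finset.univ.filter fun s : Finset (Fin K) =>
    q ≤ ∑ κ ∈ s, Z κ).exists_min_image Finset.card ⟨Finset.univ, by simpa using hqZ⟩
  rw [Finset.mem_filter] at hs
  have hne : s.Nonempty := by
    rw [Finset.nonempty_iff_ne_empty]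
    rintro rfl
    simp at hs
    linarith
  obtain ⟨a, ha⟩ := hne
  have h1 : ∑ κ ∈ s.erase a, Z κ < q := by
    by_contra! hc
    have := hmin (s.erase a) (by simpa using hc)
    exact absurd (Finset.card_erase_lt_of_mem ha) (not_lt.2 this)
  have h2 := Finset.add_sum_erase s Z ha
  refine ⟨s, ?_⟩
  calc (q - ∑ κ ∈ s, Z κ) ^ 2 ≤ Z a ^ 2 := by
        rw [← neg_sq]
        exact pow_le_pow_left₀ (by linarith [hs.2]) (by linarith) 2
    _ ≤ _ := Finset.single_le_sum (f := fun κ => Z κ ^ 2) (fun κ _ => sq_nonneg _) ha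

/-- Positions of all nuclei, given the positions of some of them. -/
lemma exists_extension {K : ℕ} {Z : Fin K → ℝ} (hZ : ∀ κ, 0 ≤ Z κ) (s : Finset (Fin K))
    {R₀ : Fin K → Space} (hR₀ : Set.InjOn R₀ s) : ∃ R : Fin K → Space, Function.Injective R ∧
      (∀ κ ∈ s, R κ = R₀ κ) ∧
      repulsionOn Z R Finset.univ ≤ repulsionOn Z R₀ s + (∑ κ, Z κ) ^ 2 := by
  classical
  set T : ℝ := ∑ κ, ‖R₀ κ‖ + 1 with hT
  have hT0 : 0 ≤ T := by positivity
  have hRT : ∀ κ, ‖R₀ κ‖ + 1 ≤ T := fun κ =>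
    add_le_add_left (Finset.single_le_sum (f := fun κ => ‖R₀ κ‖) (fun κ _ => norm_nonneg _)
      (Finset.mem_univ κ)) 1
  -- The remaining nuclei sit on a half-line, one unit apart, starting beyond all points of `R₀` by
  -- at least one unit.
  let far : Fin K → Space := fun κ => EuclideanSpace.single 0 (T + ((κ : ℕ) : ℝ))
  let R : Fin K → Space := fun κ => if κ ∈ s then R₀ κ else far κ
  have hff : ∀ κ l : Fin K, κ ≠ l → 1 ≤ ‖far κ - far l‖ := fun κ l hkl => by
    have h1 := one_le_abs_sub_of_ne fun hc : (κ : ℕ) = l => hkl (Fin.ext hc)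
    refine h1.trans (le_trans (le_of_eq ?_) (abs_apply_le_norm (far κ - far l) 0))
    simp [far]
  have hfs : ∀ κ l : Fin K, 1 ≤ ‖far κ - R₀ l‖ := fun κ l => by
    have h1 : ‖far κ‖ = T + ((κ : ℕ) : ℝ) := by
      simp only [far, PiLp.norm_single]
      exact Real.norm_of_nonneg (by positivity)
    have h2 := norm_sub_norm_le (far κ) (R₀ l)
    have h3 := hRT l
    have h4 : (0 : ℝ) ≤ ((κ : ℕ) : ℝ) := Nat.cast_nonneg _
    linarith
  have hsep : ∀ κ l : Fin K, κ ≠ l → ¬(κ ∈ s ∧ l ∈ s) → 1 ≤ ‖R κ - R l‖ := by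
    intro κ l hkl hs
    by_cases hκ : κ ∈ s <;> by_cases hl : l ∈ s
    · exact absurd ⟨hκ, hl⟩ hs
    · simp only [R, hκ, hl, if_true, if_false]
      rw [norm_sub_rev]
      exact hfs l κ
    · simp only [R, hκ, hl, if_true, if_false]
      exact hfs κ l
    · simp only [R, hκ, hl, if_false]
      exact hff κ l hkl
  refine ⟨R, ?_, fun κ hκ => by simp [R, hκ], ?_⟩
  · intro κ l hkl
    by_contra hne
    by_cases hs : κ ∈ s ∧ l ∈ s
    · simp only [R, hs.1, hs.2, if_true] at hkl
      exact hne (hR₀ hs.1 hs.2 hkl)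
    · have := hsep κ l hne hs
      rw [hkl, sub_self, norm_zero] at this
      linarith
  · have hterm : ∀ κ l : Fin K, Z κ * Z l / ‖R κ - R l‖
        ≤ (if κ ∈ s then if l ∈ s then Z κ * Z l / ‖R₀ κ - R₀ l‖ else 0 else 0)
          + Z κ * Z l := by
      intro κ l
      have hZZ := mul_nonneg (hZ κ) (hZ l)
      by_cases hs : κ ∈ s ∧ l ∈ s
      · simp only [R, hs.1, hs.2, if_true]
        linarith
      · have h0 : (if κ ∈ s then if l ∈ s then Z κ * Z l / ‖R₀ κ - R₀ l‖ else 0 else 0) = 0 := by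
          split_ifs with h1 h2
          · exact absurd ⟨h1, h2⟩ hs
          · rfl
          · rfl
        rw [h0, zero_add]
        by_cases hkl : κ = l
        · rw [hkl, sub_self, norm_zero, div_zero]
          exact mul_nonneg (hZ l) (hZ l)
        · exact div_le_self hZZ (hsep κ l hkl hs)
    have hsum := Finset.sum_le_sum fun κ (_ : κ ∈ Finset.univ) =>
      Finset.sum_le_sum fun l (_ : l ∈ Finset.univ) => hterm κ l
    have e1 : ∑ κ, ∑ l, ((if κ ∈ s then if l ∈ s then Z κ * Z l / ‖R₀ κ - R₀ l‖ else 0 else 0)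
          + Z κ * Z l) = ∑ κ ∈ s, ∑ l ∈ s, Z κ * Z l / ‖R₀ κ - R₀ l‖ + (∑ κ, Z κ) ^ 2 := by
      simp_rw [Finset.sum_add_distrib]
      congr 1
      · have hin : ∀ κ, (∑ l, if κ ∈ s then if l ∈ s then Z κ * Z l / ‖R₀ κ - R₀ l‖ else 0 else 0)
            = if κ ∈ s then ∑ l ∈ s, Z κ * Z l / ‖R₀ κ - R₀ l‖ else 0 := fun κ => by
          split_ifs
          · simp
          · simp
        simp_rw [hin]
        simp
      · rw [sq, Finset.sum_mul_sum]
    rw [e1] at hsum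
    simp only [repulsionOn]
    nlinarith [sq_nonneg (∑ κ, Z κ)]

include h in
/-- Nuclei of sufficient total charge can be placed so that they screen a charge density. -/
lemma exists_nuclei {K : ℕ} {Z : Fin K → ℝ} (hZ : ∀ κ, 0 ≤ Z κ) (hq : 0 < ∫ x, ρ x)
    (hqZ : ∫ x, ρ x ≤ ∑ κ, Z κ) : ∃ R : Fin K → Space, Function.Injective R ∧
      -(∑ κ, Z κ * attraction ρ (R κ)) + 1 / 2 * coulombEnergy ρ ρ + nuclearRepulsion Z R
        ≤ (∑ κ, Z κ) ^ 2 := by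
  obtain ⟨s, hs⟩ := exists_subset_sum hq hqZ
  obtain ⟨R₀, hR₀, hle⟩ := exists_positions h hq hZ s 1
  obtain ⟨R, hR, hRs, hrep⟩ := exists_extension hZ s hR₀
  refine ⟨R, hR, ?_⟩
  rw [nuclearRepulsion_eq]
  have h1 : ∑ κ ∈ s, Z κ * attraction ρ (R₀ κ) ≤ ∑ κ, Z κ * attraction ρ (R κ) := by
    rw [Finset.sum_congr rfl fun κ hκ => by rw [← hRs κ hκ]]
    exact Finset.sum_le_sum_of_subset_of_nonneg (Finset.subset_univ s)
      fun κ _ _ => mul_nonneg (hZ κ) (attraction_nonneg h _)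
  set q := ∫ x, ρ x
  -- Adding the self-repulsion of `ρ` completes the square. The result is nonpositive because the
  -- missing diagonal `∑ Z κ ^ 2` pays for the charge mismatch.
  have h2 : coulombEnergy ρ ρ / q * (-1 * ∑ κ ∈ s, Z κ)
      + coulombEnergy ρ ρ / q ^ 2 * (1 / 2) * ((∑ κ ∈ s, Z κ) ^ 2 - ∑ κ ∈ s, Z κ ^ 2)
      + 1 / 2 * coulombEnergy ρ ρ
      = coulombEnergy ρ ρ / (2 * q ^ 2)
        * ((q - ∑ κ ∈ s, Z κ) ^ 2 - ∑ κ ∈ s, Z κ ^ 2) := by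
    field_simp
    ring
  have h3 : coulombEnergy ρ ρ / (2 * q ^ 2) * ((q - ∑ κ ∈ s, Z κ) ^ 2 - ∑ κ ∈ s, Z κ ^ 2) ≤ 0 :=
    mul_nonpos_of_nonneg_of_nonpos (div_nonneg (coulombEnergy_nonneg h h) (by positivity))
      (sub_nonpos.2 hs)
  linarith

end Nuclei

/-! ### The energy of a cluster of orbitals with a common magnetic field -/

lemma integral_norm_sq_scaled_field (B : Space → Space) (c : ℝ) {s : ℝ} (hs : 0 < s) :
    ∫ x, ‖(c * s ^ 2) • B (s • x)‖ ^ 2 = c ^ 2 * s * ∫ x, ‖B x‖ ^ 2 := by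
  rw [← integral_scale hs fun x => ‖B x‖ ^ 2, ← integral_const_mul]
  refine integral_congr_ae (Filter.Eventually.of_forall fun x => ?_)
  simp only [norm_smul, mul_pow, Real.norm_eq_abs, sq_abs]
  ring

/-- The nuclei are arranged to screen `ρ₁` alone. Their attraction on `ρ₂` only lowers the energy
and is dropped, so the cross term and the self-energy of `ρ₂` are left over. -/
lemma exists_nuclei_potential_le {ρ₁ ρ₂ : Space → ℝ} (h₁ : IsDensity ρ₁) (h₂ : IsDensity ρ₂)
    {K : ℕ} {Z : Fin K → ℝ} (hZ : ∀ κ, 0 ≤ Z κ) (hq : 0 < ∫ x, ρ₁ x)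
    (hqZ : ∫ x, ρ₁ x ≤ ∑ κ, Z κ) : ∃ R : Fin K → Space, Function.Injective R ∧
      -(∑ κ, Z κ * attraction (fun x => ρ₁ x + ρ₂ x) (R κ))
        + 1 / 2 * coulombEnergy (fun x => ρ₁ x + ρ₂ x) (fun x => ρ₁ x + ρ₂ x)
        + nuclearRepulsion Z R
        ≤ (∑ κ, Z κ) ^ 2 + coulombEnergy ρ₂ ρ₁ + 1 / 2 * coulombEnergy ρ₂ ρ₂ := by
  obtain ⟨R, hR, hle⟩ := exists_nuclei h₁ hZ hq hqZ
  refine ⟨R, hR, ?_⟩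
  rw [coulombEnergy_add h₁ h₂]
  have h : ∑ κ, Z κ * attraction ρ₁ (R κ)
      ≤ ∑ κ, Z κ * attraction (fun x => ρ₁ x + ρ₂ x) (R κ) := by
    refine Finset.sum_le_sum fun κ _ => mul_le_mul_of_nonneg_left ?_ (hZ κ)
    refine integral_mono (h₁.integrable_potential _) ((h₁.add h₂).integrable_potential _)
      fun x => ?_
    have := h₂.nonneg x
    simp only
    gcongr
    linarith
  linarith

lemma integral_orbitalDensity {N : ℕ} {u : Fin N → 𝓢(Space, Spinor)}
    (hu : ∀ i, ∫ ξ, ‖u i ξ‖ ^ 2 = 1) : ∫ x, orbitalDensity u x = N := by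
  simp only [orbitalDensity, density]
  rw [integral_finsetSum _ fun i _ => (isDensity_norm_sq (positionOrbital (u i))).integrable]
  simp [integral_norm_sq_position, hu]

section Cluster

variable {g : Space → ℝ} (hg : IsProfile g) {M n : ℕ} (q : ℕ) {l m : ℝ}

lemma two_le_norm_clusterCenter (hM : 2 ≤ M) (hn : 0 < n) (i : ℕ) :
    2 ≤ ‖clusterCenter M n i‖ := by
  refine le_trans ?_ (le_norm_clusterCenter M n i)
  have h : 2 * 1 ≤ M * n := Nat.mul_le_mul hM hn
  exact_mod_cast h

/-- The offset by one in `axisCenter` keeps these orbitals away from zero momentum, where the spinor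
field may be singular. -/
lemma one_le_norm_axisCenter (j : ℕ) : 1 ≤ ‖axisCenter j‖ := by
  rw [norm_axisCenter]
  linarith [(Nat.cast_nonneg j : (0 : ℝ) ≤ j)]

/-- The scales of the cluster orbitals and of the remaining ones. -/
def orbitalScale (n q : ℕ) (l : ℝ) : Fin (n ^ 3 + q) → ℝ :=
  Fin.append (fun _ => l) fun _ => 1

/-- The centres of the cluster orbitals and of the remaining ones. -/
def orbitalCenter (M n q : ℕ) : Fin (n ^ 3 + q) → Space :=
  Fin.append (fun i => clusterCenter M n i) fun j => axisCenter j

lemma orbitalScale_pos (hl : 0 < l) (i : Fin (n ^ 3 + q)) : 0 < orbitalScale n q l i := by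
  refine Fin.addCases (fun i => ?_) (fun j => ?_) i
  · rwa [orbitalScale, Fin.append_left]
  · rw [orbitalScale, Fin.append_right]
    exact one_pos

lemma one_le_norm_orbitalCenter (hM : 2 ≤ M) (hn : 0 < n) (i : Fin (n ^ 3 + q)) :
    1 ≤ ‖orbitalCenter M n q i‖ := by
  refine Fin.addCases (fun i => ?_) (fun j => ?_) i
  · rw [orbitalCenter, Fin.append_left]
    linarith [two_le_norm_clusterCenter hM hn i]
  · rw [orbitalCenter, Fin.append_right]
    exact one_le_norm_axisCenter j

include hg in
-- Cluster momenta exceed `2 l - l / 2`, while those of the remaining orbitals stay below `q + 1 / 2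
-- < l`.
lemma amplitude_cluster_axis (hM : 2 ≤ M) (hn : 0 < n) (hl : q + 2 ≤ l) (i : Fin (n ^ 3))
    (j : Fin q) (ξ : Space) :
    amplitude g l (clusterCenter M n i) ξ = 0 ∨ amplitude g 1 (axisCenter j) ξ = 0 := by
  by_contra! hc
  have hq : (0 : ℝ) ≤ q := Nat.cast_nonneg q
  have hl0 : 0 < l := by linarith
  have h1 := norm_sub_lt_of_amplitude_ne_zero hg hl0 hc.1
  have h2 := norm_lt_of_amplitude_ne_zero hg one_pos hc.2
  have h3 := norm_sub_norm_le (l • clusterCenter M n i) ξ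
  rw [norm_sub_rev, norm_smul, Real.norm_of_nonneg hl0.le] at h3
  rw [norm_axisCenter] at h2
  have h4 : (j : ℝ) + 1 ≤ q := by exact_mod_cast j.2
  have h5 : l * 2 ≤ l * ‖clusterCenter M n i‖ := by
    gcongr
    exact two_le_norm_clusterCenter hM hn i
  linarith

include hg in
lemma amplitude_orbital_disjoint (hM : 2 ≤ M) (hn : 0 < n) (hl : q + 2 ≤ l)
    (i j : Fin (n ^ 3 + q)) (hij : i ≠ j) (ξ : Space) :
    amplitude g (orbitalScale n q l i) (orbitalCenter M n q i) ξ = 0 ∨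
      amplitude g (orbitalScale n q l j) (orbitalCenter M n q j) ξ = 0 := by
  have hl0 : 0 < l := by linarith [(Nat.cast_nonneg q : (0 : ℝ) ≤ q)]
  revert hij
  refine Fin.addCases (fun i => ?_) (fun i => ?_) i <;>
    refine Fin.addCases (fun j => ?_) (fun j => ?_) j <;> intro hij <;>
    simp only [orbitalScale, orbitalCenter, Fin.append_left, Fin.append_right]
  · exact amplitude_disjoint hg hl0 (one_le_norm_clusterCenter_sub fun h =>
      hij (by rw [Fin.ext h])) ξ
  · exact amplitude_cluster_axis hg q hM hn hl i j ξ
  · exact (amplitude_cluster_axis hg q hM hn hl j i ξ).symm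
  · exact amplitude_disjoint hg one_pos (one_le_norm_axisCenter_sub fun h =>
      hij (by rw [Fin.ext h])) ξ

/-- There are `n ^ 3` orbitals of momentum at most of order `l n`. The mass adds to the energy only
a term independent of `l`. -/
lemma sum_kinetic_cluster_le (hl : 0 < l) (hm : 0 ≤ m) (hn : 0 < n)
    (hk : ∀ i : Fin (n ^ 3), 1 ≤ ‖clusterCenter M n i‖) :
    ∑ i : Fin (n ^ 3), ∫ ξ, diracEnergy m ξ * ‖diracOrbital hg hl hm (hk i) ξ‖ ^ 2
      ≤ l * (2 * π * (M + 4) * (n : ℝ) ^ 4) + m * (n : ℝ) ^ 3 := by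
  have hn1 : (1 : ℝ) ≤ n := by exact_mod_cast hn
  have h : ∀ i : Fin (n ^ 3), ∫ ξ, diracEnergy m ξ * ‖diracOrbital hg hl hm (hk i) ξ‖ ^ 2
      ≤ 2 * π * (l * ((M + 4) * n)) + m := fun i => by
    refine (integral_kinetic_le hg hl hm (hk i)).trans ?_
    have h1 := norm_clusterCenter_le (M := M) hn i.2
    gcongr
    linarith
  refine (Finset.sum_le_card_nsmul _ _ _ fun i _ => h i).trans (le_of_eq ?_)
  simp only [Finset.card_univ, Fintype.card_fin, nsmul_eq_mul, Nat.cast_pow]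
  ring

end Cluster

/-! ### The energy of the full trial state as a function of the momentum scale -/

section Bound

variable {g : Space → ℝ} (hg : IsProfile g) {A B : Space → Space} (hA : Continuous A)
  (hAi : Integrable A) {a : ℝ} (ha : ∀ x, ‖A x‖ ≤ a)
  (hpot : ∀ c s : ℝ, 0 < s →
    IsCoulombPotential (fun x => (c * s) • A (s • x)) (fun x => (c * s ^ 2) • B (s • x)))
  {δ : ℝ} (hδ : 0 < δ) (haδ : 2 * a * δ ≤ 1 / 4) {M : ℕ} (hM : 2 ≤ M)
  (hMδ : 3 ≤ δ ^ 2 * ((M : ℝ) - 1)) {r : ℝ} (hr : 1 ≤ r) (havg : 1 / 2 ≤ averagedPotential g A r)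
  {b : ℝ} (hb : 0 < b) (hB : ∫ x, ‖B x‖ ^ 2 ≤ b)

include hg hA hAi ha hpot hδ haδ hM hMδ hr havg hb hB in
/-- The energy of a cluster of `n ^ 3` orbitals of momentum scale `l` and of `q` further ones. -/
lemma exists_energyValues_le {α m : ℝ} (hα : 0 < α) (hm : 0 ≤ m) {n : ℕ} (hn : 0 < n) (q : ℕ)
    {K : ℕ} {Z : Fin K → ℝ} (hZ : ∀ κ, 0 ≤ Z κ) (hnZ : (n : ℝ) ^ 3 ≤ ∑ κ, Z κ) :
    ∃ E₀ : ℝ, ∀ l : ℝ, m ≤ l → r ≤ l → q + 2 ≤ l → ∃ E ∈ energyValues α m (n ^ 3 + q) Z,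
      E ≤ l * (2 * π * (M + 4) * (n : ℝ) ^ 4 - π * α * (n : ℝ) ^ 6 / (8 * b * r)) + E₀ := by
  let v : Fin q → 𝓢(Space, Spinor) := fun j =>
    diracOrbital hg one_pos hm (one_le_norm_axisCenter j)
  have hv : ∀ j, ∫ ξ, ‖v j ξ‖ ^ 2 = 1 := fun j => by
    simp only [v, norm_sq_diracOrbital]
    exact integral_amplitude_sq hg one_pos
  choose D hD0 hD using fun j => exists_norm_le_schwartz (positionOrbital (v j))
  have hρv := isDensity_orbitalDensity v
  obtain ⟨C, hC⟩ := hρv.bounded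
  -- This is the minimizer of `n ^ 3 √α c / 4 + b c ^ 2 / (8 π)`, the magnetic interaction plus the
  -- field energy per unit of `s`.
  set c : ℝ := -(π * √α * (n : ℝ) ^ 3 / b) with hcdef
  have hc : c ≤ 0 := neg_nonpos.2 (by positivity)
  -- The constant collects everything independent of `l`: the cluster mass, the kinetic and magnetic
  -- energies of the excess orbitals, and the Coulomb bound.
  refine ⟨m * (n : ℝ) ^ 3 + (∑ j, ∫ ξ, diracEnergy m ξ * ‖v j ξ‖ ^ 2)
    + (∑ j, √α * |c| * D j ^ 2 * ∫ x, ‖A x‖)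
    + α * ((∑ κ, Z κ) ^ 2 + (C * coreMass + ∫ x, orbitalDensity v x) * (n : ℝ) ^ 3
      + 1 / 2 * coulombEnergy (orbitalDensity v) (orbitalDensity v)), fun l hml hrl hql => ?_⟩
  have hl1 : 1 ≤ l := hr.trans hrl
  have hl : 0 < l := one_pos.trans_le hl1
  have hr0 : 0 < r := one_pos.trans_le hr
  have hkc : ∀ i : Fin (n ^ 3), 1 ≤ ‖clusterCenter M n i‖ := fun i => by
    linarith [two_le_norm_clusterCenter hM hn i]
  let w : Fin (n ^ 3) → 𝓢(Space, Spinor) := fun i => diracOrbital hg hl hm (hkc i)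
  have hw : ∀ j, ∫ ξ, ‖w j ξ‖ ^ 2 = 1 := fun j => by
    simp only [w, norm_sq_diracOrbital]
    exact integral_amplitude_sq hg hl
  have hρw := isDensity_orbitalDensity w
  have hwint : ∫ x, orbitalDensity w x = (n : ℝ) ^ 3 := by
    rw [integral_orbitalDensity hw]
    push_cast
    rfl
  let u : Fin (n ^ 3 + q) → 𝓢(Space, Spinor) := fun i =>
    diracOrbital hg (orbitalScale_pos q hl i) hm (one_le_norm_orbitalCenter q hM hn i)
  have hu : IsOrbitals m u := isOrbitals_diracOrbital hg hm _ _
    (amplitude_orbital_disjoint hg q hM hn hql)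
  have huw : ∀ i, u (Fin.castAdd q i) = w i := fun i => by
    simp only [u, w, orbitalScale, orbitalCenter, Fin.append_left]
  have huv : ∀ j, u (Fin.natAdd (n ^ 3) j) = v j := fun j => by
    simp only [u, v, orbitalScale, orbitalCenter, Fin.append_right]
  have hρ : orbitalDensity u = fun x => orbitalDensity w x + orbitalDensity v x := by
    funext x
    simp only [orbitalDensity, density, Fin.sum_univ_add, huw, huv]
  obtain ⟨R, hR, hRle⟩ := exists_nuclei_potential_le hρw hρv hZ
    (by rw [hwint]; positivity) (by rwa [hwint])
  -- The potential lives at length `r / l`, wider by the factor `r` than the cluster orbitals.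
  set s : ℝ := l / r with hsdef
  have hs1 : 1 ≤ s := (one_le_div hr0).2 hrl
  have hs : 0 < s := one_pos.trans_le hs1
  have hAs : Continuous fun x => (√α * c * s) • A (s • x) := by fun_prop
  have has : ∀ x, ‖(√α * c * s) • A (s • x)‖ ≤ |√α * c * s| * a := fun x => by
    rw [norm_smul, Real.norm_eq_abs]
    exact mul_le_mul_of_nonneg_left (ha _) (abs_nonneg _)
  have ht : √α * c * s ≤ 0 :=
    mul_nonpos_of_nonpos_of_nonneg (mul_nonpos_of_nonneg_of_nonpos (sqrt_nonneg _) hc) hs.le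
  refine ⟨_, ⟨_, _, R, slaterState u hu.compact, hpot c s hs, hR, isState_slaterState hu, rfl⟩, ?_⟩
  refine (energy_slaterState_le hu hα.le Z R _ (fun i j => ?_)).trans ?_
  · have h1 := integrable_magnetic hAs has (positionOrbital (u i)) (positionOrbital (u j))
    exact h1.congr (Filter.Eventually.of_forall fun x => by
      simp only [smul_smul, mul_assoc])
  rw [integral_norm_sq_scaled_field B c hs, hρ]
  simp only [smul_smul, ← mul_assoc]
  simp only [Fin.sum_univ_add, huw, huv]
  have hkin := sum_kinetic_cluster_le hg hl hm hn hkc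
  have hmagw : ∑ i, ∫ x, (inner ℂ (positionOrbital (w i) x)
      (actSpinor (alphaDot ((√α * c * s) • A (s • x))) (positionOrbital (w i) x))).re
      ≤ (n : ℝ) ^ 3 * (√α * c * s / 4) := by
    refine (Finset.sum_le_card_nsmul _ _ _ fun i _ =>
      integral_magnetic_diracOrbital_le hg hA ha hl hm (hkc i) hδ haδ havg
        (fun ξ hξ => cluster_momentum hg hl1 hml hn hMδ hM hξ) ht).trans (le_of_eq ?_)
    simp
  have hmagv : ∑ j, ∫ x, (inner ℂ (positionOrbital (v j) x)
      (actSpinor (alphaDot ((√α * c * s) • A (s • x))) (positionOrbital (v j) x))).re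
      ≤ ∑ j, √α * |c| * D j ^ 2 * ∫ x, ‖A x‖ := by
    refine Finset.sum_le_sum fun j _ => ?_
    refine (integral_magnetic_le_of_bounded hA ha hAi (v j) (hD0 j) (hD j) hs _).trans ?_
    -- The coupling grows like `s` and the volume of the potential shrinks like `s⁻³`, so the excess
    -- orbitals hardly feel it.
    have hs3 : s * (s ^ 3)⁻¹ ≤ 1 := by
      rw [← div_eq_mul_inv, div_le_one (by positivity)]
      exact le_self_pow₀ hs1 (by norm_num)
    have hnn : 0 ≤ √α * |c| * D j ^ 2 * ∫ x, ‖A x‖ := by positivity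
    rw [abs_mul, abs_mul, abs_of_nonneg (sqrt_nonneg α), abs_of_pos hs]
    calc _ = s * (s ^ 3)⁻¹ * (√α * |c| * D j ^ 2 * ∫ x, ‖A x‖) := by ring
      _ ≤ 1 * (√α * |c| * D j ^ 2 * ∫ x, ‖A x‖) := by gcongr
      _ = _ := one_mul _
  have hcoul : α * (-(∑ κ, Z κ * attraction (fun x => orbitalDensity w x + orbitalDensity v x) (R κ))
        + 1 / 2 * coulombEnergy (fun x => orbitalDensity w x + orbitalDensity v x)
          (fun x => orbitalDensity w x + orbitalDensity v x) + nuclearRepulsion Z R)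
      ≤ α * ((∑ κ, Z κ) ^ 2 + (C * coreMass + ∫ x, orbitalDensity v x) * (n : ℝ) ^ 3
        + 1 / 2 * coulombEnergy (orbitalDensity v) (orbitalDensity v)) := by
    have h1 := coulombEnergy_le hρv hρw hC
    rw [hwint] at h1
    exact mul_le_mul_of_nonneg_left (by linarith) hα.le
  have hfin : (n : ℝ) ^ 3 * (√α * c * s / 4) + 1 / (8 * π) * (c ^ 2 * s * ∫ x, ‖B x‖ ^ 2)
      ≤ -(l * (π * α * (n : ℝ) ^ 6 / (8 * b * r))) := by
    have h1 : 1 / (8 * π) * (c ^ 2 * s * ∫ x, ‖B x‖ ^ 2) ≤ 1 / (8 * π) * (c ^ 2 * s * b) := by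
      gcongr
    have e : (n : ℝ) ^ 3 * (√α * c * s / 4) + 1 / (8 * π) * (c ^ 2 * s * b)
        = -(l * (π * √α ^ 2 * (n : ℝ) ^ 6 / (8 * b * r))) := by
      rw [hcdef, hsdef]
      field_simp
      ring
    rw [Real.sq_sqrt hα.le] at e
    linarith
  simp only [mul_assoc] at hkin hmagw hmagv hcoul hfin ⊢
  linarith

end Bound

/-! ### The ground state energy -/

lemma groundStateEnergy_eq_bot {α m : ℝ} {N K : ℕ} {Z : Fin K → ℝ} {κ E₀ l₀ : ℝ} (hκ : κ < 0)
    (h : ∀ l, l₀ ≤ l → ∃ E ∈ energyValues α m N Z, E ≤ l * κ + E₀) :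
    groundStateEnergy α m N Z = ⊥ := by
  rw [groundStateEnergy, sInf_eq_bot]
  intro y hy
  obtain ⟨z, -, hz⟩ := EReal.lt_iff_exists_real_btwn.1 hy
  -- At this `l` the bound `l κ + E₀` is at most `z - 1`.
  obtain ⟨E, hE, hle⟩ := h (max l₀ ((E₀ - z + 1) / -κ)) (le_max_left _ _)
  refine ⟨E, ⟨E, hE, rfl⟩, lt_trans (EReal.coe_lt_coe_iff.2 ?_) hz⟩
  have h1 : (E₀ - z + 1) / -κ * -κ ≤ max l₀ ((E₀ - z + 1) / -κ) * -κ := by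
    gcongr
    · linarith
    · exact le_max_right _ _
  rw [div_mul_cancel₀ _ (by linarith)] at h1
  linarith

/-- A cluster size that makes the magnetic energy dominate. -/
lemma exists_clusterSize {α Γ : ℝ} (hα : 0 < α) (hΓ : 0 < Γ) : ∃ n : ℕ, 0 < n ∧
    Γ < α * (n : ℝ) ^ 2 ∧ (n : ℝ) ^ 3 ≤ (√Γ + 1) ^ 3 * max (α ^ (-(3 / 2) : ℝ)) 1 := by
  have hsα : 0 < √α := Real.sqrt_pos.2 hα
  have hα2 : √α ^ 2 = α := Real.sq_sqrt hα.le
  have hΓ2 : √Γ ^ 2 = Γ := Real.sq_sqrt hΓ.le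
  -- The witness is `⌊√(Γ / α)⌋ + 1`, the least integer above `√(Γ / α)`. The added 1 is why the
  -- bound involves `√Γ + 1` and a maximum with 1.
  have h1 := Nat.lt_floor_add_one (√Γ / √α)
  have h2 := Nat.floor_le (a := √Γ / √α) (by positivity)
  refine ⟨⌊√Γ / √α⌋₊ + 1, Nat.succ_pos _, ?_, ?_⟩
  · push_cast
    rw [div_lt_iff₀ hsα] at h1
    calc Γ = √Γ ^ 2 := hΓ2.symm
      _ < ((⌊√Γ / √α⌋₊ + 1 : ℝ) * √α) ^ 2 := by gcongr
      _ = _ := by rw [mul_pow, hα2, mul_comm]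
  · have hpow : α ^ (-(3 / 2) : ℝ) = (1 / √α) ^ 3 := by
      rw [Real.rpow_neg hα.le, Real.sqrt_eq_rpow, div_pow, one_pow, ← Real.rpow_natCast,
        ← Real.rpow_mul hα.le, one_div]
      norm_num
    have h3 : (⌊√Γ / √α⌋₊ + 1 : ℝ) ≤ (√Γ + 1) * max (1 / √α) 1 := by
      have h4 : √Γ / √α ≤ √Γ * max (1 / √α) 1 := by
        rw [div_eq_mul_one_div]
        gcongr
        exact le_max_left _ _
      have h5 : (1 : ℝ) ≤ max (1 / √α) 1 := le_max_right _ _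
      linarith
    have hmax : max (1 / √α) 1 ^ 3 = max (α ^ (-(3 / 2) : ℝ)) 1 := by
      rw [hpow]
      rcases le_total (1 / √α) 1 with h | h
      · rw [max_eq_right h, max_eq_right (pow_le_one₀ (by positivity) h), one_pow]
      · rw [max_eq_left h, max_eq_left (one_le_pow₀ h)]
    push_cast
    rw [← hmax, ← mul_pow]
    gcongr

theorem exists_instability_constant : ∃ C : ℝ, 0 < C ∧ ∀ (α m : ℝ), 0 < α → 0 ≤ m →
    ∀ (N K : ℕ) (Z : Fin K → ℝ), (∀ κ, 0 ≤ Z κ) →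
      C * max (α ^ (-(3 / 2) : ℝ)) 1 < ∑ κ, Z κ → C * max (α ^ (-(3 / 2) : ℝ)) 1 < (N : ℝ) →
      groundStateEnergy α m N Z = ⊥ := by
  obtain ⟨g, hg⟩ := exists_isProfile
  obtain ⟨A, B, hA, hAc, hA0, -, -, hpot⟩ := exists_scaled_potential
  obtain ⟨a₀, ha₀⟩ := hA.bounded_above_of_compact_support hAc
  set a := max a₀ 1 with hadef
  have ha : ∀ x, ‖A x‖ ≤ a := fun x => (ha₀ x).trans (le_max_left _ _)
  have ha0 : 0 < a := one_pos.trans_le (le_max_right _ _)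
  set δ := 1 / (8 * a) with hδdef
  have hδ : 0 < δ := by positivity
  have haδ : 2 * a * δ ≤ 1 / 4 := by
    rw [hδdef]
    apply le_of_eq
    field_simp
    norm_num
  obtain ⟨M₀, hM₀⟩ := exists_nat_ge (3 / δ ^ 2)
  set M := M₀ + 2 with hMdef
  have hM : 2 ≤ M := Nat.le_add_left _ _
  have hMδ : 3 ≤ δ ^ 2 * ((M : ℝ) - 1) := by
    rw [div_le_iff₀ (by positivity)] at hM₀
    have : 0 < δ ^ 2 := by positivity
    rw [hMdef]
    push_cast
    linarith
  obtain ⟨r, hr, havg⟩ := exists_radius hg hA ha hA0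
  set b := (∫ x, ‖B x‖ ^ 2) + 1 with hbdef
  have hb : 0 < b := add_pos_of_nonneg_of_pos (integral_nonneg fun x => sq_nonneg _) one_pos
  have hB : ∫ x, ‖B x‖ ^ 2 ≤ b := (lt_add_one _).le
  have hr0 : 0 < r := one_pos.trans_le hr
  -- This is the ratio of the kinetic coefficient `2 π (M + 4)` to the magnetic one `π / (8 b r)`;
  -- the slope in `l` is a positive multiple of `Γ - α n ^ 2`. It depends only on the fixed profile
  -- and potential, hence is universal.
  set Γ := 16 * (M + 4) * b * r with hΓdef
  have hΓ : 0 < Γ := by positivity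
  refine ⟨(√Γ + 1) ^ 3, by positivity, fun α m hα hm N K Z hZ hZsum hN => ?_⟩
  obtain ⟨n, hn, hαn, hn3⟩ := exists_clusterSize hα hΓ
  have hnN : n ^ 3 ≤ N := by exact_mod_cast hn3.trans hN.le
  obtain ⟨q, rfl⟩ := Nat.exists_eq_add_of_le hnN
  obtain ⟨E₀, hE⟩ := exists_energyValues_le hg hA (hA.integrable_of_hasCompactSupport hAc) ha hpot
    hδ haδ hM hMδ hr havg hb hB hα hm hn q hZ (hn3.trans hZsum.le)
  refine groundStateEnergy_eq_bot (l₀ := max m (max r (q + 2))) (E₀ := E₀) ?_ fun l hl =>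
    hE l ((le_max_left _ _).trans hl) (((le_max_left _ _).trans (le_max_right _ _)).trans hl)
      (((le_max_right _ _).trans (le_max_right _ _)).trans hl)
  have hn0 : (0 : ℝ) < n := by exact_mod_cast hn
  have e : 2 * π * (M + 4) * (n : ℝ) ^ 4 - π * α * (n : ℝ) ^ 6 / (8 * b * r)
      = π * (n : ℝ) ^ 4 / (8 * b * r) * (Γ - α * (n : ℝ) ^ 2) := by
    rw [hΓdef]
    field_simp
    ring
  rw [e]
  exact mul_neg_of_pos_of_neg (by positivity) (sub_neg.2 hαn)

end BrownRavenhall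

end

theorem mainTheorem2 :
    ∃ C : ℝ, 0 < C ∧
      ∀ (α m : ℝ), 0 < α → 0 ≤ m →
        ∀ (N K : ℕ) (Z : Fin K → ℝ), (∀ κ, 0 ≤ Z κ) →
          C * max (α ^ (-(3 / 2) : ℝ)) 1 < ∑ κ, Z κ →
          C * max (α ^ (-(3 / 2) : ℝ)) 1 < (N : ℝ) →
          2 < ∑ κ, Z κ ^ 2 →
          BrownRavenhall.groundStateEnergy α m N Z = ⊥ := by
  obtain ⟨C, hC, h⟩ := BrownRavenhall.exists_instability_constant
  exact ⟨C, hC, fun α m hα hm N K Z hZ hZsum hN _ => h α m hα hm N K Z hZ hZsum hN⟩
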